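/- Let $0<q<1$ and $[x]=\dfrac{q^{x}-q^{-x}}{q-q^{-1}}$ for $x\in\mathbb C$. **The algebra.** Let $H=U_q(su(2))$ be the Hopf algebra generated by $q^{\pm J_z},J_\pm$ with $q^{\pm J_z}q^{\mp J_z}=1$, $q^{J_z}J_\pm q^{-J_z}=q^{\pm1}J_\pm$, $[J_+,J_-]=\frac{q^{2J_z}-q^{-2J_z}}{q-q^{-1}}$, $\Delta(q^{\pm J_z})=q^{\pm J_z}\otimes q^{\pm J_z}$, $\Delta(J_\pm)=q^{-J_z}\otimes J_\pm+J_\pm\otimes q^{J_z}$. For $B\in\frac12\mathbb N$ let $\pi^B$ be its spin $B$ representation, $q^{J_z}e_m=q^me_m$, $J_\pm e_m=q^{\pm1/2}\sqrt{[B\pm m+1][B\mp m]}\,e_{m\pm1}$ ($m=-B,\dots,B$), and let $g^B_{ij}=\pi^B(\cdot)_{ij}$ be its matrix elements. They span the restricted dual $H^{*}$, with the convolution product. Let $D=U_q(sl(2,\mathbb C)_{\mathbb R})$ be the quantum double of $H$: the algebra generated by the subalgebras $H$ and $H^{*}$ with the relations $\sum_i \pi^B(x_{(2)})_{ni}\,x_{(1)}\,g^B_{ij}=\sum_i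 g^B_{ni}\,\pi^B(x_{(1)})_{ij}\,x_{(2)}$ ($x\in H$). Let $R=\sum_i e_i\otimes e^i$ be its universal $R$-matrix, where $(e_i)$, $(e^i)$ are dual bases of $H$ and $H^*$, let $R'=\sum_i e^i\otimes e_i$, and $\mu=q^{2J_z}$. **Finite-dimensional representations.** For $I=(I^l,I^r)\in\frac12\mathbb N\times\frac12\mathbb N$ let $\Pi_I$ be the representation of $D$ on $V_{I^l}\otimes V_{I^r}$ in which $H$ acts by $(\pi^{I^l}\otimes\pi^{I^r})\circ\Delta$ and $f\in H^{*}$ acts by the matrix with entries $f\big(L^{(-)}_{a'b'}L^{(+)}_{ab}\big)$ (row $(a,a')$, column $(b,b')$), where $L^{(+)}=(\mathrm{id}\otimes\pi^{I^l})(R^{(+)})$, $L^{(-)}=(\mathrm{id}\otimes\pi^{I^r})(R^{(-)})$, with $R^{(+)}=q^{2J_z\otimes J_z}\sum_{n\ge0}\frac{(q-q^{-1})^nq^{n(n-1)/2}}{[n]!}(q^{J_z}J_+)^n\otimes(J_-q^{-J_z})^n$ and $R^{(-)}=(R^{(+)}_{21})^{-1}$. Put $$c_I=\mathrm{tr}_{V_I}\big((\Pi_I(\mu)\otimes1)\,(\Pi_I\otimes\mathrm{id})(RR')\big)\in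 D .$$ **Principal series.** Let $\alpha=(\alpha^l,\alpha^r)\in\mathbb C^2$ with $\alpha^l-\alpha^r\in\frac12\mathbb Z$ and $\alpha^l+\alpha^r+1\in i\mathbb R$. Let $\Pi_\alpha$ be the principal series representation of $D$ with label $\alpha$, realized as the space of linear functionals $\varphi$ on $D$ that are $H$-finite for the action $(d\cdot\varphi)(y)=\varphi(yd)$ of $D$ and satisfy $\varphi(g^B_{ij}d)=\delta_{ij}\,q^{2(\alpha^l+\alpha^r)m_i}\varphi(d)$ (where $m_i$ is the weight of the $i$-th basis vector of $V_B$) and $\varphi(q^{J_z}d)=q^{\alpha^l-\alpha^r}\varphi(d)$ for all $d\in D$, with that action of $D$. **Proposition.** The element $c_I$ is central in $D$, and it acts on the module of $\Pi_\alpha$ by a scalar $\vartheta_{I\alpha}$, namely $$\vartheta_{I\alpha}=\frac{[(2I^l+1)(2\alpha^l+1)]}{[2\alpha^l+1]}\;\frac{[(2I^r+1)(2\alpha^r+1)]}{[2\alpha^r+1]}$$ if $[2\alpha^l+1]\ne0$ and $[2\alpha^r+1]\neq0$. In all cases $$\vartheta_{I\alpha}=\lim_{z\to0}\frac{[(2I^l+1)(2\alpha^l+1+z)]}{[2\alpha^l+1+z]}\;\frac{[(2I^r+1)(2\alpha^r+1+z)]}{[2\alpha^r+1+z]}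 ,$$ i.e. the formula holds with the quotients extended by continuity at the zeros of their denominators. -/

import Mathlib

open scoped TensorProduct

noncomputable section

namespace QuantumLorentz

/-! ## Deformation parameter and quantum numbers -/

/-- The deformation parameter: a real number `q` with `0 < q < 1`. -/
abbrev DefParam : Type := Set.Ioo (0 : ℝ) 1

/-- `q` as a complex number. -/
def qc (q : DefParam) : ℂ := ((q : ℝ) : ℂ)

/-- `q ^ x` for complex `x`. -/
def qpow (q : DefParam) (x : ℂ) : ℂ := qc q ^ x

/-- The quantum number `[x] = (q ^ x - q ^ (-x)) / (q - q⁻¹)`. -/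
def qnum (q : DefParam) (x : ℂ) : ℂ := (qpow q x - qpow q (-x)) / (qc q - (qc q)⁻¹)

theorem qc_ne_zero (q : DefParam) : qc q ≠ 0 := by
  have := q.2.1
  simp only [qc, ne_eq, Complex.ofReal_eq_zero]
  exact this.ne'

theorem qpow_add (q : DefParam) (x y : ℂ) : qpow q (x + y) = qpow q x * qpow q y :=
  Complex.cpow_add _ _ (qc_ne_zero q)

theorem qpow_neg (q : DefParam) (x : ℂ) : qpow q (-x) = (qpow q x)⁻¹ := Complex.cpow_neg _ _

theorem qpow_sub (q : DefParam) (x y : ℂ) : qpow q (x - y) = qpow q x * (qpow q y)⁻¹ := by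
  rw [sub_eq_add_neg, qpow_add, qpow_neg]

theorem qpow_ne_zero (q : DefParam) (x : ℂ) : qpow q x ≠ 0 := by
  intro h
  have h1 := qpow_add q x (-x)
  rw [h, zero_mul, add_neg_cancel] at h1
  simp [qpow] at h1

theorem qpow_one (q : DefParam) : qpow q 1 = qc q := Complex.cpow_one _

theorem qpow_zero (q : DefParam) : qpow q 0 = 1 := Complex.cpow_zero _

theorem qpow_natCast (q : DefParam) (n : ℕ) : qpow q n = qc q ^ n := Complex.cpow_natCast _ _

theorem qc_pow_ne_one (q : DefParam) (n : ℕ) : qc q ^ (n + 1) ≠ 1 := by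
  intro h
  have h1 : ((q : ℝ)) ^ (n + 1) = 1 := by
    rw [qc] at h
    exact_mod_cast h
  exact (pow_lt_one₀ q.2.1.le q.2.2 (Nat.succ_ne_zero n)).ne h1

theorem lam_ne_zero (q : DefParam) : qc q - (qc q)⁻¹ ≠ 0 := by
  intro h
  have h0 := qc_ne_zero q
  have := qc_pow_ne_one q 1
  apply this
  field_simp at h
  linear_combination h

/-! ## The Hopf algebra `U_q(su(2))`

It is generated by `K = q ^ J_z`, its inverse, and `J₊`, `J₋`.  (The star structure of
the paper plays no role in the statement.) -/

inductive UqGen : Type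
  | K | Kinv | Jp | Jm

open UqGen in
/-- The defining relations of `U_q(su(2))`. -/
inductive UqRel (q : DefParam) : FreeAlgebra ℂ UqGen → FreeAlgebra ℂ UqGen → Prop
  | K_Kinv : UqRel q (FreeAlgebra.ι ℂ K * FreeAlgebra.ι ℂ Kinv) 1
  | Kinv_K : UqRel q (FreeAlgebra.ι ℂ Kinv * FreeAlgebra.ι ℂ K) 1
  | K_Jp : UqRel q (FreeAlgebra.ι ℂ K * FreeAlgebra.ι ℂ Jp * FreeAlgebra.ι ℂ Kinv)
      (qc q • FreeAlgebra.ι ℂ Jp)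
  | K_Jm : UqRel q (FreeAlgebra.ι ℂ K * FreeAlgebra.ι ℂ Jm * FreeAlgebra.ι ℂ Kinv)
      ((qc q)⁻¹ • FreeAlgebra.ι ℂ Jm)
  | Jp_Jm : UqRel q
      (FreeAlgebra.ι ℂ Jp * FreeAlgebra.ι ℂ Jm - FreeAlgebra.ι ℂ Jm * FreeAlgebra.ι ℂ Jp)
      ((qc q - (qc q)⁻¹)⁻¹ • (FreeAlgebra.ι ℂ K * FreeAlgebra.ι ℂ K
        - FreeAlgebra.ι ℂ Kinv * FreeAlgebra.ι ℂ Kinv))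

/-- The algebra `U_q(su(2))`. -/
def Uq (q : DefParam) : Type := RingQuot (UqRel q)

instance (q : DefParam) : Ring (Uq q) := inferInstanceAs (Ring (RingQuot (UqRel q)))

instance instAlgebraUq (q : DefParam) : Algebra ℂ (Uq q) :=
  inferInstanceAs (Algebra ℂ (RingQuot (UqRel q)))

namespace Uq

/-- The canonical projection from the free algebra. -/
def mk (q : DefParam) : FreeAlgebra ℂ UqGen →ₐ[ℂ] Uq q := RingQuot.mkAlgHom ℂ (UqRel q)

theorem mk_surjective (q : DefParam) : Function.Surjective (mk q) :=
  RingQuot.mkAlgHom_surjective ℂ (UqRel q)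

theorem mk_rel {q : DefParam} {a b : FreeAlgebra ℂ UqGen} (h : UqRel q a b) :
    mk q a = mk q b := RingQuot.mkAlgHom_rel ℂ h

/-- `K = q ^ J_z`. -/
def K (q : DefParam) : Uq q := mk q (FreeAlgebra.ι ℂ UqGen.K)
/-- `K⁻¹ = q ^ (-J_z)`. -/
def Kinv (q : DefParam) : Uq q := mk q (FreeAlgebra.ι ℂ UqGen.Kinv)
/-- `J₊`. -/
def Jp (q : DefParam) : Uq q := mk q (FreeAlgebra.ι ℂ UqGen.Jp)
/-- `J₋`. -/
def Jm (q : DefParam) : Uq q := mk q (FreeAlgebra.ι ℂ UqGen.Jm)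

theorem K_Kinv (q : DefParam) : K q * Kinv q = 1 := by
  simpa [K, Kinv] using mk_rel (UqRel.K_Kinv (q := q))

theorem Kinv_K (q : DefParam) : Kinv q * K q = 1 := by
  simpa [K, Kinv] using mk_rel (UqRel.Kinv_K (q := q))

end Uq

/-- Elements `k, k', p, m` of an algebra satisfying the relations of
`q ^ J_z, q ^ (-J_z), J₊, J₋` with parameter `Q`. -/
structure UqTuple {A : Type*} [Ring A] [Algebra ℂ A] (Q : ℂ) (k k' p m : A) : Prop where
  kk' : k * k' = 1
  k'k : k' * k = 1
  kp : k * p = Q • (p * k)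
  km : k * m = Q⁻¹ • (m * k)
  pm : p * m - m * p = (Q - Q⁻¹)⁻¹ • (k * k - k' * k')

theorem Uq.tuple (q : DefParam) : UqTuple (qc q) (Uq.K q) (Uq.Kinv q) (Uq.Jp q) (Uq.Jm q) where
  kk' := Uq.K_Kinv q
  k'k := Uq.Kinv_K q
  kp := by
    have h := Uq.mk_rel (UqRel.K_Jp (q := q))
    simp only [map_mul, map_smul] at h
    change Uq.K q * Uq.Jp q * Uq.Kinv q = qc q • Uq.Jp q at h
    rw [← smul_mul_assoc, ← h, mul_assoc, Uq.Kinv_K, mul_one]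
  km := by
    have h := Uq.mk_rel (UqRel.K_Jm (q := q))
    simp only [map_mul, map_smul] at h
    change Uq.K q * Uq.Jm q * Uq.Kinv q = (qc q)⁻¹ • Uq.Jm q at h
    rw [← smul_mul_assoc, ← h, mul_assoc, Uq.Kinv_K, mul_one]
  pm := by
    have h := Uq.mk_rel (UqRel.Jp_Jm (q := q))
    simpa only [map_mul, map_smul, map_sub] using! h

namespace Uq

/-- The universal property of `U_q(su(2))`. -/
def lift {q : DefParam} {A : Type*} [Ring A] [Algebra ℂ A] {k k' p m : A}
    (h : UqTuple (qc q) k k' p m) : Uq q →ₐ[ℂ] A :=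
  RingQuot.liftAlgHom ℂ ⟨FreeAlgebra.lift ℂ fun g => match g with
      | UqGen.K => k | UqGen.Kinv => k' | UqGen.Jp => p | UqGen.Jm => m, by
    intro a b hab
    cases hab with
    | K_Kinv => simpa using h.kk'
    | Kinv_K => simpa using h.k'k
    | K_Jp =>
      simp only [map_mul, map_smul, FreeAlgebra.lift_ι_apply]
      rw [h.kp, smul_mul_assoc, mul_assoc, h.kk', mul_one]
    | K_Jm =>
      simp only [map_mul, map_smul, FreeAlgebra.lift_ι_apply]
      rw [h.km, smul_mul_assoc, mul_assoc, h.kk', mul_one]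
    | Jp_Jm => simpa using h.pm⟩

section
variable {q : DefParam} {A : Type*} [Ring A] [Algebra ℂ A] {k k' p m : A}
    (h : UqTuple (qc q) k k' p m)

theorem lift_mk_ι (g : UqGen) : lift h (mk q (FreeAlgebra.ι ℂ g)) =
    (match g with
      | UqGen.K => k | UqGen.Kinv => k' | UqGen.Jp => p | UqGen.Jm => m) :=
  (RingQuot.liftAlgHom_mkAlgHom_apply ℂ _ _ _).trans (FreeAlgebra.lift_ι_apply _ _)

@[simp] theorem lift_K : lift h (K q) = k := lift_mk_ι h UqGen.K
@[simp] theorem lift_Kinv : lift h (Kinv q) = k' := lift_mk_ι h UqGen.Kinv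
@[simp] theorem lift_Jp : lift h (Jp q) = p := lift_mk_ι h UqGen.Jp
@[simp] theorem lift_Jm : lift h (Jm q) = m := lift_mk_ι h UqGen.Jm
end

theorem induction {q : DefParam} {P : Uq q → Prop}
    (hc : ∀ c : ℂ, P (algebraMap ℂ _ c)) (hK : P (K q)) (hKinv : P (Kinv q))
    (hJp : P (Jp q)) (hJm : P (Jm q)) (hadd : ∀ x y, P x → P y → P (x + y))
    (hmul : ∀ x y, P x → P y → P (x * y)) (x : Uq q) : P x := by
  obtain ⟨a, rfl⟩ := mk_surjective q x
  induction a using FreeAlgebra.induction with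
  | grade0 c => simpa using hc c
  | grade1 g => cases g <;> assumption
  | mul a b ha hb => simpa using hmul _ _ ha hb
  | add a b ha hb => simpa using hadd _ _ ha hb

theorem hom_ext {q : DefParam} {A : Type*} [Ring A] [Algebra ℂ A] {f g : Uq q →ₐ[ℂ] A}
    (hK : f (K q) = g (K q)) (hKinv : f (Kinv q) = g (Kinv q)) (hJp : f (Jp q) = g (Jp q))
    (hJm : f (Jm q) = g (Jm q)) : f = g := by
  ext x
  induction x using induction with
  | hc c => simp
  | hK => exact hK
  | hKinv => exact hKinv
  | hJp => exact hJp
  | hJm => exact hJm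
  | hadd x y hx hy => simp [hx, hy]
  | hmul x y hx hy => simp [hx, hy]

end Uq

namespace UqTuple

variable {A : Type*} [Ring A] [Algebra ℂ A] {Q : ℂ} {k k' p m : A}

theorem pk (h : UqTuple Q k k' p m) (hQ : Q ≠ 0) : p * k = Q⁻¹ • (k * p) := by
  rw [h.kp, smul_smul, inv_mul_cancel₀ hQ, one_smul]

theorem mkk (h : UqTuple Q k k' p m) (hQ : Q ≠ 0) : m * k = Q • (k * m) := by
  rw [h.km, smul_smul, mul_inv_cancel₀ hQ, one_smul]

theorem k'p (h : UqTuple Q k k' p m) (hQ : Q ≠ 0) : k' * p = Q⁻¹ • (p * k') := by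
  have h1 : k' * p = k' * (p * k) * k' := by simp only [mul_assoc, h.kk', mul_one]
  rw [h1, h.pk hQ, mul_smul_comm, ← mul_assoc, h.k'k, one_mul, smul_mul_assoc]

theorem k'm (h : UqTuple Q k k' p m) (hQ : Q ≠ 0) : k' * m = Q • (m * k') := by
  have h1 : k' * m = k' * (m * k) * k' := by simp only [mul_assoc, h.kk', mul_one]
  rw [h1, h.mkk hQ, mul_smul_comm, ← mul_assoc, h.k'k, one_mul, smul_mul_assoc]

end UqTuple

namespace Uq

theorem comul_tuple (q : DefParam) : UqTuple (qc q) (K q ⊗ₜ[ℂ] K q) (Kinv q ⊗ₜ[ℂ] Kinv q)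
    (Kinv q ⊗ₜ[ℂ] Jp q + Jp q ⊗ₜ[ℂ] K q) (Kinv q ⊗ₜ[ℂ] Jm q + Jm q ⊗ₜ[ℂ] K q) := by
  have h := Uq.tuple q
  have hq := qc_ne_zero q
  constructor
  · simp [K_Kinv, Algebra.TensorProduct.one_def]
  · simp [Kinv_K, Algebra.TensorProduct.one_def]
  · simp only [mul_add, add_mul, Algebra.TensorProduct.tmul_mul_tmul, h.kp, K_Kinv, Kinv_K,
      TensorProduct.tmul_smul, TensorProduct.smul_tmul', smul_add]
  · simp only [mul_add, add_mul, Algebra.TensorProduct.tmul_mul_tmul, h.km, K_Kinv, Kinv_K,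
      TensorProduct.tmul_smul, TensorProduct.smul_tmul', smul_add]
  · have e : Jp q * Jm q = Jm q * Jp q
        + (qc q - (qc q)⁻¹)⁻¹ • (K q * K q - Kinv q * Kinv q) := by
      rw [← h.pm]; abel
    have pK := h.pk hq
    have kp' := h.k'p hq
    have km' := h.k'm hq
    simp only [mul_add, add_mul, Algebra.TensorProduct.tmul_mul_tmul, e, h.km, h.kp, kp', km', TensorProduct.tmul_add, TensorProduct.add_tmul, TensorProduct.tmul_sub,
      TensorProduct.sub_tmul, TensorProduct.tmul_smul, ← TensorProduct.smul_tmul', smul_sub]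
    abel

/-- The coproduct: `Δ(q^{±J_z}) = q^{±J_z} ⊗ q^{±J_z}`,
`Δ(J_±) = q^{-J_z} ⊗ J_± + J_± ⊗ q^{J_z}`. -/
def comulHom (q : DefParam) : Uq q →ₐ[ℂ] Uq q ⊗[ℂ] Uq q := lift (comul_tuple q)

theorem counit_tuple (q : DefParam) : UqTuple (qc q) (1 : ℂ) 1 0 0 := by
  constructor <;> simp

/-- The counit. -/
def counitHom (q : DefParam) : Uq q →ₐ[ℂ] ℂ := lift (counit_tuple q)

instance instBialgebra (q : DefParam) : Bialgebra ℂ (Uq q) :=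
  Bialgebra.ofAlgHom (comulHom q) (counitHom q)
    (by
      apply hom_ext <;>
        simp [comulHom, TensorProduct.tmul_add, TensorProduct.add_tmul, add_assoc])
    (by
      apply hom_ext <;>
        simp [comulHom, counitHom])
    (by
      apply hom_ext <;>
        simp [comulHom, counitHom])

theorem comul_K (q : DefParam) : Coalgebra.comul (R := ℂ) (K q) = K q ⊗ₜ[ℂ] K q :=
  lift_K (comul_tuple q)
theorem comul_Kinv (q : DefParam) :
    Coalgebra.comul (R := ℂ) (Kinv q) = Kinv q ⊗ₜ[ℂ] Kinv q := lift_Kinv (comul_tuple q)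
theorem comul_Jp (q : DefParam) :
    Coalgebra.comul (R := ℂ) (Jp q) = Kinv q ⊗ₜ[ℂ] Jp q + Jp q ⊗ₜ[ℂ] K q :=
  lift_Jp (comul_tuple q)
theorem comul_Jm (q : DefParam) :
    Coalgebra.comul (R := ℂ) (Jm q) = Kinv q ⊗ₜ[ℂ] Jm q + Jm q ⊗ₜ[ℂ] K q :=
  lift_Jm (comul_tuple q)
theorem counit_K (q : DefParam) : Coalgebra.counit (R := ℂ) (K q) = 1 :=
  lift_K (counit_tuple q)
theorem counit_Kinv (q : DefParam) : Coalgebra.counit (R := ℂ) (Kinv q) = 1 :=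
  lift_Kinv (counit_tuple q)
theorem counit_Jp (q : DefParam) : Coalgebra.counit (R := ℂ) (Jp q) = 0 :=
  lift_Jp (counit_tuple q)
theorem counit_Jm (q : DefParam) : Coalgebra.counit (R := ℂ) (Jm q) = 0 :=
  lift_Jm (counit_tuple q)

end Uq

/-! ## The spin representations -/

/-- The weight `m = I - k` of the `k`-th basis vector of the spin `I = N / 2` representation,
`k = 0, …, N`. -/
def wt (N k : ℕ) : ℂ := (N : ℂ) / 2 - k

/-- The matrix of `q ^ (c J_z)` in the spin `N / 2` representation, `c ∈ ℂ`. -/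
def spinK (q : DefParam) (c : ℂ) (N : ℕ) : Matrix (Fin (N + 1)) (Fin (N + 1)) ℂ :=
  Matrix.diagonal fun k => qpow q (c * wt N k)

/-- `J₊ e_m = q^{1/2} √([I + m + 1] [I - m]) e_{m+1}`. -/
def spinJp (q : DefParam) (N : ℕ) : Matrix (Fin (N + 1)) (Fin (N + 1)) ℂ :=
  Matrix.of fun a b => if (a : ℕ) + 1 = b then
    qpow q (1 / 2) * (qnum q (N / 2 + wt N b + 1) * qnum q (N / 2 - wt N b)) ^ (1 / 2 : ℂ) else 0

/-- `J₋ e_m = q^{-1/2} √([I - m + 1] [I + m]) e_{m-1}`. -/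
def spinJm (q : DefParam) (N : ℕ) : Matrix (Fin (N + 1)) (Fin (N + 1)) ℂ :=
  Matrix.of fun a b => if (a : ℕ) = b + 1 then
    qpow q (-1 / 2) * (qnum q (N / 2 - wt N b + 1) * qnum q (N / 2 + wt N b)) ^ (1 / 2 : ℂ) else 0

theorem qnum_neg (q : DefParam) (x : ℂ) : qnum q (-x) = - qnum q x := by
  simp only [qnum, neg_neg]; ring

theorem sqrt_aux (q : DefParam) (z : ℂ) :
    qpow q (1 / 2) * z ^ (1 / 2 : ℂ) * (qpow q (-1 / 2) * z ^ (1 / 2 : ℂ)) = z := by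
  have h1 : qpow q (1 / 2) * qpow q (-1 / 2) = 1 := by
    rw [← qpow_add, ← qpow_zero q]; congr 1; ring
  have h2 : z ^ (1 / 2 : ℂ) * z ^ (1 / 2 : ℂ) = z := by
    have := Complex.cpow_nat_inv_pow z (n := 2) (by norm_num)
    rw [pow_two] at this
    simpa using this
  calc _ = (qpow q (1 / 2) * qpow q (-1 / 2)) * (z ^ (1 / 2 : ℂ) * z ^ (1 / 2 : ℂ)) := by ring
    _ = z := by rw [h1, h2, one_mul]

/-- `J₊ J₋` on the vector `a` (with `J₊ J₋ = 0` on the lowest weight vector). -/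
theorem spinJp_mul_spinJm (q : DefParam) (N : ℕ) :
    spinJp q N * spinJm q N = Matrix.diagonal fun a : Fin (N + 1) =>
      qnum q ((a : ℂ) + 1) * qnum q ((N : ℂ) - a) := by
  ext a b
  rw [Matrix.mul_apply, Matrix.diagonal_apply]
  by_cases ha : (a : ℕ) < N
  · rw [Finset.sum_eq_single (⟨a + 1, by omega⟩ : Fin (N + 1))]
    · by_cases hab : a = b
      · subst hab
        simp only [spinJp, spinJm, Matrix.of_apply, if_true]
        have e1 : (N : ℂ) / 2 + wt N ((a : ℕ) + 1) + 1 = (N : ℂ) - a := by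
          simp only [wt]; push_cast; ring
        have e2 : (N : ℂ) / 2 - wt N ((a : ℕ) + 1) = (a : ℂ) + 1 := by
          simp only [wt]; push_cast; ring
        have e3 : (N : ℂ) / 2 - wt N (a : ℕ) + 1 = (a : ℂ) + 1 := by
          simp only [wt]; ring
        have e4 : (N : ℂ) / 2 + wt N (a : ℕ) = (N : ℂ) - a := by
          simp only [wt]; ring
        rw [e1, e2, e3, e4, mul_comm (qnum q ((N : ℂ) - a))]
        exact sqrt_aux q _
      · have : ¬ ((a : ℕ) = b) := fun h => hab (Fin.ext h)
        simp [spinJm, hab, this]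
    · intro c _ hc
      have : ¬ ((a : ℕ) + 1 = c) := fun h => hc (Fin.ext h.symm)
      simp [spinJp, this]
    · simp
  · have haN : (a : ℕ) = N := by omega
    rw [Finset.sum_eq_zero]
    · simp [haN, qnum]
    · intro c _
      have : ¬ ((a : ℕ) + 1 = c) := by omega
      simp [spinJp, this]

theorem spinJm_mul_spinJp (q : DefParam) (N : ℕ) :
    spinJm q N * spinJp q N = Matrix.diagonal fun a : Fin (N + 1) =>
      qnum q (a : ℂ) * qnum q ((N : ℂ) - a + 1) := by
  ext a b
  rw [Matrix.mul_apply, Matrix.diagonal_apply]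
  by_cases ha : 0 < (a : ℕ)
  · rw [Finset.sum_eq_single (⟨a - 1, by omega⟩ : Fin (N + 1))]
    · by_cases hab : a = b
      · subst hab
        have h1 : (a : ℕ) = (a : ℕ) - 1 + 1 := by omega
        have h2 : (((a : ℕ) - 1 : ℕ) : ℂ) = (a : ℂ) - 1 := by
          rw [Nat.cast_sub (by omega)]; simp
        simp only [spinJp, spinJm, Matrix.of_apply, ← h1, if_true]
        have e1 : (N : ℂ) / 2 + wt N (a : ℕ) + 1 = (N : ℂ) - a + 1 := by
          simp only [wt]; ring
        have e2 : (N : ℂ) / 2 - wt N (a : ℕ) = (a : ℂ) := by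
          simp only [wt]; ring
        have e3 : (N : ℂ) / 2 - wt N ((a : ℕ) - 1) + 1 = (a : ℂ) := by
          simp only [wt, h2]; ring
        have e4 : (N : ℂ) / 2 + wt N ((a : ℕ) - 1) = (N : ℂ) - a + 1 := by
          simp only [wt, h2]; ring
        rw [e1, e2, e3, e4, mul_comm (qnum q ((N : ℂ) - a + 1)), mul_comm]
        exact sqrt_aux q _
      · have : ¬ ((a : ℕ) - 1 + 1 = b) := fun h => hab (Fin.ext (by omega))
        simp [spinJp, hab, this]
    · intro c _ hc
      have : ¬ ((a : ℕ) = c + 1) := fun h => hc (Fin.ext (by simp; omega))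
      simp [spinJm, this]
    · simp
  · have ha0 : (a : ℕ) = 0 := by omega
    rw [Finset.sum_eq_zero]
    · simp [ha0, qnum]
    · intro c _
      have : ¬ ((a : ℕ) = c + 1) := by omega
      simp [spinJm, this]

theorem spin_tuple (q : DefParam) (N : ℕ) :
    UqTuple (qc q) (spinK q 1 N) (spinK q (-1) N) (spinJp q N) (spinJm q N) := by
  have hq := qc_ne_zero q
  constructor
  · rw [spinK, spinK, Matrix.diagonal_mul_diagonal, ← Matrix.diagonal_one]
    congr 1; ext k; rw [← qpow_add]; simp [qpow_zero]
  · rw [spinK, spinK, Matrix.diagonal_mul_diagonal, ← Matrix.diagonal_one]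
    congr 1; ext k; rw [← qpow_add]; simp [qpow_zero]
  · ext a b
    simp only [spinK, Matrix.diagonal_mul, Matrix.mul_diagonal, Matrix.smul_apply, smul_eq_mul,
      spinJp, Matrix.of_apply]
    split_ifs with h
    · have : qpow q (1 * wt N a) = qc q * qpow q (1 * wt N b) := by
        rw [← qpow_one, ← qpow_add]; congr 1; simp only [wt, ← h]; push_cast; ring
      rw [this]; ring
    · simp
  · ext a b
    simp only [spinK, Matrix.diagonal_mul, Matrix.mul_diagonal, Matrix.smul_apply, smul_eq_mul,
      spinJm, Matrix.of_apply]
    split_ifs with h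
    · have : qpow q (1 * wt N a) = (qc q)⁻¹ * qpow q (1 * wt N b) := by
        rw [← qpow_one, ← qpow_neg, ← qpow_add]; congr 1; simp only [wt, h]; push_cast; ring
      rw [this]; ring
    · simp
  · rw [spinJp_mul_spinJm, spinJm_mul_spinJp]
    simp only [spinK, Matrix.diagonal_mul_diagonal, Matrix.diagonal_sub]
    rw [← Matrix.diagonal_smul]
    congr 1
    ext a
    have hl : qc q ^ 2 - 1 ≠ 0 := sub_ne_zero.2 (qc_pow_ne_one q 1)
    have h1 := qpow_ne_zero q a
    have h2 : qpow q N = qpow q (N/2) * qpow q (N/2) := by rw [← qpow_add]; congr 1; ring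
    have h3 := qpow_ne_zero q (N/2)
    simp only [Pi.smul_apply, smul_eq_mul, qnum, wt, neg_mul, one_mul, neg_sub, neg_add, qpow_add,
      qpow_sub, qpow_neg, qpow_one, h2]
    field_simp
    ring

/-- The spin `N / 2` representation of `U_q(su(2))`, in the basis `e_m`,
`m = N/2, N/2 - 1, …, -N/2`. -/
def spinRep (q : DefParam) (N : ℕ) : Uq q →ₐ[ℂ] Matrix (Fin (N + 1)) (Fin (N + 1)) ℂ :=
  Uq.lift (spin_tuple q N)

/-! ## The restricted dual and the quantum double -/

/-- The matrix element `g^B_{ij} : x ↦ π^B(x)_{ij}` of the spin `B = N / 2` representation, as an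
element of the dual of `U_q(su(2))` with its convolution product
`(f * f')(x) = ∑ f(x₍₁₎) f'(x₍₂₎)`. -/
def coeff (q : DefParam) (N : ℕ) (i j : Fin (N + 1)) : WithConv (Uq q →ₗ[ℂ] ℂ) :=
  WithConv.toConv (Matrix.entryLinearMap ℂ ℂ i j ∘ₗ (spinRep q N).toLinearMap)

/-- The restricted dual `U_q(su(2))^*` : the algebra of functionals generated (in fact, spanned)
by the matrix elements of the spin representations. -/
def Oq (q : DefParam) : Subalgebra ℂ (WithConv (Uq q →ₗ[ℂ] ℂ)) :=
  Algebra.adjoin ℂ {f | ∃ (N : ℕ) (i j : Fin (N + 1)), f = coeff q N i j}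

/-- `g^B_{ij}` as an element of the restricted dual, `B = N / 2`. -/
def g (q : DefParam) (N : ℕ) (i j : Fin (N + 1)) : Oq q :=
  ⟨coeff q N i j, Algebra.subset_adjoin ⟨N, i, j, rfl⟩⟩

/-- The pairing of an element of the restricted dual with an element of `U_q(su(2))`. -/
def evalO {q : DefParam} (f : Oq q) : Uq q →ₗ[ℂ] ℂ := f.1.ofConv

theorem evalO_g (q : DefParam) (N : ℕ) (i j : Fin (N + 1)) (x : Uq q) :
    evalO (g q N i j) x = spinRep q N x i j := rfl

section legs

variable {q : DefParam} {ι : Type} [Fintype ι] [DecidableEq ι]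

/-- `x ↦ x ⊗ 1`, from `U_q(su(2))` to `U_q(su(2)) ⊗ End(ℂ^ι)`, the latter seen as matrices with
entries in `U_q(su(2))`. -/
def leg (q : DefParam) (ι : Type) [Fintype ι] [DecidableEq ι] : Uq q →ₐ[ℂ] Matrix ι ι (Uq q) :=
  Matrix.scalarAlgHom ι ℂ

/-- `M ↦ 1 ⊗ M`, from `End(ℂ^ι)` to `U_q(su(2)) ⊗ End(ℂ^ι)`. -/
def legM (q : DefParam) (ι : Type) [Fintype ι] [DecidableEq ι] :
    Matrix ι ι ℂ →ₐ[ℂ] Matrix ι ι (Uq q) :=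
  (Algebra.ofId ℂ (Uq q)).mapMatrix

theorem leg_comm (x : Uq q) (M : Matrix ι ι ℂ) : Commute (leg q ι x) (legM q ι M) := by
  ext i j
  simp [leg, legM, Algebra.ofId_apply, Algebra.commutes, Matrix.scalar]

/-- `x ↦ ∑ x₍₁₎ ⊗ π(x₍₂₎)`. -/
def actL (π : Uq q →ₐ[ℂ] Matrix ι ι ℂ) : Uq q →ₐ[ℂ] Matrix ι ι (Uq q) :=
  (Algebra.TensorProduct.lift (leg q ι) ((legM q ι).comp π)
    fun x y => leg_comm x (π y)).comp (Uq.comulHom q)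

/-- `x ↦ ∑ x₍₂₎ ⊗ π(x₍₁₎)`. -/
def actR (π : Uq q →ₐ[ℂ] Matrix ι ι ℂ) : Uq q →ₐ[ℂ] Matrix ι ι (Uq q) :=
  (Algebra.TensorProduct.lift ((legM q ι).comp π) (leg q ι)
    fun x y => (leg_comm y (π x)).symm).comp (Uq.comulHom q)

end legs

/-- The generators of the quantum double: the elements of `U_q(su(2))` and of its restricted
dual. -/
abbrev DGen (q : DefParam) : Type := Uq q ⊕ Oq q

/-- The relations of the quantum double: `U_q(su(2))` and its restricted dual are subalgebras, and
`∑ π(x₍₂₎)_{ni} x₍₁₎ g_{ij} = ∑ g_{ni} π(x₍₁₎)_{ij} x₍₂₎`, i.e.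
`R (π ⊗ id)(Δ x) = (π ⊗ id)(Δ^{op} x) R`, for the matrix `R = (g_{ij})` of matrix elements of each
spin representation `π`. -/
inductive DRel (q : DefParam) : FreeAlgebra ℂ (DGen q) → FreeAlgebra ℂ (DGen q) → Prop
  | addU (x y : Uq q) : DRel q (FreeAlgebra.ι ℂ (Sum.inl (x + y)))
      (FreeAlgebra.ι ℂ (Sum.inl x) + FreeAlgebra.ι ℂ (Sum.inl y))
  | mulU (x y : Uq q) : DRel q (FreeAlgebra.ι ℂ (Sum.inl (x * y)))
      (FreeAlgebra.ι ℂ (Sum.inl x) * FreeAlgebra.ι ℂ (Sum.inl y))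
  | algebraMapU (c : ℂ) : DRel q (FreeAlgebra.ι ℂ (Sum.inl (algebraMap ℂ (Uq q) c)))
      (algebraMap ℂ _ c)
  | addO (x y : Oq q) : DRel q (FreeAlgebra.ι ℂ (Sum.inr (x + y)))
      (FreeAlgebra.ι ℂ (Sum.inr x) + FreeAlgebra.ι ℂ (Sum.inr y))
  | mulO (x y : Oq q) : DRel q (FreeAlgebra.ι ℂ (Sum.inr (x * y)))
      (FreeAlgebra.ι ℂ (Sum.inr x) * FreeAlgebra.ι ℂ (Sum.inr y))
  | algebraMapO (c : ℂ) : DRel q (FreeAlgebra.ι ℂ (Sum.inr (algebraMap ℂ (Oq q) c)))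
      (algebraMap ℂ _ c)
  | cross (N : ℕ) (n j : Fin (N + 1)) (x : Uq q) : DRel q
      (∑ i, FreeAlgebra.ι ℂ (Sum.inl (actL (spinRep q N) x n i))
        * FreeAlgebra.ι ℂ (Sum.inr (g q N i j)))
      (∑ i, FreeAlgebra.ι ℂ (Sum.inr (g q N n i))
        * FreeAlgebra.ι ℂ (Sum.inl (actR (spinRep q N) x i j)))

/-- The quantum Lorentz algebra `U_q(sl(2, ℂ)_ℝ)`, i.e. the quantum double of `U_q(su(2))`. -/
def Dq (q : DefParam) : Type := RingQuot (DRel q)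

instance (q : DefParam) : Ring (Dq q) := inferInstanceAs (Ring (RingQuot (DRel q)))

instance instAlgebraDq (q : DefParam) : Algebra ℂ (Dq q) :=
  inferInstanceAs (Algebra ℂ (RingQuot (DRel q)))

namespace Dq

/-- The canonical projection from the free algebra. -/
def mk (q : DefParam) : FreeAlgebra ℂ (DGen q) →ₐ[ℂ] Dq q := RingQuot.mkAlgHom ℂ (DRel q)

theorem mk_surjective (q : DefParam) : Function.Surjective (mk q) :=
  RingQuot.mkAlgHom_surjective ℂ (DRel q)

theorem mk_rel {q : DefParam} {a b : FreeAlgebra ℂ (DGen q)} (h : DRel q a b) :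
    mk q a = mk q b := RingQuot.mkAlgHom_rel ℂ h

/-- An algebra homomorphism out of the functions on generators `x ↦ j x` that is additive,
multiplicative and compatible with scalars. -/
def homOfMk {q : DefParam} {A : Type} [Ring A] [Algebra ℂ A] (j : A → FreeAlgebra ℂ (DGen q))
    (hadd : ∀ x y, DRel q (j (x + y)) (j x + j y))
    (hmul : ∀ x y, DRel q (j (x * y)) (j x * j y))
    (halg : ∀ c, DRel q (j (algebraMap ℂ A c)) (algebraMap ℂ _ c)) : A →ₐ[ℂ] Dq q where
  toFun x := mk q (j x)
  map_one' := by
    have := mk_rel (halg 1)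
    simpa using this
  map_mul' x y := by simpa using mk_rel (hmul x y)
  map_zero' := by
    have := mk_rel (halg 0)
    simpa using this
  map_add' x y := by simpa using mk_rel (hadd x y)
  commutes' c := by simpa using mk_rel (halg c)

/-- The inclusion of `U_q(su(2))`. -/
def ofU (q : DefParam) : Uq q →ₐ[ℂ] Dq q :=
  homOfMk (fun x => FreeAlgebra.ι ℂ (Sum.inl x)) DRel.addU DRel.mulU DRel.algebraMapU

/-- The inclusion of the restricted dual of `U_q(su(2))`. -/
def ofO (q : DefParam) : Oq q →ₐ[ℂ] Dq q :=
  homOfMk (fun x => FreeAlgebra.ι ℂ (Sum.inr x)) DRel.addO DRel.mulO DRel.algebraMapO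

theorem cross (q : DefParam) (N : ℕ) (n j : Fin (N + 1)) (x : Uq q) :
    ∑ i, ofU q (actL (spinRep q N) x n i) * ofO q (g q N i j) =
      ∑ i, ofO q (g q N n i) * ofU q (actR (spinRep q N) x i j) := by
  simpa only [map_sum, map_mul] using! mk_rel (DRel.cross N n j x)

theorem induction {q : DefParam} {P : Dq q → Prop}
    (hc : ∀ c : ℂ, P (algebraMap ℂ _ c)) (hU : ∀ x, P (ofU q x)) (hO : ∀ f, P (ofO q f))
    (hadd : ∀ x y, P x → P y → P (x + y))
    (hmul : ∀ x y, P x → P y → P (x * y)) (x : Dq q) : P x := by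
  obtain ⟨a, rfl⟩ := mk_surjective q x
  induction a using FreeAlgebra.induction with
  | grade0 c => simpa using hc c
  | grade1 y =>
    cases y with
    | inl y => exact hU y
    | inr y => exact hO y
  | mul a b ha hb => simpa using hmul _ _ ha hb
  | add a b ha hb => simpa using hadd _ _ ha hb

/-- The universal property of the quantum double. -/
def lift {q : DefParam} {A : Type*} [Ring A] [Algebra ℂ A] (φ : Uq q →ₐ[ℂ] A)
    (ψ : Oq q →ₐ[ℂ] A)
    (h : ∀ (N : ℕ) (n j : Fin (N + 1)) (x : Uq q),
      ∑ i, φ (actL (spinRep q N) x n i) * ψ (g q N i j) =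
        ∑ i, ψ (g q N n i) * φ (actR (spinRep q N) x i j)) : Dq q →ₐ[ℂ] A :=
  RingQuot.liftAlgHom ℂ ⟨FreeAlgebra.lift ℂ (Sum.elim φ ψ), by
    intro a b hab
    cases hab with
    | cross N n j x => simpa using h N n j x
    | _ => simp⟩

section
variable {q : DefParam} {A : Type*} [Ring A] [Algebra ℂ A] (φ : Uq q →ₐ[ℂ] A)
    (ψ : Oq q →ₐ[ℂ] A)
    (h : ∀ (N : ℕ) (n j : Fin (N + 1)) (x : Uq q),
      ∑ i, φ (actL (spinRep q N) x n i) * ψ (g q N i j) =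
        ∑ i, ψ (g q N n i) * φ (actR (spinRep q N) x i j))

theorem lift_ofU (x : Uq q) : lift φ ψ h (ofU q x) = φ x :=
  (RingQuot.liftAlgHom_mkAlgHom_apply ℂ _ _ _).trans (FreeAlgebra.lift_ι_apply _ _)

theorem lift_ofO (x : Oq q) : lift φ ψ h (ofO q x) = ψ x :=
  (RingQuot.liftAlgHom_mkAlgHom_apply ℂ _ _ _).trans (FreeAlgebra.lift_ι_apply _ _)
end

end Dq

/-! ## The universal `R`-matrix of `U_q(su(2))` -/

/-- The quantum integer `[n]` for a parameter `Q`. -/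
def qint (Q : ℂ) (n : ℕ) : ℂ := (Q ^ n - (Q ^ n)⁻¹) / (Q - Q⁻¹)

/-- The coefficients `(Q - Q⁻¹)^n Q^{n(n-1)/2} / [n]!`. -/
def rcoeff (Q : ℂ) (n : ℕ) : ℂ :=
  (Q - Q⁻¹) ^ n * Q ^ (n.choose 2) / ∏ i ∈ Finset.range n, qint Q (i + 1)

theorem rcoeff_zero (Q : ℂ) : rcoeff Q 0 = 1 := by simp [rcoeff]

theorem rcoeff_succ {Q : ℂ} (h0 : Q ≠ 0) (h1 : ∀ n : ℕ, Q ^ (n + 1) ≠ 1) (n : ℕ) :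
    rcoeff Q (n + 1) * (Q ^ (n + 1) - (Q ^ (n + 1))⁻¹) = rcoeff Q n * ((Q - Q⁻¹) ^ 2 * Q ^ n) := by
  have hne : ∀ n : ℕ, Q ^ (n + 1) - (Q ^ (n + 1))⁻¹ ≠ 0 := by
    intro n h
    have h3 := h1 (2 * n + 1)
    apply h3
    have h4 : Q ^ (n + 1) ≠ 0 := pow_ne_zero _ h0
    field_simp at h
    rw [show 2 * n + 1 + 1 = (n + 1) * 2 by ring, pow_mul]
    linear_combination h
  have hl : Q - Q⁻¹ ≠ 0 := by simpa using hne 0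
  have hq : ∀ n, qint Q (n + 1) ≠ 0 := fun n => div_ne_zero (hne n) hl
  have hp : ∏ i ∈ Finset.range n, qint Q (i + 1) ≠ 0 :=
    Finset.prod_ne_zero_iff.2 fun i _ => hq i
  rw [rcoeff, rcoeff, Finset.prod_range_succ, Nat.choose_succ_succ' n 1, Nat.choose_one_right]
  have e : Q ^ (n + 1) - (Q ^ (n + 1))⁻¹ = qint Q (n + 1) * (Q - Q⁻¹) := by
    rw [qint, div_mul_cancel₀ _ hl]
  rw [e]
  have := hq n
  generalize Q - Q⁻¹ = L at *
  field_simp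
  ring

section exchange

variable {A : Type*} [Ring A] [Algebra ℂ A] {Q : ℂ}

theorem UqTuple.pf {k k' p m : A} (h : UqTuple Q k k' p m) (h0 : Q ≠ 0)
    (h1 : ∀ n : ℕ, Q ^ (n + 1) ≠ 1) (n : ℕ) :
    p * (m * k') ^ (n + 1) = Q ^ (n + 1) • ((m * k') ^ (n + 1) * p)
      + ((Q ^ (n + 1) - (Q ^ (n + 1))⁻¹) * ((Q - Q⁻¹)⁻¹) ^ 2) •
        ((m * k') ^ n * (k - Q ^ (2 * n) • (k' * k' * k'))) := by
  have hl : Q - Q⁻¹ ≠ 0 := by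
    intro e
    field_simp at e
    exact h1 1 (by linear_combination e)
  have hp : p * (m * k') = Q • ((m * k') * p) + (Q - Q⁻¹)⁻¹ • (k - k' * k' * k') := by
    have e : p * m = m * p + (Q - Q⁻¹)⁻¹ • (k * k - k' * k') := by rw [← h.pm]; abel
    have e2 : p * k' = Q • (k' * p) := by
      rw [h.k'p h0, smul_smul, mul_inv_cancel₀ h0, one_smul]
    rw [← mul_assoc, e, add_mul, mul_assoc m p, e2, smul_mul_assoc, sub_mul, mul_assoc k k, h.kk',
      mul_one, mul_smul_comm, ← mul_assoc]
  have hk : k * (m * k') = Q⁻¹ • ((m * k') * k) := by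
    rw [← mul_assoc, h.km, smul_mul_assoc, mul_assoc, mul_assoc, h.kk', h.k'k]
  have hk' : k' * (m * k') = Q • ((m * k') * k') := by
    rw [← mul_assoc, h.k'm h0, smul_mul_assoc]
  have hk3 : k' * k' * k' * (m * k') = Q ^ 3 • ((m * k') * (k' * k' * k')) := by
    rw [mul_assoc, hk', mul_smul_comm, mul_assoc, ← mul_assoc k' (m * k') k', hk', smul_mul_assoc,
      mul_smul_comm, ← mul_assoc, ← mul_assoc, hk']
    simp only [smul_mul_assoc, smul_smul, mul_assoc]
    congr 1
    ring
  generalize m * k' = f at *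
  induction n with
  | zero => 
    rw [zero_add, pow_one, hp, pow_one, pow_zero, one_mul, mul_zero, pow_zero, one_smul, pow_two,
      ← mul_assoc, mul_inv_cancel₀ hl, one_mul]
  | succ n ih =>
    have e : (k - Q ^ (2 * n) • (k' * k' * k')) * f
        = f * (Q⁻¹ • k - (Q ^ (2 * n) * Q ^ 3) • (k' * k' * k')) := by
      rw [sub_mul, smul_mul_assoc, hk, hk3, mul_sub, mul_smul_comm, mul_smul_comm, smul_smul]
    rw [pow_succ f (n + 1), ← mul_assoc, ih, add_mul, smul_mul_assoc, smul_mul_assoc,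
      mul_assoc (f ^ (n + 1)) p f, mul_assoc (f ^ n), hp, e, ← mul_assoc (f ^ n) f, ← pow_succ]
    simp only [mul_add, mul_sub, mul_smul_comm, ← mul_assoc, ← pow_succ]
    have hQ := pow_ne_zero n h0
    have hl2 : Q ^ 2 - 1 ≠ 0 := sub_ne_zero.2 (h1 1)
    match_scalars <;> field_simp <;> ring

/-- Two tuples commuting with each other. -/
def TuplesCommute (k₁ k₁' p₁ m₁ k₂ k₂' p₂ m₂ : A) : Prop :=
  ∀ x ∈ ({k₁, k₁', p₁, m₁} : Set A), ∀ y ∈ ({k₂, k₂', p₂, m₂} : Set A), Commute x y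

theorem rmatrix_exchange_p {k₁ k₁' p₁ m₁ k₂ k₂' p₂ m₂ d : A} (h0 : Q ≠ 0)
    (h1 : ∀ n : ℕ, Q ^ (n + 1) ≠ 1)
    (t₁ : UqTuple Q k₁ k₁' p₁ m₁) (t₂ : UqTuple Q k₂ k₂' p₂ m₂)
    (hc : TuplesCommute k₁ k₁' p₁ m₁ k₂ k₂' p₂ m₂) (M : ℕ)
    (hM : (k₁ * p₁) ^ M * (m₂ * k₂') ^ M = 0)
    (dp₁ : d * p₁ = p₁ * k₂ * k₂ * d) (dp₂ : d * p₂ = k₁ * k₁ * p₂ * d)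
    (dk₂ : Commute d k₂') (dk₁ : Commute d k₁') :
    (d * ∑ n ∈ Finset.range M, rcoeff Q n • ((k₁ * p₁) ^ n * (m₂ * k₂') ^ n))
        * (k₁' * p₂ + p₁ * k₂) =
      (p₁ * k₂' + k₁ * p₂) *
        (d * ∑ n ∈ Finset.range M, rcoeff Q n • ((k₁ * p₁) ^ n * (m₂ * k₂') ^ n)) := by
  have c11 : Commute k₁' p₂ := hc _ (by simp) _ (by simp)
  have c12 : Commute k₁' k₂ := hc _ (by simp) _ (by simp)
  have c13 : Commute k₁' k₂' := hc _ (by simp) _ (by simp)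
  have c14 : Commute k₁' m₂ := hc _ (by simp) _ (by simp)
  have c21 : Commute k₁ p₂ := hc _ (by simp) _ (by simp)
  have c22 : Commute k₁ k₂ := hc _ (by simp) _ (by simp)
  have c23 : Commute k₁ k₂' := hc _ (by simp) _ (by simp)
  have c24 : Commute k₁ m₂ := hc _ (by simp) _ (by simp)
  have c31 : Commute p₁ p₂ := hc _ (by simp) _ (by simp)
  have c32 : Commute p₁ k₂ := hc _ (by simp) _ (by simp)
  have c33 : Commute p₁ k₂' := hc _ (by simp) _ (by simp)
  have c34 : Commute p₁ m₂ := hc _ (by simp) _ (by simp)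
  obtain ⟨e, he⟩ : ∃ e, e = k₁ * p₁ := ⟨_, rfl⟩
  obtain ⟨f, hf⟩ : ∃ f, f = m₂ * k₂' := ⟨_, rfl⟩
  have hp₁ : p₁ = k₁' * e := by rw [he, ← mul_assoc, t₁.k'k, one_mul]
  have cef : Commute e f := by
    rw [he, hf]
    exact (c24.mul_right c23).mul_left (c34.mul_right c33)
  have cep : Commute e p₂ := he ▸ c21.mul_left c31
  have cek : Commute e k₂ := he ▸ c22.mul_left c32
  have cek' : Commute e k₂' := he ▸ c23.mul_left c33
  have ck'f : Commute k₁' f := hf ▸ c14.mul_right c13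
  have hpf := fun n => t₂.pf h0 h1 n
  rw [← hf] at hpf
  have hek : ∀ n, e ^ n * k₁' = Q ^ n • (k₁' * e ^ n) := by
    have h : e * k₁' = Q • (k₁' * e) := by
      rw [he, mul_assoc, ← mul_assoc k₁' k₁, t₁.k'k, one_mul]
      have : p₁ * k₁' = Q • (k₁' * p₁) := by
        rw [t₁.k'p h0, smul_smul, mul_inv_cancel₀ h0, one_smul]
      rw [this, mul_smul_comm, ← mul_assoc, t₁.kk', one_mul]
    intro n
    induction n with
    | zero => simp
    | succ n ih =>
      rw [pow_succ, mul_assoc, h, mul_smul_comm, ← mul_assoc, ih, smul_mul_assoc, smul_smul,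
        mul_assoc, pow_succ, mul_comm]
  have hk3f : ∀ n, k₂' * k₂' * k₂' * f ^ n = Q ^ (3 * n) • (f ^ n * (k₂' * k₂' * k₂')) := by
    have hk' : k₂' * f = Q • (f * k₂') := by
      rw [hf, ← mul_assoc, t₂.k'm h0, smul_mul_assoc]
    have hk3 : k₂' * k₂' * k₂' * f = Q ^ 3 • (f * (k₂' * k₂' * k₂')) := by
      rw [mul_assoc, hk', mul_smul_comm, mul_assoc, ← mul_assoc k₂' f k₂', hk', smul_mul_assoc,
        mul_smul_comm, ← mul_assoc, ← mul_assoc, hk']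
      simp only [smul_mul_assoc, smul_smul, mul_assoc]
      congr 1
      ring
    intro n
    induction n with
    | zero => simp
    | succ n ih =>
      rw [pow_succ, ← mul_assoc, ih, smul_mul_assoc, mul_assoc, hk3, mul_smul_comm, smul_smul,
        ← mul_assoc, ← pow_add]
      rfl
  -- the two families of terms
  let U : ℕ → A := fun n => rcoeff Q n • (e ^ n * f ^ n * (k₁' * p₂) - k₁' * p₂ * (e ^ n * f ^ n))
  let W : ℕ → A := fun n => rcoeff Q n •
    (e ^ n * f ^ n * (p₁ * k₂) - p₁ * (k₂' * k₂' * k₂') * (e ^ n * f ^ n))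
  have hU0 : U 0 = 0 := by simp [U]
  have hUW : ∀ n, U (n + 1) + W n = 0 := by
    intro n
    have e1 : e ^ (n + 1) * f ^ (n + 1) * (k₁' * p₂) - k₁' * p₂ * (e ^ (n + 1) * f ^ (n + 1))
        = -(((Q ^ (n + 1) - (Q ^ (n + 1))⁻¹) * ((Q - Q⁻¹)⁻¹) ^ 2) •
          (k₁' * e ^ (n + 1) * (f ^ n * (k₂ - Q ^ (2 * n) • (k₂' * k₂' * k₂'))))) := by
      have a1 : e ^ (n + 1) * f ^ (n + 1) * (k₁' * p₂)
          = k₁' * e ^ (n + 1) * (Q ^ (n + 1) • (f ^ (n + 1) * p₂)) := by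
        rw [mul_assoc, ← mul_assoc (f ^ (n + 1)), ← (ck'f.pow_right (n + 1)).eq, mul_assoc k₁',
          ← mul_assoc, hek, smul_mul_assoc, mul_smul_comm]
      have a2 : k₁' * p₂ * (e ^ (n + 1) * f ^ (n + 1))
          = k₁' * e ^ (n + 1) * (p₂ * f ^ (n + 1)) := by
        rw [mul_assoc, ← mul_assoc p₂, ← (cep.pow_left (n + 1)).eq]
        simp only [mul_assoc]
      rw [a1, a2, hpf, ← mul_sub, sub_add_cancel_left, mul_neg, mul_smul_comm]
    have e2 : e ^ n * f ^ n * (p₁ * k₂) - p₁ * (k₂' * k₂' * k₂') * (e ^ n * f ^ n)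
        = Q ^ n • (k₁' * e ^ (n + 1) * (f ^ n * (k₂ - Q ^ (2 * n) • (k₂' * k₂' * k₂')))) := by
      have a1 : e ^ n * f ^ n * (p₁ * k₂) = Q ^ n • (k₁' * e ^ (n + 1) * (f ^ n * k₂)) := by
        rw [hp₁, mul_assoc, ← mul_assoc (f ^ n), ← mul_assoc (f ^ n),
          ← (ck'f.pow_right n).eq, mul_assoc k₁', ← ((cef.pow_right n)).eq, ← mul_assoc,
          ← mul_assoc, hek, pow_succ]
        simp only [smul_mul_assoc, mul_assoc]
      have ck3 : Commute e (k₂' * k₂' * k₂') := (cek'.mul_right cek').mul_right cek'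
      have a2 : p₁ * (k₂' * k₂' * k₂') * (e ^ n * f ^ n)
          = Q ^ (3 * n) • (k₁' * e ^ (n + 1) * (f ^ n * (k₂' * k₂' * k₂'))) := by
        rw [mul_assoc, ← mul_assoc _ (e ^ n), ← (ck3.pow_left n).eq, mul_assoc (e ^ n), hk3f, hp₁,
          pow_succ' e n]
        simp only [mul_smul_comm, mul_assoc]
      rw [a1, a2, mul_sub, mul_sub, mul_smul_comm, mul_smul_comm, smul_sub, smul_smul, ← pow_add]
      congr 3
      ring
    simp only [U, W]
    rw [e1, e2, smul_neg, smul_smul, smul_smul, neg_add_eq_zero]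
    congr 1
    have := rcoeff_succ h0 h1 n
    have hl : Q - Q⁻¹ ≠ 0 := by
      intro e
      field_simp at e
      exact h1 1 (by linear_combination e)
    rw [← mul_assoc, this]
    generalize Q - Q⁻¹ = L at *
    field_simp
  have hsum : ∀ M, ∑ n ∈ Finset.range M, (U n + W n) = - U M := by
    intro M
    induction M with
    | zero => simp [hU0]
    | succ M ih =>
      rw [Finset.sum_range_succ, ih, neg_add_cancel_left]
      exact eq_neg_of_add_eq_zero_right (hUW M)
  have hUM : U M = 0 := by
    simp only [U]
    rw [← he, ← hf] at hM
    rw [hM]; simp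
  rw [← he, ← hf]
  set Θ := ∑ n ∈ Finset.range M, rcoeff Q n • (e ^ n * f ^ n) with hΘ
  have key : Θ * (k₁' * p₂ + p₁ * k₂) = (k₁' * p₂ + p₁ * (k₂' * k₂' * k₂')) * Θ := by
    have h := hsum M
    rw [hUM, neg_zero] at h
    rw [← sub_eq_zero, ← h, hΘ, Finset.sum_mul, Finset.mul_sum, ← Finset.sum_sub_distrib]
    refine Finset.sum_congr rfl fun n _ => ?_
    simp only [U, W, smul_mul_assoc, mul_smul_comm, mul_add, add_mul, smul_sub, smul_add]
    abel
  have b1 : k₁' * (k₁ * k₁ * p₂ * d) = k₁ * p₂ * d := by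
    simp only [← mul_assoc, t₁.k'k, one_mul]
  have b2 : p₁ * k₂ * k₂ * d * (k₂' * k₂' * k₂') = p₁ * k₂' * d := by
    rw [mul_assoc _ d, ((dk₂.mul_right dk₂).mul_right dk₂).eq, ← mul_assoc]
    congr 1
    simp only [mul_assoc]
    rw [← mul_assoc k₂ k₂' (k₂' * k₂'), t₂.kk', one_mul, ← mul_assoc k₂ k₂', t₂.kk', one_mul]
  have fin : d * (k₁' * p₂ + p₁ * (k₂' * k₂' * k₂')) = (p₁ * k₂' + k₁ * p₂) * d := by
    rw [mul_add, add_mul, ← mul_assoc d k₁', ← mul_assoc d p₁, dk₁.eq, mul_assoc k₁', dp₂, dp₁,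
      add_comm, b1, b2]
  rw [mul_assoc, key, ← mul_assoc d, fin, mul_assoc]

theorem UqTuple.flip {k k' p m : A} (h : UqTuple Q k k' p m) (h0 : Q ≠ 0) :
    UqTuple Q k' k m p where
  kk' := h.k'k
  k'k := h.kk'
  kp := h.k'm h0
  km := h.k'p h0
  pm := by rw [← neg_sub, h.pm, ← smul_neg, neg_sub]

theorem rmatrix_exchange_m {k₁ k₁' p₁ m₁ k₂ k₂' p₂ m₂ d : A} (h0 : Q ≠ 0)
    (h1 : ∀ n : ℕ, Q ^ (n + 1) ≠ 1)
    (t₁ : UqTuple Q k₁ k₁' p₁ m₁) (t₂ : UqTuple Q k₂ k₂' p₂ m₂)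
    (hc : TuplesCommute k₁ k₁' p₁ m₁ k₂ k₂' p₂ m₂) (M : ℕ)
    (hM : (k₁ * p₁) ^ M * (m₂ * k₂') ^ M = 0)
    (dm₁ : d * m₁ = m₁ * k₂' * k₂' * d) (dm₂ : d * m₂ = k₁' * k₁' * m₂ * d)
    (dk₂ : Commute d k₂) (dk₁ : Commute d k₁) :
    (d * ∑ n ∈ Finset.range M, rcoeff Q n • ((k₁ * p₁) ^ n * (m₂ * k₂') ^ n))
        * (k₁' * m₂ + m₁ * k₂) =
      (m₁ * k₂' + k₁ * m₂) *
        (d * ∑ n ∈ Finset.range M, rcoeff Q n • ((k₁ * p₁) ^ n * (m₂ * k₂') ^ n)) := by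
  have c11 : Commute k₁' m₂ := hc _ (by simp) _ (by simp)
  have c12 : Commute k₁' k₂' := hc _ (by simp) _ (by simp)
  have c21 : Commute k₁ m₂ := hc _ (by simp) _ (by simp)
  have c22 : Commute k₁ k₂' := hc _ (by simp) _ (by simp)
  have c31 : Commute p₁ m₂ := hc _ (by simp) _ (by simp)
  have c32 : Commute p₁ k₂' := hc _ (by simp) _ (by simp)
  have c41 : Commute m₁ k₂' := hc _ (by simp) _ (by simp)
  have c42 : Commute m₁ k₂ := hc _ (by simp) _ (by simp)
  have cef : Commute (k₁ * p₁) (m₂ * k₂') :=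
    (c21.mul_right c22).mul_left (c31.mul_right c32)
  have hterm : ∀ n, (k₂' * m₂) ^ n * (p₁ * k₁) ^ n = (k₁ * p₁) ^ n * (m₂ * k₂') ^ n := by
    intro n
    rw [t₂.k'm h0, t₁.pk h0, smul_pow, smul_pow, smul_mul_smul_comm, ← mul_pow, mul_inv_cancel₀ h0,
      one_pow, one_smul, (cef.pow_pow n n).eq]
  have hc' : TuplesCommute k₂' k₂ m₂ p₂ k₁' k₁ m₁ p₁ := by
    intro x hx y hy
    refine (hc y ?_ x ?_).symm
    · simp only [Set.mem_insert_iff, Set.mem_singleton_iff] at hy ⊢; tauto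
    · simp only [Set.mem_insert_iff, Set.mem_singleton_iff] at hx ⊢; tauto
  have h := rmatrix_exchange_p (d := d) h0 h1 (t₂.flip h0) (t₁.flip h0) hc' M
    (by rw [hterm, hM])
    (by rw [dm₂, ((c11.mul_left c11).eq), mul_assoc m₂ k₁' k₁', mul_assoc])
    (by rw [dm₁, mul_assoc m₁ k₂' k₂', (c41.mul_right c41).eq]) dk₁ dk₂
  simp only [hterm] at h
  rw [c11.eq, c42.eq, c41.eq, c21.eq, add_comm (m₂ * k₁') , add_comm (k₂' * m₁)]
  exact h

end exchange

/-- `K ^ z = q ^ (z J_z)`, `z ∈ ℤ`. -/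
def Kpow (q : DefParam) (z : ℤ) : Uq q :=
  (((⟨Uq.K q, Uq.Kinv q, Uq.K_Kinv q, Uq.Kinv_K q⟩ : (Uq q)ˣ) ^ z : (Uq q)ˣ) : Uq q)

/-- The matrix `(id ⊗ π^B)(R^{(+)})`, `B = N / 2`, with entries in `U_q(su(2))`, where `R^{(+)}` is
the universal `R`-matrix of `U_q(su(2))`, i.e. `R^{(+)} =
q^{2 J_z ⊗ J_z} ∑_n (q - q⁻¹)^n q^{n(n-1)/2} / [n]! (q^{J_z} J₊)^n ⊗ (J₋ q^{-J_z})^n`. -/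
def Rplus (q : DefParam) (N : ℕ) : Matrix (Fin (N + 1)) (Fin (N + 1)) (Uq q) :=
  Matrix.diagonal (fun a : Fin (N + 1) => Kpow q ((N : ℤ) - 2 * (a : ℕ))) *
    ∑ n ∈ Finset.range (N + 1), rcoeff (qc q) n •
      (leg q _ (Uq.K q * Uq.Jp q) ^ n
        * legM q _ (spinRep q N (Uq.Jm q * Uq.Kinv q)) ^ n)

/-- The matrix `(id ⊗ π^B)(R^{(-)})`, `B = N / 2`, where `R^{(-)} = (R^{(+)}₂₁)⁻¹`, i.e.
`R^{(-)} = q^{-2 J_z ⊗ J_z} ∑_n (q⁻¹ - q)^n q^{-n(n-1)/2} / [n]! (J₋ q^{J_z})^n ⊗ (q^{-J_z} J₊)^n`. -/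
def Rminus (q : DefParam) (N : ℕ) : Matrix (Fin (N + 1)) (Fin (N + 1)) (Uq q) :=
  Matrix.diagonal (fun a : Fin (N + 1) => Kpow q (-((N : ℤ) - 2 * (a : ℕ)))) *
    ∑ n ∈ Finset.range (N + 1), rcoeff (qc q)⁻¹ n •
      (leg q _ (Uq.Jm q * Uq.K q) ^ n
        * legM q _ (spinRep q N (Uq.Kinv q * Uq.Jp q)) ^ n)

section Kpow

theorem Kpow_zero (q : DefParam) : Kpow q 0 = 1 := by simp [Kpow]

theorem Kpow_add (q : DefParam) (y z : ℤ) : Kpow q (y + z) = Kpow q y * Kpow q z := by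
  simp [Kpow, zpow_add]

theorem Kpow_one (q : DefParam) : Kpow q 1 = Uq.K q := by simp [Kpow]

theorem Kpow_neg_one (q : DefParam) : Kpow q (-1) = Uq.Kinv q := by simp [Kpow]

theorem Kpow_two (q : DefParam) : Kpow q 2 = Uq.K q * Uq.K q := by
  rw [show (2 : ℤ) = 1 + 1 by norm_num, Kpow_add, Kpow_one]

theorem Kpow_neg_two (q : DefParam) : Kpow q (-2) = Uq.Kinv q * Uq.Kinv q := by
  rw [show (-2 : ℤ) = -1 + -1 by norm_num, Kpow_add, Kpow_neg_one]

theorem Kpow_comm (q : DefParam) (y z : ℤ) : Commute (Kpow q y) (Kpow q z) := by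
  rw [Commute, SemiconjBy, ← Kpow_add, ← Kpow_add, add_comm]

/-- If `K x = c x K` then `K ^ z x = c ^ z x K ^ z`. -/
theorem Kpow_mul {q : DefParam} {x : Uq q} {c : ℂ} (hc : c ≠ 0)
    (h : Uq.K q * x = c • (x * Uq.K q)) (z : ℤ) : Kpow q z * x = c ^ z • (x * Kpow q z) := by
  have h' : Uq.Kinv q * x = c⁻¹ • (x * Uq.Kinv q) := by
    have : Uq.K q * x * Uq.Kinv q = c • x := by
      rw [h, smul_mul_assoc, mul_assoc, Uq.K_Kinv, mul_one]
    calc Uq.Kinv q * x = c⁻¹ • (Uq.Kinv q * (c • x)) := by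
          rw [mul_smul_comm, smul_smul, inv_mul_cancel₀ hc, one_smul]
      _ = c⁻¹ • (x * Uq.Kinv q) := by
          rw [← this, ← mul_assoc, ← mul_assoc, Uq.Kinv_K, one_mul]
  induction z using Int.induction_on with
  | zero => simp [Kpow_zero]
  | succ n ih =>
    rw [add_comm, Kpow_add, Kpow_one, mul_assoc, ih, mul_smul_comm, ← mul_assoc, h, smul_mul_assoc,
      smul_smul, mul_assoc, zpow_add₀ hc, zpow_one, mul_comm]
  | pred n ih =>
    rw [show (-(n : ℤ) - 1) = -1 + -n by ring, Kpow_add, Kpow_neg_one, mul_assoc, ih,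
      mul_smul_comm, ← mul_assoc, h', smul_mul_assoc, smul_smul, mul_assoc, zpow_add₀ hc,
      zpow_neg_one, mul_comm]

theorem comul_Kpow (q : DefParam) (z : ℤ) :
    Coalgebra.comul (R := ℂ) (Kpow q z) = Kpow q z ⊗ₜ[ℂ] Kpow q z := by
  induction z using Int.induction_on with
  | zero => simp [Kpow_zero, Algebra.TensorProduct.one_def]
  | succ n ih =>
    rw [Kpow_add, Bialgebra.comul_mul, ih, Kpow_one, Uq.comul_K,
      Algebra.TensorProduct.tmul_mul_tmul]
  | pred n ih =>
    rw [sub_eq_add_neg, Kpow_add, Bialgebra.comul_mul, ih, Kpow_neg_one, Uq.comul_Kinv,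
      Algebra.TensorProduct.tmul_mul_tmul]

theorem counit_Kpow (q : DefParam) (z : ℤ) : Coalgebra.counit (R := ℂ) (Kpow q z) = 1 := by
  induction z using Int.induction_on with
  | zero => simp [Kpow_zero]
  | succ n ih => rw [Kpow_add, Bialgebra.counit_mul, ih, Kpow_one, Uq.counit_K, mul_one]
  | pred n ih =>
    rw [sub_eq_add_neg, Kpow_add, Bialgebra.counit_mul, ih, Kpow_neg_one, Uq.counit_Kinv, mul_one]

end Kpow

theorem UqTuple.map {A B : Type*} [Ring A] [Algebra ℂ A] [Ring B] [Algebra ℂ B] {Q : ℂ}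
    {k k' p m : A} (h : UqTuple Q k k' p m) (φ : A →ₐ[ℂ] B) :
    UqTuple Q (φ k) (φ k') (φ p) (φ m) where
  kk' := by rw [← map_mul, h.kk', map_one]
  k'k := by rw [← map_mul, h.k'k, map_one]
  kp := by rw [← map_mul, h.kp, map_smul, map_mul]
  km := by rw [← map_mul, h.km, map_smul, map_mul]
  pm := by simp only [← map_mul, ← map_sub, ← map_smul, h.pm]

/-- A tuple for `Q` gives a tuple for `Q⁻¹` by exchanging `k` and `k'`. -/
theorem UqTuple.invParam {A : Type*} [Ring A] [Algebra ℂ A] {Q : ℂ}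
    {k k' p m : A} (h : UqTuple Q k k' p m) (h0 : Q ≠ 0) : UqTuple Q⁻¹ k' k p m where
  kk' := h.k'k
  k'k := h.kk'
  kp := h.k'p h0
  km := by rw [inv_inv]; exact h.k'm h0
  pm := by
    rw [h.pm, inv_inv, ← neg_sub (k * k), ← neg_sub Q Q⁻¹, inv_neg, neg_smul, smul_neg, neg_neg]

section actions

variable {q : DefParam} {ι : Type} [Fintype ι] [DecidableEq ι] (π : Uq q →ₐ[ℂ] Matrix ι ι ℂ)

/-- `x ⊗ y ↦ x π(y)`. -/
theorem actL_comul {x : Uq q} {s : Finset ℕ} {u v : ℕ → Uq q}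
    (h : Coalgebra.comul (R := ℂ) x = ∑ i ∈ s, u i ⊗ₜ[ℂ] v i) :
    actL π x = ∑ i ∈ s, leg q ι (u i) * legM q ι (π (v i)) := by
  refine (congrArg (Algebra.TensorProduct.lift (leg q ι) ((legM q ι).comp π)
    fun x y => leg_comm x (π y)) h).trans ?_
  rw [map_sum]
  exact Finset.sum_congr rfl fun i _ => Algebra.TensorProduct.lift_tmul _ _ _ _ _

theorem actR_comul {x : Uq q} {s : Finset ℕ} {u v : ℕ → Uq q}
    (h : Coalgebra.comul (R := ℂ) x = ∑ i ∈ s, u i ⊗ₜ[ℂ] v i) :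
    actR π x = ∑ i ∈ s, legM q ι (π (u i)) * leg q ι (v i) := by
  refine (congrArg (Algebra.TensorProduct.lift ((legM q ι).comp π) (leg q ι)
    fun x y => (leg_comm y (π x)).symm) h).trans ?_
  rw [map_sum]
  exact Finset.sum_congr rfl fun i _ => Algebra.TensorProduct.lift_tmul _ _ _ _ _

theorem actL_one {x u v : Uq q} (h : Coalgebra.comul (R := ℂ) x = u ⊗ₜ[ℂ] v) :
    actL π x = leg q ι u * legM q ι (π v) := by
  simpa using actL_comul π (s := Finset.range 1) (u := fun _ => u) (v := fun _ => v) (by simpa using h)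

theorem actR_one {x u v : Uq q} (h : Coalgebra.comul (R := ℂ) x = u ⊗ₜ[ℂ] v) :
    actR π x = legM q ι (π u) * leg q ι v := by
  simpa using actR_comul π (s := Finset.range 1) (u := fun _ => u) (v := fun _ => v) (by simpa using h)

theorem actL_two {x u v u' v' : Uq q}
    (h : Coalgebra.comul (R := ℂ) x = u ⊗ₜ[ℂ] v + u' ⊗ₜ[ℂ] v') :
    actL π x = leg q ι u * legM q ι (π v) + leg q ι u' * legM q ι (π v') := by
  simpa [Finset.sum_range_succ] using actL_comul π (s := Finset.range 2)
    (u := fun i => if i = 0 then u else u') (v := fun i => if i = 0 then v else v')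
    (by simpa [Finset.sum_range_succ] using h)

theorem actR_two {x u v u' v' : Uq q}
    (h : Coalgebra.comul (R := ℂ) x = u ⊗ₜ[ℂ] v + u' ⊗ₜ[ℂ] v') :
    actR π x = legM q ι (π u) * leg q ι v + legM q ι (π u') * leg q ι v' := by
  simpa [Finset.sum_range_succ] using actR_comul π (s := Finset.range 2)
    (u := fun i => if i = 0 then u else u') (v := fun i => if i = 0 then v else v')
    (by simpa [Finset.sum_range_succ] using h)

theorem actL_K : actL π (Uq.K q) = leg q ι (Uq.K q) * legM q ι (π (Uq.K q)) :=
  actL_one π (Uq.comul_K q)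
theorem actL_Jp : actL π (Uq.Jp q) = leg q ι (Uq.Kinv q) * legM q ι (π (Uq.Jp q))
    + leg q ι (Uq.Jp q) * legM q ι (π (Uq.K q)) := actL_two π (Uq.comul_Jp q)
theorem actL_Jm : actL π (Uq.Jm q) = leg q ι (Uq.Kinv q) * legM q ι (π (Uq.Jm q))
    + leg q ι (Uq.Jm q) * legM q ι (π (Uq.K q)) := actL_two π (Uq.comul_Jm q)
theorem actR_K : actR π (Uq.K q) = legM q ι (π (Uq.K q)) * leg q ι (Uq.K q) :=
  actR_one π (Uq.comul_K q)
theorem actR_Jp : actR π (Uq.Jp q) = legM q ι (π (Uq.Kinv q)) * leg q ι (Uq.Jp q)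
    + legM q ι (π (Uq.Jp q)) * leg q ι (Uq.K q) := actR_two π (Uq.comul_Jp q)
theorem actR_Jm : actR π (Uq.Jm q) = legM q ι (π (Uq.Kinv q)) * leg q ι (Uq.Jm q)
    + legM q ι (π (Uq.Jm q)) * leg q ι (Uq.K q) := actR_two π (Uq.comul_Jm q)

/-- The relation `R Δ(x) = Δ^{op}(x) R` holds for all `x` if it holds for the generators. -/
theorem exchange_of_gens {X : Matrix ι ι (Uq q)}
    (hK : X * actL π (Uq.K q) = actR π (Uq.K q) * X)
    (hKinv : X * actL π (Uq.Kinv q) = actR π (Uq.Kinv q) * X)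
    (hJp : X * actL π (Uq.Jp q) = actR π (Uq.Jp q) * X)
    (hJm : X * actL π (Uq.Jm q) = actR π (Uq.Jm q) * X) (x : Uq q) :
    X * actL π x = actR π x * X := by
  induction x using Uq.induction with
  | hc c => rw [AlgHom.commutes, AlgHom.commutes, Algebra.commutes]
  | hK => exact hK
  | hKinv => exact hKinv
  | hJp => exact hJp
  | hJm => exact hJm
  | hadd x y hx hy => rw [map_add, map_add, mul_add, add_mul, hx, hy]
  | hmul x y hx hy => rw [map_mul, map_mul, ← mul_assoc, hx, mul_assoc, hy, mul_assoc]

/-- The relation for `K⁻¹` follows from that for `K`. -/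
theorem exchange_Kinv {X : Matrix ι ι (Uq q)}
    (hK : X * actL π (Uq.K q) = actR π (Uq.K q) * X) :
    X * actL π (Uq.Kinv q) = actR π (Uq.Kinv q) * X := by
  have h1 : actR π (Uq.Kinv q) * actR π (Uq.K q) = 1 := by rw [← map_mul, Uq.Kinv_K, map_one]
  have h2 : actL π (Uq.K q) * actL π (Uq.Kinv q) = 1 := by rw [← map_mul, Uq.K_Kinv, map_one]
  calc _ = actR π (Uq.Kinv q) * (actR π (Uq.K q) * X) * actL π (Uq.Kinv q) := by
        rw [← mul_assoc, h1, one_mul]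
    _ = actR π (Uq.Kinv q) * X := by rw [← hK, mul_assoc, mul_assoc, h2, mul_one]

end actions

theorem legs_tuplesCommute (q : DefParam) {ι : Type} [Fintype ι] [DecidableEq ι]
    (x y z w : Uq q) (a b c d : Matrix ι ι ℂ) :
    TuplesCommute (leg q ι x) (leg q ι y) (leg q ι z) (leg q ι w)
      (legM q ι a) (legM q ι b) (legM q ι c) (legM q ι d) := by
  intro u hu v hv
  simp only [Set.mem_insert_iff, Set.mem_singleton_iff] at hu hv
  rcases hu with rfl | rfl | rfl | rfl <;> rcases hv with rfl | rfl | rfl | rfl <;>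
    exact leg_comm _ _

theorem legs_tuplesCommute' (q : DefParam) {ι : Type} [Fintype ι] [DecidableEq ι]
    (x y z w : Uq q) (a b c d : Matrix ι ι ℂ) :
    TuplesCommute (legM q ι a) (legM q ι b) (legM q ι c) (legM q ι d)
      (leg q ι x) (leg q ι y) (leg q ι z) (leg q ι w) := by
  intro u hu v hv
  exact (legs_tuplesCommute q x y z w a b c d v hv u hu).symm

/-- A matrix shifting the index by `s`; its powers shift the index by multiples of `s`. -/
theorem pow_shift {N : ℕ} {F : Matrix (Fin (N + 1)) (Fin (N + 1)) ℂ} {s : ℤ}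
    (hF : ∀ a b : Fin (N + 1), ((a : ℕ) : ℤ) ≠ (b : ℕ) + s → F a b = 0) (n : ℕ)
    (a b : Fin (N + 1)) (h : ((a : ℕ) : ℤ) ≠ (b : ℕ) + n * s) : (F ^ n) a b = 0 := by
  induction n generalizing a with
  | zero =>
    have : a ≠ b := by rintro rfl; simp at h
    simp [this]
  | succ n ih =>
    rw [pow_succ', Matrix.mul_apply]
    refine Finset.sum_eq_zero fun c _ => ?_
    by_cases hc : ((a : ℕ) : ℤ) = (c : ℕ) + s
    · rw [ih c, mul_zero]
      intro h'
      apply h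
      rw [hc, h']
      push_cast
      ring
    · rw [hF a c hc, zero_mul]

theorem pow_shift_eq_zero {N : ℕ} {F : Matrix (Fin (N + 1)) (Fin (N + 1)) ℂ} {s : ℤ}
    (hs : s = 1 ∨ s = -1)
    (hF : ∀ a b : Fin (N + 1), ((a : ℕ) : ℤ) ≠ (b : ℕ) + s → F a b = 0) (n : ℕ) (hn : N < n) :
    F ^ n = 0 := by
  ext a b
  refine pow_shift hF n a b ?_
  have := a.2
  have := b.2
  rcases hs with rfl | rfl <;> omega

theorem spinRep_K (q : DefParam) (N : ℕ) : spinRep q N (Uq.K q) = spinK q 1 N := Uq.lift_K _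
theorem spinRep_Kinv (q : DefParam) (N : ℕ) : spinRep q N (Uq.Kinv q) = spinK q (-1) N :=
  Uq.lift_Kinv _
theorem spinRep_Jp (q : DefParam) (N : ℕ) : spinRep q N (Uq.Jp q) = spinJp q N := Uq.lift_Jp _
theorem spinRep_Jm (q : DefParam) (N : ℕ) : spinRep q N (Uq.Jm q) = spinJm q N := Uq.lift_Jm _

theorem shift_f (q : DefParam) (N : ℕ) (a b : Fin (N + 1))
    (h : ((a : ℕ) : ℤ) ≠ (b : ℕ) + 1) : spinRep q N (Uq.Jm q * Uq.Kinv q) a b = 0 := by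
  rw [map_mul, spinRep_Jm, spinRep_Kinv, spinK, Matrix.mul_diagonal, spinJm, Matrix.of_apply,
    if_neg (by omega), zero_mul]

theorem shift_e (q : DefParam) (N : ℕ) (a b : Fin (N + 1))
    (h : ((a : ℕ) : ℤ) ≠ (b : ℕ) + (-1)) : spinRep q N (Uq.Kinv q * Uq.Jp q) a b = 0 := by
  rw [map_mul, spinRep_Jp, spinRep_Kinv, spinK, Matrix.diagonal_mul, spinJp, Matrix.of_apply,
    if_neg (by omega), mul_zero]

section diag

/-- `q^{2 ε J_z ⊗ J_z}` on `U_q(su(2)) ⊗ End(V_{N/2})`. -/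
def dmat (q : DefParam) (N : ℕ) (ε : ℤ) : Matrix (Fin (N + 1)) (Fin (N + 1)) (Uq q) :=
  Matrix.diagonal (fun a : Fin (N + 1) => Kpow q (ε * ((N : ℤ) - 2 * (a : ℕ))))

variable (q : DefParam) (N : ℕ) (ε : ℤ)

theorem leg_eq (x : Uq q) : leg q (Fin (N + 1)) x = Matrix.diagonal fun _ => x := rfl

theorem legM_spinK (c : ℂ) : legM q _ (spinK q c N) =
    Matrix.diagonal fun a : Fin (N + 1) => algebraMap ℂ (Uq q) (qpow q (c * wt N a)) := by
  ext a b
  simp only [legM, spinK, AlgHom.mapMatrix_apply, Matrix.map_apply, Matrix.diagonal_apply,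
    Algebra.ofId_apply]
  split_ifs <;> simp

theorem dmat_comm_leg (z : ℤ) : Commute (dmat q N ε) (leg q _ (Kpow q z)) := by
  rw [leg_eq, dmat, Commute, SemiconjBy, Matrix.diagonal_mul_diagonal, Matrix.diagonal_mul_diagonal]
  congr 1; ext a; rw [(Kpow_comm q _ _).eq]

theorem dmat_comm_legM (c : ℂ) : Commute (dmat q N ε) (legM q _ (spinK q c N)) := by
  rw [legM_spinK, dmat, Commute, SemiconjBy, Matrix.diagonal_mul_diagonal,
    Matrix.diagonal_mul_diagonal]
  congr 1; ext a; rw [Algebra.commutes]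

theorem qpow_wt (s : ℤ) (a : ℕ) (c : ℂ) (hc : c = 2 * ε * s) :
    qpow q (c * wt N a) = (qc q ^ s) ^ (ε * ((N : ℤ) - 2 * a)) := by
  rw [← zpow_mul, ← Complex.cpow_intCast, qpow, hc]
  congr 1
  simp only [wt]; push_cast; ring

theorem dmat_leg {x : Uq q} {s : ℤ} (h : Uq.K q * x = (qc q ^ s) • (x * Uq.K q)) {c : ℂ}
    (hc : c = 2 * ε * s) :
    dmat q N ε * leg q _ x = legM q _ (spinK q c N) * leg q _ x * dmat q N ε := by
  rw [legM_spinK, leg_eq, dmat, Matrix.diagonal_mul_diagonal, Matrix.diagonal_mul_diagonal,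
    Matrix.diagonal_mul_diagonal]
  congr 1; ext a
  rw [Kpow_mul (zpow_ne_zero _ (qc_ne_zero q)) h, qpow_wt q N ε s a c hc, mul_assoc,
    Algebra.smul_def]

theorem dmat_legM {F : Matrix (Fin (N + 1)) (Fin (N + 1)) ℂ} {s : ℤ}
    (hF : ∀ a b : Fin (N + 1), ((a : ℕ) : ℤ) ≠ (b : ℕ) + s → F a b = 0) {z : ℤ}
    (hz : z = - 2 * ε * s) :
    dmat q N ε * legM q _ F = leg q _ (Kpow q z) * legM q _ F * dmat q N ε := by
  ext a b
  rw [leg_eq, dmat, Matrix.diagonal_mul, Matrix.mul_diagonal, Matrix.diagonal_mul]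
  simp only [legM, AlgHom.mapMatrix_apply, Matrix.map_apply, Algebra.ofId_apply]
  by_cases h : ((a : ℕ) : ℤ) = (b : ℕ) + s
  · rw [mul_assoc, Algebra.commutes (F a b) (Kpow q (ε * ((N : ℤ) - 2 * (b : ℕ)))), ← mul_assoc,
      ← Kpow_add, h, hz]
    congr 2; ring
  · rw [hF a b h]; simp

theorem spinK_mul (c d : ℂ) : spinK q c N * spinK q d N = spinK q (c + d) N := by
  rw [spinK, spinK, spinK, Matrix.diagonal_mul_diagonal]
  congr 1; ext a; rw [← qpow_add]; congr 1; ring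

theorem Rplus_eq : Rplus q N = dmat q N 1 * ∑ n ∈ Finset.range (N + 1), rcoeff (qc q) n •
    ((leg q _ (Uq.K q) * leg q _ (Uq.Jp q)) ^ n
      * (legM q _ (spinRep q N (Uq.Jm q)) * legM q _ (spinRep q N (Uq.Kinv q))) ^ n) := by
  simp only [Rplus, dmat, one_mul, map_mul]

theorem Rminus_eq : Rminus q N = dmat q N (-1) * ∑ n ∈ Finset.range (N + 1), rcoeff (qc q)⁻¹ n •
    ((legM q _ (spinRep q N (Uq.Kinv q)) * legM q _ (spinRep q N (Uq.Jp q))) ^ n *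
      (leg q _ (Uq.Jm q) * leg q _ (Uq.K q)) ^ n) := by
  simp only [Rminus, dmat, neg_mul, one_mul, ← map_mul, ← map_pow, (leg_comm _ _).eq]

theorem shift_Jp (a b : Fin (N + 1)) (h : ((a : ℕ) : ℤ) ≠ (b : ℕ) + (-1)) :
    spinJp q N a b = 0 := by
  rw [spinJp, Matrix.of_apply, if_neg (by omega)]

theorem shift_Jm (a b : Fin (N + 1)) (h : ((a : ℕ) : ℤ) ≠ (b : ℕ) + 1) :
    spinJm q N a b = 0 := by
  rw [spinJm, Matrix.of_apply, if_neg (by omega)]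

theorem qc_inv_pow_ne_one (n : ℕ) : (qc q)⁻¹ ^ (n + 1) ≠ 1 := by
  rw [inv_pow, ne_eq, inv_eq_one]; exact qc_pow_ne_one q n

theorem K_Jp_s : Uq.K q * Uq.Jp q = (qc q ^ (1 : ℤ)) • (Uq.Jp q * Uq.K q) := by
  rw [zpow_one, (Uq.tuple q).kp]

theorem K_Jm_s : Uq.K q * Uq.Jm q = (qc q ^ (-1 : ℤ)) • (Uq.Jm q * Uq.K q) := by
  rw [zpow_neg_one, (Uq.tuple q).km]

end diag

section exchangeR

theorem commute_term {A : Type*} [Ring A] [Algebra ℂ A] {x e f : A} {c : ℂ} (hc : c ≠ 0)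
    (he : x * e = c • (e * x)) (hf : x * f = c⁻¹ • (f * x)) (n : ℕ) :
    Commute x (e ^ n * f ^ n) := by
  have h : ∀ (y : A) (b : ℂ), x * y = b • (y * x) → x * y ^ n = b ^ n • (y ^ n * x) := by
    intro y b hy
    induction n with
    | zero => simp
    | succ n ih =>
      rw [pow_succ, ← mul_assoc, ih, smul_mul_assoc, mul_assoc, hy, mul_smul_comm, smul_smul,
        ← mul_assoc, pow_succ]
  rw [Commute, SemiconjBy, ← mul_assoc, h e c he, smul_mul_assoc, mul_assoc, h f c⁻¹ hf,
    mul_smul_comm, smul_smul, ← mul_pow, mul_inv_cancel₀ hc, one_pow, one_smul, mul_assoc]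

theorem rmatrix_exchange_k {A : Type*} [Ring A] [Algebra ℂ A] {Q : ℂ}
    {k₁ k₁' p₁ m₁ k₂ k₂' p₂ m₂ d : A} (h0 : Q ≠ 0)
    (t₁ : UqTuple Q k₁ k₁' p₁ m₁) (t₂ : UqTuple Q k₂ k₂' p₂ m₂)
    (hc : TuplesCommute k₁ k₁' p₁ m₁ k₂ k₂' p₂ m₂) (M : ℕ)
    (dk₂ : Commute d k₂) (dk₁ : Commute d k₁) :
    (d * ∑ n ∈ Finset.range M, rcoeff Q n • ((k₁ * p₁) ^ n * (m₂ * k₂') ^ n))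
        * (k₁ * k₂) =
      (k₂ * k₁) *
        (d * ∑ n ∈ Finset.range M, rcoeff Q n • ((k₁ * p₁) ^ n * (m₂ * k₂') ^ n)) := by
  have c12 : Commute k₁ k₂ := hc _ (by simp) _ (by simp)
  have c13 : Commute k₁ k₂' := hc _ (by simp) _ (by simp)
  have c14 : Commute k₁ m₂ := hc _ (by simp) _ (by simp)
  have c32 : Commute p₁ k₂ := hc _ (by simp) _ (by simp)
  rw [← c12.eq]
  refine (Commute.mul_right ?_ (Commute.sum_right _ _ _ fun n _ => Commute.smul_right
    (commute_term h0 ?_ ?_ n) _) : Commute (k₁ * k₂) _).eq.symm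
  · exact (dk₁.mul_right dk₂).symm
  · have h : k₁ * (k₁ * p₁) = Q • ((k₁ * p₁) * k₁) := by
      rw [t₁.kp, mul_smul_comm, smul_mul_assoc, ← mul_assoc, t₁.kp, smul_mul_assoc]
    rw [mul_assoc, ((c12.mul_left c32).eq).symm, ← mul_assoc, h, smul_mul_assoc, mul_assoc]
  · have h : k₂ * (m₂ * k₂') = Q⁻¹ • ((m₂ * k₂') * k₂) := by
      rw [← mul_assoc, t₂.km, smul_mul_assoc, mul_assoc, mul_assoc, t₂.kk', t₂.k'k]
    rw [mul_assoc, h, mul_smul_comm, ← mul_assoc, (c14.mul_right c13).eq, mul_assoc]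

variable (q : DefParam) (N : ℕ)

theorem spinK_two : legM q _ (spinK q 2 N) =
    legM q _ (spinRep q N (Uq.K q)) * legM q _ (spinRep q N (Uq.K q)) := by
  rw [← map_mul, spinRep_K, spinK_mul]; norm_num

theorem spinK_neg_two : legM q _ (spinK q (-2) N) =
    legM q _ (spinRep q N (Uq.Kinv q)) * legM q _ (spinRep q N (Uq.Kinv q)) := by
  rw [← map_mul, spinRep_Kinv, spinK_mul]; norm_num

/-- `R Δ(x) = Δ^{op}(x) R` for `R^{(+)}`. -/
theorem Rplus_exchange (x : Uq q) :
    Rplus q N * actL (spinRep q N) x = actR (spinRep q N) x * Rplus q N := by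
  have hq := qc_ne_zero q
  have h1 := qc_pow_ne_one q
  have t₁ := (Uq.tuple q).map (leg q (Fin (N + 1)))
  have t₂ := (Uq.tuple q).map ((legM q (Fin (N + 1))).comp (spinRep q N))
  simp only [AlgHom.comp_apply] at t₂
  have hM : (leg q _ (Uq.K q) * leg q _ (Uq.Jp q)) ^ (N + 1) * (legM q _ (spinRep q N (Uq.Jm q)) *
      legM q _ (spinRep q N (Uq.Kinv q))) ^ (N + 1) = 0 := by
    rw [← map_mul (legM q _), ← map_mul (spinRep q N), ← map_pow,
      pow_shift_eq_zero (Or.inl rfl) (shift_f q N) _ (Nat.lt_succ_self N), map_zero, mul_zero]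
  have cK : Commute (dmat q N 1) (leg q _ (Uq.K q)) := Kpow_one q ▸ dmat_comm_leg q N 1 1
  have cKinv : Commute (dmat q N 1) (leg q _ (Uq.Kinv q)) :=
    Kpow_neg_one q ▸ dmat_comm_leg q N 1 (-1)
  have cM : Commute (dmat q N 1) (legM q _ (spinRep q N (Uq.K q))) :=
    spinRep_K q N ▸ dmat_comm_legM q N 1 1
  have cMinv : Commute (dmat q N 1) (legM q _ (spinRep q N (Uq.Kinv q))) :=
    spinRep_Kinv q N ▸ dmat_comm_legM q N 1 (-1)
  have hc := legs_tuplesCommute q (ι := Fin (N + 1)) (Uq.K q) (Uq.Kinv q) (Uq.Jp q) (Uq.Jm q)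
    (spinRep q N (Uq.K q)) (spinRep q N (Uq.Kinv q)) (spinRep q N (Uq.Jp q))
    (spinRep q N (Uq.Jm q))
  have lc := fun (x : Uq q) M => (leg_comm (q := q) (ι := Fin (N + 1)) x M).eq
  have hK : Rplus q N * actL (spinRep q N) (Uq.K q) =
      actR (spinRep q N) (Uq.K q) * Rplus q N := by
    rw [actL_K, actR_K, Rplus_eq]
    exact rmatrix_exchange_k hq t₁ t₂ hc _ cM cK
  refine exchange_of_gens _ hK (exchange_Kinv _ hK) ?_ ?_ x
  · rw [actL_Jp, actR_Jp, Rplus_eq, ← lc, ← lc (Uq.K q)]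
    refine rmatrix_exchange_p hq h1 t₁ t₂ hc _ hM ?_ ?_ cMinv cKinv
    · rw [dmat_leg q N 1 (K_Jp_s q) (c := 2) (by norm_num), spinK_two, ← map_mul, ← lc, map_mul,
        ← mul_assoc]
    · rw [spinRep_Jp, dmat_legM q N 1 (shift_Jp q N) (z := 2) (by norm_num), Kpow_two, map_mul]
  · rw [actL_Jm, actR_Jm, Rplus_eq, ← lc, ← lc (Uq.K q)]
    refine rmatrix_exchange_m hq h1 t₁ t₂ hc _ hM ?_ ?_ cM cK
    · rw [dmat_leg q N 1 (K_Jm_s q) (c := -2) (by norm_num), spinK_neg_two, ← map_mul, ← lc,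
        map_mul, ← mul_assoc]
    · rw [spinRep_Jm, dmat_legM q N 1 (shift_Jm q N) (z := -2) (by norm_num), Kpow_neg_two,
        map_mul]

/-- `R Δ(x) = Δ^{op}(x) R` for `R^{(-)}`. -/
theorem Rminus_exchange (x : Uq q) :
    Rminus q N * actL (spinRep q N) x = actR (spinRep q N) x * Rminus q N := by
  have hq := inv_ne_zero (qc_ne_zero q)
  have h1 := qc_inv_pow_ne_one q
  have t₂ := ((Uq.tuple q).map (leg q (Fin (N + 1)))).invParam (qc_ne_zero q)
  have t₁ := ((Uq.tuple q).map ((legM q (Fin (N + 1))).comp (spinRep q N))).invParam (qc_ne_zero q)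
  simp only [AlgHom.comp_apply] at t₁
  have hM : (legM q _ (spinRep q N (Uq.Kinv q)) * legM q _ (spinRep q N (Uq.Jp q))) ^ (N + 1) *
      (leg q _ (Uq.Jm q) * leg q _ (Uq.K q)) ^ (N + 1) = 0 := by
    rw [← map_mul (legM q _), ← map_mul (spinRep q N), ← map_pow,
      pow_shift_eq_zero (Or.inr rfl) (shift_e q N) _ (Nat.lt_succ_self N), map_zero, zero_mul]
  have cK : Commute (dmat q N (-1)) (leg q _ (Uq.K q)) := Kpow_one q ▸ dmat_comm_leg q N (-1) 1
  have cKinv : Commute (dmat q N (-1)) (leg q _ (Uq.Kinv q)) :=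
    Kpow_neg_one q ▸ dmat_comm_leg q N (-1) (-1)
  have cM : Commute (dmat q N (-1)) (legM q _ (spinRep q N (Uq.K q))) :=
    spinRep_K q N ▸ dmat_comm_legM q N (-1) 1
  have cMinv : Commute (dmat q N (-1)) (legM q _ (spinRep q N (Uq.Kinv q))) :=
    spinRep_Kinv q N ▸ dmat_comm_legM q N (-1) (-1)
  have hc := legs_tuplesCommute' q (ι := Fin (N + 1)) (Uq.Kinv q) (Uq.K q) (Uq.Jp q) (Uq.Jm q)
    (spinRep q N (Uq.Kinv q)) (spinRep q N (Uq.K q)) (spinRep q N (Uq.Jp q))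
    (spinRep q N (Uq.Jm q))
  have lc := fun (x : Uq q) M => (leg_comm (q := q) (ι := Fin (N + 1)) x M).eq
  have hKinv : Rminus q N * actL (spinRep q N) (Uq.Kinv q) =
      actR (spinRep q N) (Uq.Kinv q) * Rminus q N := by
    rw [actL_one _ (Uq.comul_Kinv q), actR_one _ (Uq.comul_Kinv q), Rminus_eq, lc]
    have h := rmatrix_exchange_k hq t₁ t₂ hc (N + 1) cKinv cMinv
    rw [lc] at h
    exact h
  have hK : Rminus q N * actL (spinRep q N) (Uq.K q) =
      actR (spinRep q N) (Uq.K q) * Rminus q N := by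
    have h1 : actR (spinRep q N) (Uq.K q) * actR (spinRep q N) (Uq.Kinv q) = 1 := by
      rw [← map_mul, Uq.K_Kinv, map_one]
    have h2 : actL (spinRep q N) (Uq.Kinv q) * actL (spinRep q N) (Uq.K q) = 1 := by
      rw [← map_mul, Uq.Kinv_K, map_one]
    calc _ = actR (spinRep q N) (Uq.K q) * (actR (spinRep q N) (Uq.Kinv q) * Rminus q N)
          * actL (spinRep q N) (Uq.K q) := by rw [← mul_assoc (actR _ _), h1, one_mul]
      _ = _ := by rw [← hKinv, mul_assoc, mul_assoc, h2, mul_one]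
  refine exchange_of_gens _ hK hKinv ?_ ?_ x
  · rw [actL_Jp, actR_Jp, Rminus_eq, lc, lc (Uq.Jp q), add_comm (_ * leg q _ (Uq.Kinv q)),
      add_comm (legM q _ (spinRep q N (Uq.Kinv q)) * leg q _ (Uq.Jp q))]
    refine rmatrix_exchange_p hq h1 t₁ t₂ hc _ hM ?_ ?_ cK cM
    · rw [spinRep_Jp, dmat_legM q N (-1) (shift_Jp q N) (z := -2) (by norm_num), Kpow_neg_two,
        lc, map_mul, ← mul_assoc]
    · rw [dmat_leg q N (-1) (K_Jp_s q) (c := -2) (by norm_num), spinK_neg_two]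
  · rw [actL_Jm, actR_Jm, Rminus_eq, lc, lc (Uq.Jm q), add_comm (_ * leg q _ (Uq.Kinv q)),
      add_comm (legM q _ (spinRep q N (Uq.Kinv q)) * leg q _ (Uq.Jm q))]
    refine rmatrix_exchange_m hq h1 t₁ t₂ hc _ hM ?_ ?_ cKinv cMinv
    · rw [spinRep_Jm, dmat_legM q N (-1) (shift_Jm q N) (z := 2) (by norm_num), Kpow_two,
        lc, map_mul, ← mul_assoc]
    · rw [dmat_leg q N (-1) (K_Jm_s q) (c := 2) (by norm_num), spinK_two]

end exchangeR

section comulR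

variable {Q : ℂ}

/-- The ratio of consecutive coefficients. -/
def rratio (Q : ℂ) (n : ℕ) : ℂ := Q * (1 - (Q⁻¹ ^ 2) ^ n) / (Q - Q⁻¹) ^ 2

theorem sub_inv_ne_zero (h0 : Q ≠ 0) (h1 : ∀ n : ℕ, Q ^ (n + 1) ≠ 1) : Q - Q⁻¹ ≠ 0 := by
  intro e
  field_simp at e
  exact h1 1 (by linear_combination e)

theorem rratio_ne_zero (h0 : Q ≠ 0) (h1 : ∀ n : ℕ, Q ^ (n + 1) ≠ 1) (n : ℕ) :
    rratio Q (n + 1) ≠ 0 := by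
  have hl := sub_inv_ne_zero h0 h1
  refine div_ne_zero (mul_ne_zero h0 (sub_ne_zero.2 fun e => ?_)) (pow_ne_zero _ hl)
  rw [← pow_mul, inv_pow, eq_comm, inv_eq_one] at e
  exact h1 (2 * n + 1) (by rw [← e]; ring)

theorem rratio_succ (h0 : Q ≠ 0) (h1 : ∀ n : ℕ, Q ^ (n + 1) ≠ 1) (n : ℕ) :
    rratio Q (n + 1) * rcoeff Q (n + 1) = rcoeff Q n := by
  have hl := sub_inv_ne_zero h0 h1
  have h := rcoeff_succ h0 h1 n
  have hQ := pow_ne_zero n h0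
  have e : rratio Q (n + 1) = (Q ^ (n + 1) - (Q ^ (n + 1))⁻¹) * (Q ^ n)⁻¹ / (Q - Q⁻¹) ^ 2 := by
    rw [rratio]
    congr 1
    rw [← pow_mul, inv_pow]
    field_simp
    ring
  rw [e, div_mul_eq_mul_div, div_eq_iff (pow_ne_zero _ hl)]
  calc _ = (rcoeff Q (n + 1) * (Q ^ (n + 1) - (Q ^ (n + 1))⁻¹)) * (Q ^ n)⁻¹ := by ring
    _ = _ := by rw [h]; field_simp

theorem rratio_add (i j : ℕ) : rratio Q i + (Q⁻¹ ^ 2) ^ i * rratio Q j = rratio Q (i + j) := by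
  simp only [rratio, pow_add]; ring

theorem rcoeff_binomial {A : Type*} [Ring A] [Algebra ℂ A] (h0 : Q ≠ 0)
    (h1 : ∀ n : ℕ, Q ^ (n + 1) ≠ 1) {u v : A} (h : u * v = Q⁻¹ ^ 2 • (v * u)) (n : ℕ) :
    rcoeff Q n • (u + v) ^ n =
      ∑ p ∈ Finset.HasAntidiagonal.antidiagonal n, (rcoeff Q p.1 * rcoeff Q p.2) • (v ^ p.1 * u ^ p.2) := by
  have hv : ∀ i, u * v ^ i = (Q⁻¹ ^ 2) ^ i • (v ^ i * u) := by
    intro i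
    induction i with
    | zero => simp
    | succ i ih =>
      rw [pow_succ, ← mul_assoc, ih, smul_mul_assoc, mul_assoc, h, mul_smul_comm, smul_smul,
        ← mul_assoc, pow_succ (Q⁻¹ ^ 2)]
  induction n with
  | zero => simp [rcoeff_zero]
  | succ n ih =>
    have hg := rratio_ne_zero h0 h1 n
    apply smul_right_injective A hg
    simp only
    rw [smul_smul, rratio_succ h0 h1, pow_succ', ← mul_smul_comm, ih]
    have e : rratio Q (n + 1) • ∑ p ∈ Finset.HasAntidiagonal.antidiagonal (n + 1),
          (rcoeff Q p.1 * rcoeff Q p.2) • (v ^ p.1 * u ^ p.2) =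
        (∑ p ∈ Finset.HasAntidiagonal.antidiagonal (n + 1),
          (rratio Q p.1 * rcoeff Q p.1 * rcoeff Q p.2) • (v ^ p.1 * u ^ p.2)) +
        ∑ p ∈ Finset.HasAntidiagonal.antidiagonal (n + 1),
          ((Q⁻¹ ^ 2) ^ p.1 * rcoeff Q p.1 * (rratio Q p.2 * rcoeff Q p.2)) •
            (v ^ p.1 * u ^ p.2) := by
      rw [Finset.smul_sum, ← Finset.sum_add_distrib]
      refine Finset.sum_congr rfl fun p hp => ?_
      rw [← Finset.HasAntidiagonal.mem_antidiagonal.1 hp, ← rratio_add, smul_smul, ← add_smul]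
      congr 1
      ring
    have hz : rratio Q 0 = 0 := by simp [rratio]
    rw [e, Finset.Nat.sum_antidiagonal_succ, Finset.Nat.sum_antidiagonal_succ', hz]
    simp only [zero_mul, mul_zero, zero_smul, zero_add, rratio_succ h0 h1]
    rw [← Finset.sum_add_distrib, Finset.mul_sum]
    refine Finset.sum_congr rfl fun p _ => ?_
    rw [mul_smul_comm, add_mul, ← mul_assoc, ← mul_assoc, hv, smul_mul_assoc, mul_assoc (v ^ p.1),
      ← pow_succ', ← pow_succ', smul_add, smul_smul, add_comm]
    congr 2
    ring

/-- The matrix `diag(W) ∑_n rcoeff(n) e^n ⊗ F^n`. -/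
theorem comul_rmatrix {q : DefParam} (h0 : Q ≠ 0)
    (h1 : ∀ n : ℕ, Q ^ (n + 1) ≠ 1) {N : ℕ} {W : Fin (N + 1) → Uq q} {e k : Uq q}
    {F : Matrix (Fin (N + 1)) (Fin (N + 1)) ℂ} {L : Matrix (Fin (N + 1)) (Fin (N + 1)) (Uq q)}
    (hL : ∀ a b, L a b = ∑ n ∈ Finset.range (N + 1), (rcoeff Q n * (F ^ n) a b) • (W a * e ^ n))
    (hF : ∀ n, N < n → F ^ n = 0)
    (hW : ∀ a, Coalgebra.comul (R := ℂ) (W a) = W a ⊗ₜ[ℂ] W a)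
    (he : Coalgebra.comul (R := ℂ) e = 1 ⊗ₜ[ℂ] e + e ⊗ₜ[ℂ] k)
    (hke : e * k = Q⁻¹ ^ 2 • (k * e))
    (hWk : ∀ a c, F a c ≠ 0 → W c = W a * k) (a b : Fin (N + 1)) :
    Coalgebra.comul (R := ℂ) (L a b) = ∑ c, L a c ⊗ₜ[ℂ] L c b := by
  have hWk' : ∀ i a c, (F ^ i) a c • W c = (F ^ i) a c • (W a * k ^ i) := by
    intro i a c
    by_cases h : (F ^ i) a c = 0
    · rw [h, zero_smul, zero_smul]
    congr 1
    induction i generalizing c with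
    | zero =>
      have : a = c := by by_contra hac; exact h (by simp [hac])
      simp [this]
    | succ i ih =>
      rw [pow_succ, Matrix.mul_apply] at h
      obtain ⟨d, -, hd⟩ := Finset.exists_ne_zero_of_sum_ne_zero h
      rw [hWk d c (right_ne_zero_of_mul hd), ih d (left_ne_zero_of_mul hd), pow_succ, mul_assoc]
  have huv : ((1 : Uq q) ⊗ₜ[ℂ] e) * (e ⊗ₜ[ℂ] k) =
      Q⁻¹ ^ 2 • ((e ⊗ₜ[ℂ] k) * ((1 : Uq q) ⊗ₜ[ℂ] e)) := by
    simp only [Algebra.TensorProduct.tmul_mul_tmul, one_mul, mul_one, hke,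
      TensorProduct.tmul_smul]
  have hpow : ∀ n, Coalgebra.comul (R := ℂ) (e ^ n) = (1 ⊗ₜ[ℂ] e + e ⊗ₜ[ℂ] k) ^ n := by
    intro n
    rw [Bialgebra.comul_pow, he]
  let G : ℕ → ℕ → Uq q ⊗[ℂ] Uq q := fun i j =>
    (rcoeff Q i * rcoeff Q j * (F ^ (i + j)) a b) • ((W a * e ^ i) ⊗ₜ[ℂ] (W a * k ^ i * e ^ j))
  have hleft : Coalgebra.comul (R := ℂ) (L a b) =
      ∑ n ∈ Finset.range (N + 1), ∑ p ∈ Finset.HasAntidiagonal.antidiagonal n, G p.1 p.2 := by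
    rw [hL, map_sum]
    refine Finset.sum_congr rfl fun n _ => ?_
    rw [map_smul, Bialgebra.comul_mul, hW, hpow, mul_comm (rcoeff Q n), ← smul_smul,
      ← mul_smul_comm, rcoeff_binomial h0 h1 huv, Finset.mul_sum, Finset.smul_sum]
    refine Finset.sum_congr rfl fun p hp => ?_
    simp only [G]
    rw [← Finset.HasAntidiagonal.mem_antidiagonal.1 hp, mul_smul_comm, smul_smul,
      mul_comm ((F ^ (p.1 + p.2)) a b)]
    simp only [Algebra.TensorProduct.tmul_pow, Algebra.TensorProduct.tmul_mul_tmul, one_pow,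
      mul_one, mul_assoc]
  have hG : ∀ i j, N < i + j → G i j = 0 := by
    intro i j hij
    simp only [G]
    rw [hF _ hij]
    simp
  have hright : ∑ c, L a c ⊗ₜ[ℂ] L c b =
      ∑ i ∈ Finset.range (N + 1), ∑ j ∈ Finset.range (N + 1), G i j := by
    simp only [hL, TensorProduct.sum_tmul, TensorProduct.tmul_sum]
    rw [Finset.sum_comm]
    conv_rhs => rw [Finset.sum_comm]
    refine Finset.sum_congr rfl fun j _ => ?_
    rw [Finset.sum_comm]
    refine Finset.sum_congr rfl fun i _ => ?_
    simp only [G]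
    rw [pow_add, Matrix.mul_apply, Finset.mul_sum, Finset.sum_smul]
    refine Finset.sum_congr rfl fun c _ => ?_
    have e1 : ((rcoeff Q i * (F ^ i) a c) • (W a * e ^ i)) ⊗ₜ[ℂ] ((rcoeff Q j * (F ^ j) c b) •
        (W c * e ^ j)) = (rcoeff Q i * rcoeff Q j * (F ^ j) c b) •
          ((W a * e ^ i) ⊗ₜ[ℂ] (((F ^ i) a c • W c) * e ^ j)) := by
      simp only [TensorProduct.smul_tmul', smul_mul_assoc, TensorProduct.tmul_smul, smul_smul]
      congr 2
      ring
    rw [e1, hWk', smul_mul_assoc, TensorProduct.tmul_smul, smul_smul]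
    congr 1
    ring
  rw [hleft, hright]
  simp only [Finset.Nat.antidiagonal_eq_map, Finset.sum_map]
  refine (Finset.sum_range_diag_flip (N + 1) G).trans ?_
  refine Finset.sum_congr rfl fun i hi => Finset.sum_subset
    (Finset.range_subset_range.2 (Nat.sub_le _ _)) fun j _ hj => hG i j ?_
  rw [Finset.mem_range] at hi hj
  omega

end comulR

section comulL

variable (q : DefParam) (N : ℕ)

theorem comul_KJp : Coalgebra.comul (R := ℂ) (Uq.K q * Uq.Jp q) =
    1 ⊗ₜ[ℂ] (Uq.K q * Uq.Jp q) + (Uq.K q * Uq.Jp q) ⊗ₜ[ℂ] Kpow q 2 := by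
  rw [Bialgebra.comul_mul, Uq.comul_K, Uq.comul_Jp, Kpow_two, mul_add]
  simp only [Algebra.TensorProduct.tmul_mul_tmul, Uq.K_Kinv]

theorem comul_JmK : Coalgebra.comul (R := ℂ) (Uq.Jm q * Uq.K q) =
    1 ⊗ₜ[ℂ] (Uq.Jm q * Uq.K q) + (Uq.Jm q * Uq.K q) ⊗ₜ[ℂ] Kpow q 2 := by
  rw [Bialgebra.comul_mul, Uq.comul_K, Uq.comul_Jm, Kpow_two, add_mul]
  simp only [Algebra.TensorProduct.tmul_mul_tmul, Uq.Kinv_K]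

theorem KJp_K2 : Uq.K q * Uq.Jp q * Kpow q 2 = (qc q)⁻¹ ^ 2 • (Kpow q 2 * (Uq.K q * Uq.Jp q)) := by
  have hq := qc_ne_zero q
  have h : Uq.K q * (Uq.K q * Uq.Jp q) = qc q • ((Uq.K q * Uq.Jp q) * Uq.K q) := by
    rw [(Uq.tuple q).kp, mul_smul_comm, smul_mul_assoc, ← mul_assoc, (Uq.tuple q).kp,
      smul_mul_assoc]
  rw [Kpow_mul hq h, smul_smul, zpow_ofNat, ← mul_pow, inv_mul_cancel₀ hq, one_pow, one_smul]

theorem JmK_K2 : Uq.Jm q * Uq.K q * Kpow q 2 =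
    (qc q)⁻¹⁻¹ ^ 2 • (Kpow q 2 * (Uq.Jm q * Uq.K q)) := by
  have hq := inv_ne_zero (qc_ne_zero q)
  have h : Uq.K q * (Uq.Jm q * Uq.K q) = (qc q)⁻¹ • ((Uq.Jm q * Uq.K q) * Uq.K q) := by
    rw [← mul_assoc, (Uq.tuple q).km, smul_mul_assoc]
  rw [Kpow_mul hq h, smul_smul, zpow_ofNat, ← mul_pow, inv_mul_cancel₀ hq, one_pow, one_smul]

theorem rmatrix_entry (W : Fin (N + 1) → Uq q) (e : Uq q) (Q : ℂ)
    (F : Matrix (Fin (N + 1)) (Fin (N + 1)) ℂ) (a b : Fin (N + 1)) :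
    (Matrix.diagonal W * ∑ n ∈ Finset.range (N + 1), rcoeff Q n •
      (leg q (Fin (N + 1)) e ^ n * legM q (Fin (N + 1)) F ^ n) :
        Matrix (Fin (N + 1)) (Fin (N + 1)) (Uq q)) a b =
      ∑ n ∈ Finset.range (N + 1), (rcoeff Q n * (F ^ n) a b) • (W a * e ^ n) := by
  rw [Matrix.diagonal_mul, Matrix.sum_apply, Finset.mul_sum]
  refine Finset.sum_congr rfl fun n _ => ?_
  rw [← map_pow, ← map_pow, leg_eq, Matrix.smul_apply, Matrix.diagonal_mul]
  simp only [legM, AlgHom.mapMatrix_apply, Matrix.map_apply, Algebra.ofId_apply]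
  rw [← Algebra.commutes, ← Algebra.smul_def, mul_smul_comm, mul_smul_comm, smul_smul]

theorem comul_Rplus (a b : Fin (N + 1)) : Coalgebra.comul (R := ℂ) (Rplus q N a b) =
    ∑ c, Rplus q N a c ⊗ₜ[ℂ] Rplus q N c b := by
  refine comul_rmatrix (qc_ne_zero q) (qc_pow_ne_one q) (rmatrix_entry q N _ _ _ _)
    (pow_shift_eq_zero (Or.inl rfl) (shift_f q N)) (fun a => comul_Kpow q _) (comul_KJp q)
    (KJp_K2 q) (fun a c h => ?_) a b
  rw [← Kpow_add]
  congr 1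
  by_contra hn
  exact h (shift_f q N a c (by omega))

theorem comul_Rminus (a b : Fin (N + 1)) : Coalgebra.comul (R := ℂ) (Rminus q N a b) =
    ∑ c, Rminus q N a c ⊗ₜ[ℂ] Rminus q N c b := by
  refine comul_rmatrix (inv_ne_zero (qc_ne_zero q)) (qc_inv_pow_ne_one q)
    (rmatrix_entry q N _ _ _ _)
    (pow_shift_eq_zero (Or.inr rfl) (shift_e q N)) (fun a => comul_Kpow q _) (comul_JmK q)
    (JmK_K2 q) (fun a c h => ?_) a b
  rw [← Kpow_add]
  congr 1
  by_contra hn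
  exact h (shift_e q N a c (by omega))

theorem counit_rmatrix {q : DefParam} {N : ℕ} (W : Fin (N + 1) → Uq q) (e : Uq q) (Q : ℂ)
    (F : Matrix (Fin (N + 1)) (Fin (N + 1)) ℂ)
    (hW : ∀ a, Coalgebra.counit (R := ℂ) (W a) = 1) (he : Coalgebra.counit (R := ℂ) e = 0)
    (a b : Fin (N + 1)) :
    Coalgebra.counit (R := ℂ) ((Matrix.diagonal W * ∑ n ∈ Finset.range (N + 1), rcoeff Q n •
      (leg q (Fin (N + 1)) e ^ n * legM q (Fin (N + 1)) F ^ n) :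
        Matrix (Fin (N + 1)) (Fin (N + 1)) (Uq q)) a b) = if a = b then 1 else 0 := by
  rw [rmatrix_entry, map_sum, Finset.sum_eq_single 0]
  · simp only [rcoeff_zero, pow_zero, mul_one, one_mul, Matrix.one_apply, map_smul, hW, smul_eq_mul]
  · intro n _ hn
    rw [map_smul, Bialgebra.counit_mul, Bialgebra.counit_pow, he, zero_pow hn, mul_zero, smul_zero]
  · simp

theorem counit_Rplus (a b : Fin (N + 1)) :
    Coalgebra.counit (R := ℂ) (Rplus q N a b) = if a = b then 1 else 0 :=
  counit_rmatrix _ _ _ _ (fun _ => counit_Kpow q _)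
    (by rw [Bialgebra.counit_mul, Uq.counit_Jp, mul_zero]) a b

theorem counit_Rminus (a b : Fin (N + 1)) :
    Coalgebra.counit (R := ℂ) (Rminus q N a b) = if a = b then 1 else 0 :=
  counit_rmatrix _ _ _ _ (fun _ => counit_Kpow q _)
    (by rw [Bialgebra.counit_mul, Uq.counit_Jm, zero_mul]) a b

end comulL

/-! ## Finite-dimensional representations of the quantum double -/

section kron

variable (ι ι' : Type) [Fintype ι] [DecidableEq ι] [Fintype ι'] [DecidableEq ι']
variable (R : Type) [Ring R] [Algebra ℂ R]

/-- `M ↦ M ⊗ 1`. -/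
def kron₁ : Matrix ι ι R →ₐ[ℂ] Matrix (ι × ι') (ι × ι') R where
  toFun M := Matrix.of fun p r => if p.2 = r.2 then M p.1 r.1 else 0
  map_one' := by
    ext p r
    simp only [Matrix.of_apply, Matrix.one_apply, Prod.ext_iff]
    split_ifs <;> tauto
  map_mul' M M' := by
    ext p r
    simp [Matrix.mul_apply, Fintype.sum_prod_type]
  map_zero' := by ext p r; simp
  map_add' M M' := by ext p r; simp; split_ifs <;> simp
  commutes' c := by
    ext p r
    simp only [Matrix.of_apply, Matrix.algebraMap_matrix_apply, Prod.ext_iff]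
    split_ifs <;> tauto

/-- `M ↦ 1 ⊗ M`. -/
def kron₂ : Matrix ι' ι' R →ₐ[ℂ] Matrix (ι × ι') (ι × ι') R where
  toFun M := Matrix.of fun p r => if p.1 = r.1 then M p.2 r.2 else 0
  map_one' := by
    ext p r
    simp only [Matrix.of_apply, Matrix.one_apply, Prod.ext_iff]
    split_ifs <;> tauto
  map_mul' M M' := by
    ext p r
    simp [Matrix.mul_apply, Fintype.sum_prod_type]
  map_zero' := by ext p r; simp
  map_add' M M' := by ext p r; simp; split_ifs <;> simp
  commutes' c := by
    ext p r
    simp only [Matrix.of_apply, Matrix.algebraMap_matrix_apply, Prod.ext_iff]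
    split_ifs <;> tauto

end kron

section finrep

variable (q : DefParam) (M N : ℕ)

/-- The index set of a basis of the representation space `V_{M/2} ⊗ V_{N/2}`. -/
abbrev FinIdx (M N : ℕ) : Type := Fin (M + 1) × Fin (N + 1)

theorem kron_comm {ι ι' : Type} [Fintype ι] [DecidableEq ι] [Fintype ι'] [DecidableEq ι']
    {R : Type} [Ring R] [Algebra ℂ R] {A : Matrix ι ι R} {B : Matrix ι' ι' R}
    (h : ∀ i j k l, Commute (A i j) (B k l)) :
    Commute (kron₁ ι ι' R A) (kron₂ ι ι' R B) := by
  ext p r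
  simp only [kron₁, kron₂, AlgHom.coe_mk, RingHom.coe_mk, MonoidHom.coe_mk, OneHom.coe_mk,
    Matrix.mul_apply, Matrix.of_apply, Fintype.sum_prod_type]
  simp [(h _ _ _ _).eq]

/-- `x ↦ ∑ π^{M/2}(x₍₁₎) ⊗ π^{N/2}(x₍₂₎)`. -/
def spinTensor : Uq q →ₐ[ℂ] Matrix (FinIdx M N) (FinIdx M N) ℂ :=
  (Algebra.TensorProduct.lift ((kron₁ (Fin (M + 1)) (Fin (N + 1)) ℂ).comp (spinRep q M))
    ((kron₂ (Fin (M + 1)) (Fin (N + 1)) ℂ).comp (spinRep q N))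
    fun _ _ => kron_comm fun _ _ _ _ => Commute.all _ _).comp (Uq.comulHom q)

/-- The matrix `X_{(a,a'),(b,b')} = L^{(-)}_{a'b'} L^{(+)}_{ab}` over `U_q(su(2))`. -/
def Xmat : Matrix (FinIdx M N) (FinIdx M N) (Uq q) :=
  Matrix.of fun p r => Rminus q N p.2 r.2 * Rplus q M p.1 r.1

theorem Xmat_eq : Xmat q M N = kron₂ (Fin (M + 1)) (Fin (N + 1)) (Uq q) (Rminus q N) *
    kron₁ (Fin (M + 1)) (Fin (N + 1)) (Uq q) (Rplus q M) := by
  ext p r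
  simp [kron₁, kron₂, Xmat, Matrix.mul_apply, Fintype.sum_prod_type]

theorem comul_Xmat (p r : FinIdx M N) : Coalgebra.comul (R := ℂ) (Xmat q M N p r) =
    ∑ s, Xmat q M N p s ⊗ₜ[ℂ] Xmat q M N s r := by
  simp only [Xmat, Matrix.of_apply, Bialgebra.comul_mul, comul_Rplus, comul_Rminus,
    Finset.sum_mul_sum, Algebra.TensorProduct.tmul_mul_tmul, Fintype.sum_prod_type]
  exact Finset.sum_comm

theorem counit_Xmat (p r : FinIdx M N) :
    Coalgebra.counit (R := ℂ) (Xmat q M N p r) = if p = r then 1 else 0 := by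
  simp only [Xmat, Matrix.of_apply, Bialgebra.counit_mul, counit_Rplus, counit_Rminus,
    Prod.ext_iff]
  split_ifs <;> simp_all

theorem spinTensor_one {x u v : Uq q} (h : Coalgebra.comul (R := ℂ) x = u ⊗ₜ[ℂ] v) :
    spinTensor q M N x = kron₁ _ _ ℂ (spinRep q M u) * kron₂ _ _ ℂ (spinRep q N v) := by
  refine (congrArg (Algebra.TensorProduct.lift
    ((kron₁ (Fin (M + 1)) (Fin (N + 1)) ℂ).comp (spinRep q M))
    ((kron₂ (Fin (M + 1)) (Fin (N + 1)) ℂ).comp (spinRep q N))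
    fun _ _ => kron_comm fun _ _ _ _ => Commute.all _ _) h).trans ?_
  exact Algebra.TensorProduct.lift_tmul _ _ _ _ _

theorem spinTensor_two {x u v u' v' : Uq q}
    (h : Coalgebra.comul (R := ℂ) x = u ⊗ₜ[ℂ] v + u' ⊗ₜ[ℂ] v') :
    spinTensor q M N x = kron₁ _ _ ℂ (spinRep q M u) * kron₂ _ _ ℂ (spinRep q N v) +
      kron₁ _ _ ℂ (spinRep q M u') * kron₂ _ _ ℂ (spinRep q N v') := by
  refine (congrArg (Algebra.TensorProduct.lift
    ((kron₁ (Fin (M + 1)) (Fin (N + 1)) ℂ).comp (spinRep q M))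
    ((kron₂ (Fin (M + 1)) (Fin (N + 1)) ℂ).comp (spinRep q N))
    fun _ _ => kron_comm fun _ _ _ _ => Commute.all _ _) h).trans ?_
  rw [map_add]
  exact congrArg₂ _ (Algebra.TensorProduct.lift_tmul _ _ _ _ _)
    (Algebra.TensorProduct.lift_tmul _ _ _ _ _)

/-- `X Δ(x) = Δ^{op}(x) X`. -/
theorem Xmat_exchange (x : Uq q) :
    Xmat q M N * actL (spinTensor q M N) x = actR (spinTensor q M N) x * Xmat q M N := by
  let E₁ := kron₁ (Fin (M + 1)) (Fin (N + 1)) (Uq q)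
  let E₂ := kron₂ (Fin (M + 1)) (Fin (N + 1)) (Uq q)
  let l := leg q (FinIdx M N)
  let A : Uq q → Matrix (FinIdx M N) (FinIdx M N) (Uq q) :=
    fun x => E₁ (legM q _ (spinRep q M x))
  let B : Uq q → Matrix (FinIdx M N) (FinIdx M N) (Uq q) :=
    fun x => E₂ (legM q _ (spinRep q N x))
  have l₁ : ∀ x, E₁ (leg q _ x) = l x := by
    intro x; ext p r
    simp only [E₁, l, kron₁, leg_eq, AlgHom.coe_mk, RingHom.coe_mk, MonoidHom.coe_mk,
      OneHom.coe_mk, Matrix.of_apply, Matrix.diagonal_apply]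
    simp only [leg, Matrix.scalarAlgHom_apply, Matrix.scalar_apply, Matrix.diagonal_apply,
      Prod.ext_iff]
    split_ifs <;> tauto
  have l₂ : ∀ x, E₂ (leg q _ x) = l x := by
    intro x; ext p r
    simp only [E₂, l, kron₂, leg_eq, AlgHom.coe_mk, RingHom.coe_mk, MonoidHom.coe_mk,
      OneHom.coe_mk, Matrix.of_apply, Matrix.diagonal_apply]
    simp only [leg, Matrix.scalarAlgHom_apply, Matrix.scalar_apply, Matrix.diagonal_apply,
      Prod.ext_iff]
    split_ifs <;> tauto
  have m₁ : ∀ F : Matrix (Fin (M + 1)) (Fin (M + 1)) ℂ,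
      legM q (FinIdx M N) (kron₁ _ _ ℂ F) = E₁ (legM q _ F) := by
    intro F; ext p r
    simp [E₁, kron₁, legM]
    split_ifs <;> simp
  have m₂ : ∀ F : Matrix (Fin (N + 1)) (Fin (N + 1)) ℂ,
      legM q (FinIdx M N) (kron₂ _ _ ℂ F) = E₂ (legM q _ F) := by
    intro F; ext p r
    simp [E₂, kron₂, legM]
    split_ifs <;> simp
  have cA : ∀ x Y, Commute (A x) (E₂ Y) := fun x Y => kron_comm fun i j k n => by
    simp only [legM, AlgHom.mapMatrix_apply, Matrix.map_apply, Algebra.ofId_apply]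
    exact Algebra.commutes _ _
  have cB : ∀ x Y, Commute (E₁ Y) (B x) := fun x Y => kron_comm fun i j k n => by
    simp only [legM, AlgHom.mapMatrix_apply, Matrix.map_apply, Algebra.ofId_apply]
    exact (Algebra.commutes _ _).symm
  have lA : ∀ x y, Commute (l x) (A y) := fun x y => by
    rw [← l₁]
    exact (leg_comm _ _).map E₁
  have lB : ∀ x y, Commute (l x) (B y) := fun x y => by
    rw [← l₂]
    exact (leg_comm _ _).map E₂
  have hX : Xmat q M N = E₂ (Rminus q N) * E₁ (Rplus q M) := Xmat_eq q M N
  have x₁ : ∀ x, E₁ (Rplus q M) * E₁ (actL (spinRep q M) x) =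
      E₁ (actR (spinRep q M) x) * E₁ (Rplus q M) := fun x => by
    rw [← map_mul, ← map_mul, Rplus_exchange]
  have x₂ : ∀ x, E₂ (Rminus q N) * E₂ (actL (spinRep q N) x) =
      E₂ (actR (spinRep q N) x) * E₂ (Rminus q N) := fun x => by
    rw [← map_mul, ← map_mul, Rminus_exchange]
  have hφ1 : ∀ {u v w : Uq q}, Coalgebra.comul (R := ℂ) u = v ⊗ₜ[ℂ] w →
      legM q _ (spinTensor q M N u) = A v * B w := by
    intro u v w h
    rw [spinTensor_one q M N h, map_mul, m₁, m₂]
  have hφ2 : ∀ {u v w v' w' : Uq q}, Coalgebra.comul (R := ℂ) u = v ⊗ₜ[ℂ] w + v' ⊗ₜ[ℂ] w' →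
      legM q _ (spinTensor q M N u) = A v * B w + A v' * B w' := by
    intro u v w v' w' h
    rw [spinTensor_two q M N h, map_add, map_mul, map_mul, m₁, m₁, m₂, m₂]
  have hK : Xmat q M N * actL (spinTensor q M N) (Uq.K q) =
      actR (spinTensor q M N) (Uq.K q) * Xmat q M N := by
    have a₁ := x₁ (Uq.K q)
    have a₂ := x₂ (Uq.K q)
    rw [actL_K, actR_K] at a₁ a₂
    simp only [map_mul, l₁, l₂] at a₁ a₂
    change _ * (_ * A (Uq.K q)) = A (Uq.K q) * _ * _ at a₁
    change _ * (_ * B (Uq.K q)) = B (Uq.K q) * _ * _ at a₂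
    rw [actL_K, actR_K, hφ1 (Uq.comul_K q), hX]
    change _ * _ * (l _ * _) = _ * l _ * _
    calc _ = E₂ (Rminus q N) * (E₁ (Rplus q M) * (l (Uq.K q) * A (Uq.K q))) * B (Uq.K q) := by
          simp only [mul_assoc]
      _ = E₂ (Rminus q N) * A (Uq.K q) * l (Uq.K q) * (E₁ (Rplus q M) * B (Uq.K q)) := by
          rw [a₁]; simp only [mul_assoc]
      _ = A (Uq.K q) * (E₂ (Rminus q N) * (l (Uq.K q) * B (Uq.K q))) * E₁ (Rplus q M) := by
          rw [(cB _ _).eq, ← (cA _ _).eq]; simp only [mul_assoc]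
      _ = _ := by rw [a₂]; simp only [mul_assoc]
  have hJ : ∀ J : Uq q, Coalgebra.comul (R := ℂ) J = Uq.Kinv q ⊗ₜ[ℂ] J + J ⊗ₜ[ℂ] Uq.K q →
      Xmat q M N * actL (spinTensor q M N) J = actR (spinTensor q M N) J * Xmat q M N := by
    intro J hJ
    have e₁ : actL (spinTensor q M N) J = E₁ (actL (spinRep q M) (Uq.Kinv q)) * B J +
        E₁ (actL (spinRep q M) J) * B (Uq.K q) := by
      rw [actL_two _ hJ, hφ2 hJ, hφ1 (Uq.comul_K q), actL_two _ hJ,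
        actL_one _ (Uq.comul_Kinv q)]
      simp only [map_add, map_mul, l₁]
      change l _ * _ + l _ * _ = l _ * A _ * _ + (l _ * A _ + l _ * A _) * _
      simp only [mul_add, add_mul, mul_assoc, add_assoc]
    have e₂ : E₁ (actR (spinRep q M) (Uq.Kinv q)) * B J +
        E₁ (actR (spinRep q M) J) * B (Uq.K q) =
        A (Uq.Kinv q) * E₂ (actL (spinRep q N) J) + A J * E₂ (actL (spinRep q N) (Uq.K q)) := by
      rw [actR_two _ hJ, actR_one _ (Uq.comul_Kinv q), actL_two _ hJ, actL_K]
      simp only [map_add, map_mul, l₁, l₂]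
      change A _ * l _ * _ + (A _ * l _ + A _ * l _) * _ =
        A _ * (l _ * B _ + l _ * B _) + A _ * (l _ * B _)
      simp only [mul_add, add_mul, mul_assoc, add_assoc]
    have e₃ : A (Uq.Kinv q) * E₂ (actR (spinRep q N) J) +
        A J * E₂ (actR (spinRep q N) (Uq.K q)) = actR (spinTensor q M N) J := by
      rw [actR_two _ hJ, actR_two _ hJ, hφ2 hJ, hφ1 (Uq.comul_Kinv q), actR_K]
      simp only [map_add, map_mul, l₂]
      change A _ * (B _ * l _ + B _ * l _) + A _ * (B _ * l _) = _ * l _ + _ * l _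
      simp only [mul_add, add_mul, mul_assoc, add_assoc]
    have f₁ : E₁ (Rplus q M) * actL (spinTensor q M N) J =
        (E₁ (actR (spinRep q M) (Uq.Kinv q)) * B J +
          E₁ (actR (spinRep q M) J) * B (Uq.K q)) * E₁ (Rplus q M) := by
      rw [e₁, mul_add, add_mul, ← mul_assoc, ← mul_assoc, x₁, x₁, mul_assoc, mul_assoc,
        (cB _ _).eq, (cB _ _).eq, ← mul_assoc, ← mul_assoc]
    have f₂ : E₂ (Rminus q N) * (A (Uq.Kinv q) * E₂ (actL (spinRep q N) J) +
        A J * E₂ (actL (spinRep q N) (Uq.K q))) =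
        actR (spinTensor q M N) J * E₂ (Rminus q N) := by
      rw [← e₃, mul_add, add_mul, ← mul_assoc, ← mul_assoc, ← (cA _ _).eq, ← (cA _ _).eq,
        mul_assoc, mul_assoc, x₂, x₂, ← mul_assoc, ← mul_assoc]
    rw [hX, mul_assoc, f₁, e₂, ← mul_assoc, f₂, mul_assoc]
  exact exchange_of_gens _ hK (exchange_Kinv _ hK) (hJ _ (Uq.comul_Jp q)) (hJ _ (Uq.comul_Jm q)) x

end finrep

section finrep

variable (q : DefParam) (M N : ℕ)

theorem evalO_mul {q : DefParam} (f f' : Oq q) (x : Uq q) : evalO (f * f') x =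
    LinearMap.mul' ℂ ℂ (TensorProduct.map (evalO f) (evalO f') (Coalgebra.comul x)) := rfl

/-- The action of the restricted dual: `f ↦ (f(X_{pr}))`. -/
def finO : Oq q →ₐ[ℂ] Matrix (FinIdx M N) (FinIdx M N) ℂ :=
  AlgHom.ofLinearMap
    { toFun := fun f => Matrix.of fun p r => evalO f (Xmat q M N p r)
      map_add' := fun f f' => rfl
      map_smul' := fun c f => rfl }
    (by
      ext p r
      change Coalgebra.counit (R := ℂ) (Xmat q M N p r) = _
      rw [counit_Xmat, Matrix.one_apply])
    (fun f f' => by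
      ext p r
      change evalO (f * f') (Xmat q M N p r) = _
      rw [evalO_mul, comul_Xmat, Matrix.mul_apply, map_sum, map_sum]
      rfl)

theorem finO_apply (f : Oq q) (p r : FinIdx M N) :
    finO q M N f p r = evalO f (Xmat q M N p r) := rfl

theorem swap_aux {q : DefParam} {ι κ : Type} [Fintype ι] [DecidableEq ι] [Fintype κ]
    [DecidableEq κ] (φ : Uq q →ₐ[ℂ] Matrix ι ι ℂ) (π : Uq q →ₐ[ℂ] Matrix κ κ ℂ) (x : Uq q)
    (i k : ι) (n m : κ) : π (actR φ x i k) n m = φ (actL π x n m) i k := by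
  suffices h : ∀ t : Uq q ⊗[ℂ] Uq q,
      π (Algebra.TensorProduct.lift ((legM q ι).comp φ) (leg q ι)
        (fun x y => (leg_comm y (φ x)).symm) t i k) n m =
      φ (Algebra.TensorProduct.lift (leg q κ) ((legM q κ).comp π)
        (fun x y => leg_comm x (π y)) t n m) i k from h _
  intro t
  induction t using TensorProduct.induction_on with
  | zero => simp
  | add t t' h h' =>
    rw [map_add, map_add, Matrix.add_apply, Matrix.add_apply, map_add, map_add, Matrix.add_apply,
      Matrix.add_apply, h, h']
  | tmul x y =>
    have e₁ : Algebra.TensorProduct.lift ((legM q ι).comp φ) (leg q ι)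
        (fun x y => (leg_comm y (φ x)).symm) (x ⊗ₜ[ℂ] y) i k = φ x i k • y := by
      have h : Algebra.TensorProduct.lift ((legM q ι).comp φ) (leg q ι)
        (fun x y => (leg_comm y (φ x)).symm) (x ⊗ₜ[ℂ] y) = legM q ι (φ x) * leg q ι y :=
        Algebra.TensorProduct.lift_tmul _ _ _ _ _
      rw [h]
      simp [leg, legM, Matrix.scalar, Algebra.ofId_apply, Algebra.smul_def]
    have e₂ : Algebra.TensorProduct.lift (leg q κ) ((legM q κ).comp π)
        (fun x y => leg_comm x (π y)) (x ⊗ₜ[ℂ] y) n m = π y n m • x := by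
      have h : Algebra.TensorProduct.lift (leg q κ) ((legM q κ).comp π)
        (fun x y => leg_comm x (π y)) (x ⊗ₜ[ℂ] y) = leg q κ x * legM q κ (π y) :=
        Algebra.TensorProduct.lift_tmul _ _ _ _ _
      rw [h, (leg_comm _ _).eq]
      simp [leg, legM, Matrix.scalar, Algebra.ofId_apply, Algebra.smul_def]
    rw [e₁, e₂, map_smul, map_smul, Matrix.smul_apply, Matrix.smul_apply, smul_eq_mul,
      smul_eq_mul, mul_comm]

theorem finRep_cross (B : ℕ) (n j : Fin (B + 1)) (x : Uq q) :
    ∑ i, spinTensor q M N (actL (spinRep q B) x n i) * finO q M N (g q B i j) =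
      ∑ i, finO q M N (g q B n i) * spinTensor q M N (actR (spinRep q B) x i j) := by
  have h := Xmat_exchange q M N x
  ext p r
  have h' := congrFun (congrFun (congrArg (spinRep q B) (congrFun (congrFun h p) r)) n) j
  rw [Matrix.mul_apply, Matrix.mul_apply, map_sum, map_sum, Matrix.sum_apply,
    Matrix.sum_apply] at h'
  simp only [map_mul, Matrix.mul_apply, swap_aux] at h'
  simp only [Matrix.sum_apply, Matrix.mul_apply, finO_apply, evalO_g]
  rw [Finset.sum_comm]
  refine Eq.trans ?_ (h'.symm.trans ?_)
  · exact Finset.sum_congr rfl fun k _ => Finset.sum_congr rfl fun i _ => by rw [← swap_aux]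
  · rw [Finset.sum_comm]
    exact Finset.sum_congr rfl fun k _ => Finset.sum_congr rfl fun i _ => by rw [← swap_aux]

/-- The finite-dimensional representation `Π_I`, `I = (M / 2, N / 2)`, of the quantum Lorentz
algebra on `V_{M/2} ⊗ V_{N/2}`: `U_q(su(2))` acts by the tensor product of the two spin
representations, and `g^B` acts by `R^{(-)}` on the second factor and by `R^{(+)}` on the first
factor. -/
def finRep : Dq q →ₐ[ℂ] Matrix (FinIdx M N) (FinIdx M N) ℂ :=
  Dq.lift (spinTensor q M N) (finO q M N) (finRep_cross q M N)

end finrep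

section central

variable (q : DefParam) (M N : ℕ)

/-- The matrix `T_{(a,a'),(b,b')} = g^{M/2}_{ab} g^{N/2}_{a'b'}` over the restricted dual. -/
def Tmat : Matrix (FinIdx M N) (FinIdx M N) (Oq q) :=
  Matrix.of fun p r => g q M p.1 r.1 * g q N p.2 r.2

/-- The matrix elements of `Π_I` on `U_q(su(2))` are the entries of `Tmat`. -/
theorem evalO_Tmat (p r : FinIdx M N) (x : Uq q) :
    evalO (Tmat q M N p r) x = finRep q M N (Dq.ofU q x) p r := by
  rw [finRep, Dq.lift_ofU, Tmat, Matrix.of_apply, evalO_mul]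
  suffices h : ∀ t : Uq q ⊗[ℂ] Uq q,
      LinearMap.mul' ℂ ℂ (TensorProduct.map (evalO (g q M p.1 r.1)) (evalO (g q N p.2 r.2)) t) =
      Algebra.TensorProduct.lift ((kron₁ (Fin (M + 1)) (Fin (N + 1)) ℂ).comp (spinRep q M))
        ((kron₂ (Fin (M + 1)) (Fin (N + 1)) ℂ).comp (spinRep q N))
        (fun _ _ => kron_comm fun _ _ _ _ => Commute.all _ _) t p r from h _
  intro t
  induction t using TensorProduct.induction_on with
  | zero => simp
  | add t t' h h' => rw [map_add, map_add, map_add, h, h', Matrix.add_apply]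
  | tmul x y =>
    have h : Algebra.TensorProduct.lift
        ((kron₁ (Fin (M + 1)) (Fin (N + 1)) ℂ).comp (spinRep q M))
        ((kron₂ (Fin (M + 1)) (Fin (N + 1)) ℂ).comp (spinRep q N))
        (fun _ _ => kron_comm fun _ _ _ _ => Commute.all _ _) (x ⊗ₜ[ℂ] y) =
        kron₁ _ _ ℂ (spinRep q M x) * kron₂ _ _ ℂ (spinRep q N y) :=
      Algebra.TensorProduct.lift_tmul _ _ _ _ _
    rw [h, TensorProduct.map_tmul, LinearMap.mul'_apply, evalO_g, evalO_g]
    simp [kron₁, kron₂, Matrix.mul_apply, Fintype.sum_prod_type]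

/-- The matrix elements of `Π_I` on the restricted dual are the evaluations at the entries of
`Xmat`. -/
theorem evalO_Xmat (p r : FinIdx M N) (f : Oq q) :
    evalO f (Xmat q M N p r) = finRep q M N (Dq.ofO q f) p r := by
  rw [finRep, Dq.lift_ofO, finO_apply]

end central

/-! ## The principal series -/

section principal

variable (q : DefParam)

/-- The action of the quantum double on its linear dual by right translation:
`(d · φ)(y) = φ(y d)`. -/
def dualAct : Dq q →ₐ[ℂ] Module.End ℂ (Dq q →ₗ[ℂ] ℂ) where
  toFun d :=
    { toFun := fun φ => φ ∘ₗ LinearMap.mulRight ℂ d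
      map_add' := fun _ _ => rfl
      map_smul' := fun _ _ => rfl }
  map_one' := by ext φ y; simp
  map_mul' d d' := by ext φ y; simp [mul_assoc]
  map_zero' := by ext φ y; simp
  map_add' d d' := by ext φ y; simp [mul_add]
  commutes' c := by ext φ y; simp [Algebra.algebraMap_eq_smul_one]

theorem dualAct_apply (d : Dq q) (φ : Dq q →ₗ[ℂ] ℂ) (y : Dq q) :
    dualAct q d φ y = φ (y * d) := rfl

/-- The `U_q(su(2))`-finite functionals: those lying in a finite-dimensional
`U_q(su(2))`-submodule of the dual of the quantum double. -/
def finiteVectors : Submodule ℂ (Dq q →ₗ[ℂ] ℂ) where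
  carrier := {φ | ∃ W : Submodule ℂ (Dq q →ₗ[ℂ] ℂ), FiniteDimensional ℂ W ∧ φ ∈ W ∧
    ∀ x : Uq q, ∀ w ∈ W, dualAct q (Dq.ofU q x) w ∈ W}
  zero_mem' := ⟨⊥, inferInstance, Submodule.zero_mem _, fun x w hw => by
    rw [Submodule.mem_bot] at hw; rw [hw, map_zero]; exact Submodule.zero_mem _⟩
  add_mem' := by
    rintro φ φ' ⟨W, hW, hφ, hs⟩ ⟨W', hW', hφ', hs'⟩
    refine ⟨W ⊔ W', inferInstance, Submodule.add_mem_sup hφ hφ', fun x w hw => ?_⟩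
    obtain ⟨a, ha, b, hb, rfl⟩ := Submodule.mem_sup.1 hw
    rw [map_add]
    exact Submodule.add_mem_sup (hs x a ha) (hs' x b hb)
  smul_mem' := by
    rintro c φ ⟨W, hW, hφ, hs⟩
    exact ⟨W, hW, W.smul_mem c hφ, hs⟩

/-- The span of the elements `g^{N/2}_{ab} x` with `x` in `U_q(su(2))`. -/
def gSpan (N : ℕ) : Submodule ℂ (Dq q) :=
  Submodule.span ℂ {d | ∃ (a b : Fin (N + 1)) (y : Uq q),
    d = Dq.ofO q (g q N a b) * Dq.ofU q y}

theorem gSpan_mul (N : ℕ) {d : Dq q} (hd : d ∈ gSpan q N) (x : Uq q) :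
    d * Dq.ofU q x ∈ gSpan q N := by
  induction hd using Submodule.span_induction with
  | mem d hd =>
    obtain ⟨a, b, y, rfl⟩ := hd
    rw [mul_assoc, ← map_mul]
    exact Submodule.subset_span ⟨a, b, _, rfl⟩
  | zero => rw [zero_mul]; exact Submodule.zero_mem _
  | add d d' _ _ h h' => rw [add_mul]; exact Submodule.add_mem _ h h'
  | smul c d _ h => rw [smul_mul_assoc]; exact Submodule.smul_mem _ c h

theorem gSpan_cross (N : ℕ) (n j : Fin (N + 1)) (x : Uq q) :
    ∑ i, Dq.ofU q (actL (spinRep q N) x n i) * Dq.ofO q (g q N i j) ∈ gSpan q N := by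
  rw [Dq.cross]
  exact Submodule.sum_mem _ fun i _ => Submodule.subset_span ⟨n, i, _, rfl⟩

theorem leg_mul_legM_apply {N : ℕ} (x : Uq q) (F : Matrix (Fin (N + 1)) (Fin (N + 1)) ℂ)
    (n i : Fin (N + 1)) : (leg q (Fin (N + 1)) x * legM q (Fin (N + 1)) F) n i = F n i • x := by
  rw [leg_comm]
  simp [leg, legM, Matrix.scalar, Algebra.ofId_apply, Algebra.smul_def]

theorem gSpan_diag (N : ℕ) {x : Uq q} {c : ℂ}
    (h : actL (spinRep q N) x = leg q _ x * legM q _ (spinK q c N)) (n j : Fin (N + 1)) :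
    Dq.ofU q x * Dq.ofO q (g q N n j) ∈ gSpan q N := by
  have h1 := gSpan_cross q N n j x
  rw [h, Finset.sum_eq_single n] at h1
  · rw [leg_mul_legM_apply, map_smul, smul_mul_assoc, spinK, Matrix.diagonal_apply_eq] at h1
    exact (Submodule.smul_mem_iff _ (qpow_ne_zero q _)).1 h1
  · intro i _ hi
    rw [leg_mul_legM_apply, spinK, Matrix.diagonal_apply_ne _ hi.symm, zero_smul, map_zero,
      zero_mul]
  · simp

theorem gSpan_J (N : ℕ) {J : Uq q}
    (h : Coalgebra.comul (R := ℂ) J = Uq.Kinv q ⊗ₜ[ℂ] J + J ⊗ₜ[ℂ] Uq.K q) (n j : Fin (N + 1)) :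
    Dq.ofU q J * Dq.ofO q (g q N n j) ∈ gSpan q N := by
  have h0 := fun n => gSpan_diag q N (x := Uq.Kinv q) (c := -1)
    (by rw [actL_one _ (Uq.comul_Kinv q), spinRep_Kinv]) n j
  have h1 := gSpan_cross q N n j J
  have e : ∑ i, Dq.ofU q (actL (spinRep q N) J n i) * Dq.ofO q (g q N i j) =
      (∑ i, spinRep q N J n i • (Dq.ofU q (Uq.Kinv q) * Dq.ofO q (g q N i j))) +
      qpow q (1 * wt N n) • (Dq.ofU q J * Dq.ofO q (g q N n j)) := by
    rw [actL_two _ h, spinRep_K]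
    simp only [Matrix.add_apply, leg_mul_legM_apply, map_add, map_smul, add_mul, smul_mul_assoc,
      Finset.sum_add_distrib]
    congr 1
    rw [Finset.sum_eq_single n]
    · rw [spinK, Matrix.diagonal_apply_eq]
    · intro i _ hi
      rw [spinK, Matrix.diagonal_apply_ne _ hi.symm, zero_smul]
    · simp
  rw [e] at h1
  have h2 := (Submodule.add_mem_iff_right _
    (Submodule.sum_mem _ fun i _ => Submodule.smul_mem _ _ (h0 i))).1 h1
  exact (Submodule.smul_mem_iff _ (qpow_ne_zero q _)).1 h2

theorem mul_gSpan (N : ℕ) (x : Uq q) {d : Dq q} (hd : d ∈ gSpan q N) :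
    Dq.ofU q x * d ∈ gSpan q N := by
  have key : ∀ x : Uq q,
      (∀ n j : Fin (N + 1), Dq.ofU q x * Dq.ofO q (g q N n j) ∈ gSpan q N) →
      ∀ d ∈ gSpan q N, Dq.ofU q x * d ∈ gSpan q N := by
    intro x hx d hd
    induction hd using Submodule.span_induction with
    | mem d hd =>
      obtain ⟨a, b, y, rfl⟩ := hd
      rw [← mul_assoc]
      exact gSpan_mul q N (hx a b) y
    | zero => rw [mul_zero]; exact Submodule.zero_mem _
    | add d d' _ _ h h' => rw [mul_add]; exact Submodule.add_mem _ h h'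
    | smul c d _ h => rw [mul_smul_comm]; exact Submodule.smul_mem _ c h
  induction x using Uq.induction generalizing d with
  | hc c =>
    rw [AlgHom.commutes, ← Algebra.smul_def]
    exact Submodule.smul_mem _ c hd
  | hK => exact key _ (gSpan_diag q N (c := 1) (by rw [actL_K, spinRep_K])) d hd
  | hKinv => exact key _ (gSpan_diag q N (c := -1)
      (by rw [actL_one _ (Uq.comul_Kinv q), spinRep_Kinv])) d hd
  | hJp => exact key _ (gSpan_J q N (Uq.comul_Jp q)) d hd
  | hJm => exact key _ (gSpan_J q N (Uq.comul_Jm q)) d hd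
  | hadd x y hx hy => rw [map_add, add_mul]; exact Submodule.add_mem _ (hx hd) (hy hd)
  | hmul x y hx hy => rw [map_mul, mul_assoc]; exact hx (hy hd)

theorem finiteVectors_g (N : ℕ) (n j : Fin (N + 1)) {φ : Dq q →ₗ[ℂ] ℂ}
    (hφ : φ ∈ finiteVectors q) : dualAct q (Dq.ofO q (g q N n j)) φ ∈ finiteVectors q := by
  obtain ⟨W, hW, hφW, hs⟩ := hφ
  let W' : Submodule ℂ (Dq q →ₗ[ℂ] ℂ) :=
    ⨆ p : Fin (N + 1) × Fin (N + 1), W.map (dualAct q (Dq.ofO q (g q N p.1 p.2)))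
  have hg : ∀ d ∈ gSpan q N, ∀ w ∈ W, dualAct q d w ∈ W' := by
    intro d hd w hw
    induction hd using Submodule.span_induction with
    | mem d hd =>
      obtain ⟨a, b, y, rfl⟩ := hd
      rw [map_mul, Module.End.mul_apply]
      exact Submodule.mem_iSup_of_mem (a, b) (Submodule.mem_map_of_mem (hs y w hw))
    | zero => rw [map_zero]; exact Submodule.zero_mem _
    | add d d' _ _ h h' => rw [map_add]; exact Submodule.add_mem _ h h'
    | smul c d _ h => rw [map_smul]; exact Submodule.smul_mem _ c h
  have hg0 : ∀ a b, Dq.ofO q (g q N a b) ∈ gSpan q N := fun a b =>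
    Submodule.subset_span ⟨a, b, 1, by rw [map_one, mul_one]⟩
  refine ⟨W', Submodule.finiteDimensional_iSup _, hg _ (hg0 n j) φ hφW, fun x w hw => ?_⟩
  have hle : W' ≤ W'.comap (dualAct q (Dq.ofU q x)) := by
    refine iSup_le fun p => ?_
    rintro _ ⟨w, hw, rfl⟩
    rw [Submodule.mem_comap, ← Module.End.mul_apply, ← map_mul]
    exact hg _ (mul_gSpan q N x (hg0 _ _)) w hw
  exact hle hw

theorem finiteVectors_stable (d : Dq q) {φ : Dq q →ₗ[ℂ] ℂ} (hφ : φ ∈ finiteVectors q) :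
    dualAct q d φ ∈ finiteVectors q := by
  induction d using Dq.induction generalizing φ with
  | hc c =>
    rw [AlgHom.commutes]
    exact Submodule.smul_mem _ c hφ
  | hU x =>
    obtain ⟨W, hW, hφW, hs⟩ := hφ
    exact ⟨W, hW, hs x φ hφW, hs⟩
  | hO f =>
    obtain ⟨f, hf⟩ := f
    induction hf using Algebra.adjoin_induction generalizing φ with
    | mem f hf =>
      obtain ⟨N, i, j, rfl⟩ := hf
      exact finiteVectors_g q N i j hφ
    | algebraMap c =>
      have : (⟨algebraMap ℂ _ c, Subalgebra.algebraMap_mem _ c⟩ : Oq q) = algebraMap ℂ _ c := rfl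
      rw [this, AlgHom.commutes, AlgHom.commutes]
      exact Submodule.smul_mem _ c hφ
    | add f f' hf hf' h h' =>
      have : (⟨f + f', add_mem hf hf'⟩ : Oq q) = ⟨f, hf⟩ + ⟨f', hf'⟩ := rfl
      rw [this, map_add, map_add]
      exact Submodule.add_mem _ (h hφ) (h' hφ)
    | mul f f' hf hf' h h' =>
      have : (⟨f * f', mul_mem hf hf'⟩ : Oq q) = ⟨f, hf⟩ * ⟨f', hf'⟩ := rfl
      rw [this, map_mul, map_mul]
      exact h (h' hφ)
  | hadd x y hx hy => rw [map_add]; exact Submodule.add_mem _ (hx hφ) (hy hφ)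
  | hmul x y hx hy => rw [map_mul]; exact hx (hy hφ)

/-- The functionals `φ` with `φ(g^B_{ij} d) = δ_{ij} q^{2 (a + b) m_i} φ(d)` and
`φ(q^{J_z} d) = q^{a - b} φ(d)`, where `m_i = B, B - 1, …, -B`. -/
def covariantVectors (a b : ℂ) : Submodule ℂ (Dq q →ₗ[ℂ] ℂ) where
  carrier := {φ | (∀ (N : ℕ) (i j : Fin (N + 1)) (d : Dq q), φ (Dq.ofO q (g q N i j) * d) =
      if i = j then qpow q (2 * (a + b) * wt N i) * φ d else 0) ∧
    ∀ d : Dq q, φ (Dq.ofU q (Uq.K q) * d) = qpow q (a - b) * φ d}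
  zero_mem' := by simp
  add_mem' := by
    rintro φ φ' ⟨h1, h2⟩ ⟨h1', h2'⟩
    refine ⟨fun N i j d => ?_, fun d => ?_⟩
    · rw [LinearMap.add_apply, h1, h1', LinearMap.add_apply]
      split_ifs <;> ring
    · rw [LinearMap.add_apply, h2, h2', LinearMap.add_apply]
      ring
  smul_mem' := by
    rintro c φ ⟨h1, h2⟩
    refine ⟨fun N i j d => ?_, fun d => ?_⟩
    · rw [LinearMap.smul_apply, h1, LinearMap.smul_apply, smul_eq_mul, smul_eq_mul]
      split_ifs <;> ring
    · rw [LinearMap.smul_apply, h2, LinearMap.smul_apply, smul_eq_mul, smul_eq_mul]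
      ring

theorem covariantVectors_stable (a b : ℂ) (d : Dq q) {φ : Dq q →ₗ[ℂ] ℂ}
    (hφ : φ ∈ covariantVectors q a b) : dualAct q d φ ∈ covariantVectors q a b := by
  refine ⟨fun N i j y => ?_, fun y => ?_⟩
  · rw [dualAct_apply, mul_assoc, hφ.1, dualAct_apply]
  · rw [dualAct_apply, mul_assoc, hφ.2, dualAct_apply]

/-- The space of the representation `Π_α`, `α = (a, b)`: the `U_q(su(2))`-finite part of the module
coinduced from the character `g^B_{ij} ↦ δ_{ij} q^{2 (a + b) m_i}`, `q^{J_z} ↦ q^{a - b}` of the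
Borel subalgebra, which is generated by the restricted dual and `q^{± J_z}`.  As a
`U_q(su(2))`-module it is the sum of the `V_C` with `C - |a - b| ∈ ℕ`, each with multiplicity
one. -/
def principalSpace (a b : ℂ) : Submodule ℂ (Dq q →ₗ[ℂ] ℂ) :=
  covariantVectors q a b ⊓ finiteVectors q

/-- The representation `Π_α`, `α = (a, b)`, of the quantum Lorentz algebra. -/
def principalRep (a b : ℂ) : Dq q →ₐ[ℂ] Module.End ℂ (principalSpace q a b) where
  toFun d := (dualAct q d).restrict fun _ hφ =>
    ⟨covariantVectors_stable q a b d hφ.1, finiteVectors_stable q d hφ.2⟩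
  map_one' := by ext φ; simp
  map_mul' d d' := LinearMap.ext fun φ => Subtype.ext (by
    change dualAct q (d * d') φ.1 = dualAct q d (dualAct q d' φ.1)
    rw [map_mul]; rfl)
  map_zero' := by ext φ; simp
  map_add' d d' := LinearMap.ext fun φ => Subtype.ext (by
    change dualAct q (d + d') φ.1 = dualAct q d φ.1 + dualAct q d' φ.1
    rw [map_add]; rfl)
  commutes' c := by ext φ; simp

end principal

/-! ## Labels and the central elements -/

/-- The labels `I = (I^l, I^r)` of the finite-dimensional irreducible representations, with
`I^l = twoL / 2` and `I^r = twoR / 2`. -/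
structure FinLabel where
  twoL : ℕ
  twoR : ℕ

/-- `I^l`. -/
def FinLabel.l (I : FinLabel) : ℂ := (I.twoL : ℂ) / 2

/-- `I^r`. -/
def FinLabel.r (I : FinLabel) : ℂ := (I.twoR : ℂ) / 2

/-- The labels `α = (α^l, α^r)` of the principal series: `α^l - α^r` is half an integer and
`α^l + α^r + 1 = i ρ` with `ρ` real. -/
structure PrincipalLabel where
  l : ℂ
  r : ℂ
  half_integer : ∃ k : ℤ, l - r = (k : ℂ) / 2
  imaginary : ∃ ρ : ℝ, l + r + 1 = Complex.I * ρ

/-- The matrix `(Π_I ⊗ id)(R)` over the quantum double, where `R = ∑ e_i ⊗ e^i` with dual bases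
`e_i` of `U_q(su(2))` and `e^i` of its dual; its entries lie in the restricted dual. -/
def RI (q : DefParam) (I : FinLabel) :
    Matrix (FinIdx I.twoL I.twoR) (FinIdx I.twoL I.twoR) (Dq q) :=
  (Tmat q I.twoL I.twoR).map (Dq.ofO q)

/-- The matrix `(Π_I ⊗ id)(R')` over the quantum double, where `R' = R₂₁ = ∑ e^i ⊗ e_i`; its
entries lie in `U_q(su(2))`. -/
def RI' (q : DefParam) (I : FinLabel) :
    Matrix (FinIdx I.twoL I.twoR) (FinIdx I.twoL I.twoR) (Dq q) :=
  (Xmat q I.twoL I.twoR).map (Dq.ofU q)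

/-- The matrix `Π_I(μ)` of the element `μ = q^{2 J_z}`, with scalars embedded in the quantum
double. -/
def muI (q : DefParam) (I : FinLabel) :
    Matrix (FinIdx I.twoL I.twoR) (FinIdx I.twoL I.twoR) (Dq q) :=
  (finRep q I.twoL I.twoR (Dq.ofU q (Uq.K q * Uq.K q))).map (algebraMap ℂ (Dq q))

/-- The element `c_I = tr_q((Π_I ⊗ id)(R R'))` of the quantum Lorentz algebra. -/
def cI (q : DefParam) (I : FinLabel) : Dq q := (muI q I * (RI q I * RI' q I)).trace

end QuantumLorentz

end

noncomputable section

namespace QuantumLorentz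

/-! ## The antipode -/

/-! Write `T` for the matrix (Π_I ⊗ id)(R), with entries in the restricted dual, `X` for (Π_I ⊗
id)(R'), with entries in U_q(su(2)), and `Y = T X`. Since Π_I(q^{J_z}) is diagonal with entries k_p
= `kEig`, the element c_I is the weighted trace ∑ k_p² Y_pp (`cI_eq`).

Centrality is checked on the two generating subalgebras. For x in U_q(su(2)), let L(x) and L'(x) be
the matrices over U_q(su(2)) obtained by applying Π_I to the second, respectively the first, leg of
Δ(x). Then X L(x) = L'(x) X, and on generators the cross relation gives L(x) T = T L'(x), so Y
commutes with L(x) (`Ymat_commute_of_cross`). With the weights k_p² this passes to the trace, the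
off-diagonal contributions cancelling in pairs (`qtrace_commute_skewPrimitive`). For the restricted
dual, let G = (g^B_{ij}) and P = π^B(X), a matrix of scalars on V_I ⊗ V_B. Pairing X L(x) = L'(x) X
with spin B gives T₁ G₂ P₁₂ = P₁₂ G₂ T₁, and the cross relation at the entries of X gives X₁ P₁₂ G₂
= G₂ P₁₂ X₁. Together they yield Y₁ P₁₂ G₂ = P₁₂ G₂ Y₁ (`Ymat_exchange_matrix`). Cancelling P from
under the weighted trace requires its inverse π^B(S(X)) and also an inverse for the transpose in the
first leg. The latter exists after twisting by k_p², because S² is conjugation by q^{2J_z}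
(`antipode_Xmat_twisted`, `commute_twistedTrace`).

For the scalar, the principal series acts by right translation on functionals that transform on the
left by a character of the subalgebra generated by the restricted dual and q^{±J_z}. A central
element may be moved to the left, so only the character matters. It kills the off-diagonal entries
of `T`, and triangularity of R^{(±)} makes X_pp a power of q^{J_z}. What remains is a sum of powers
of q over pairs of weights, which factors as the product of two spin characters, at 2α^l + 1 and
2α^r + 1 (`covariantVectors_cI`). A telescoping sum identifies each character with a quotient of
quantum numbers where the denominator is nonzero (`spinChar_mul_qnum`). The characters are
continuous and the zeros of the denominators are isolated, which gives the limit in all cases. -/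

/-- The antipode reverses products, so it is built through the universal property with values in the
opposite algebra. The factor -q^{±1} on J_± is forced by S(q^{-J_z}) J_± + S(J_±) q^{J_z} = 0. -/
theorem antipode_tuple (q : DefParam) : UqTuple (qc q) (MulOpposite.op (Uq.Kinv q))
    (MulOpposite.op (Uq.K q)) (MulOpposite.op (-(qc q • Uq.Jp q)))
    (MulOpposite.op (-((qc q)⁻¹ • Uq.Jm q))) := by
  have h := Uq.tuple q
  have hq := qc_ne_zero q
  constructor
  · rw [← MulOpposite.op_mul, Uq.K_Kinv, MulOpposite.op_one]
  · rw [← MulOpposite.op_mul, Uq.Kinv_K, MulOpposite.op_one]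
  · rw [← MulOpposite.op_mul, ← MulOpposite.op_mul, ← MulOpposite.op_smul, mul_neg, neg_mul,
      mul_smul_comm, smul_mul_assoc, h.k'p hq, smul_neg, smul_smul, smul_smul,
      mul_assoc, mul_inv_cancel₀ hq, mul_one]
  · rw [← MulOpposite.op_mul, ← MulOpposite.op_mul, ← MulOpposite.op_smul, mul_neg, neg_mul,
      mul_smul_comm, smul_mul_assoc, h.k'm hq, smul_neg, smul_smul, smul_smul,
      mul_assoc, inv_mul_cancel₀ hq, mul_one]
  · simp only [← MulOpposite.op_mul, ← MulOpposite.op_sub, ← MulOpposite.op_smul]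
    congr 1
    rw [neg_mul_neg, neg_mul_neg, smul_mul_smul_comm, smul_mul_smul_comm, inv_mul_cancel₀ hq,
      mul_inv_cancel₀ hq, one_smul, one_smul, ← neg_sub, h.pm, ← smul_neg, neg_sub]

/-- The antipode of `U_q(su(2))`, as a homomorphism to the opposite algebra. -/
def antipodeHom (q : DefParam) : Uq q →ₐ[ℂ] (Uq q)ᵐᵒᵖ := Uq.lift (antipode_tuple q)

/-- The antipode of `U_q(su(2))`. -/
def antipode (q : DefParam) : Uq q →ₗ[ℂ] Uq q :=
  (MulOpposite.opLinearEquiv ℂ).symm.toLinearMap ∘ₗ (antipodeHom q).toLinearMap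

section antipode

variable (q : DefParam)

theorem antipode_apply (x : Uq q) : antipode q x = (antipodeHom q x).unop := rfl

theorem antipode_mul (x y : Uq q) : antipode q (x * y) = antipode q y * antipode q x := by
  simp [antipode_apply]

theorem antipode_K : antipode q (Uq.K q) = Uq.Kinv q := by simp [antipode_apply, antipodeHom]
theorem antipode_Kinv : antipode q (Uq.Kinv q) = Uq.K q := by simp [antipode_apply, antipodeHom]
theorem antipode_Jp : antipode q (Uq.Jp q) = -(qc q • Uq.Jp q) := by
  simp [antipode_apply, antipodeHom]
theorem antipode_Jm : antipode q (Uq.Jm q) = -((qc q)⁻¹ • Uq.Jm q) := by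
  simp [antipode_apply, antipodeHom]
theorem antipode_algebraMap (c : ℂ) : antipode q (algebraMap ℂ _ c) = algebraMap ℂ _ c := by
  rw [antipode_apply, AlgHom.commutes]; rfl

/-- `x ⊗ y ↦ S(x) y`. -/
def antipodeMul : Uq q ⊗[ℂ] Uq q →ₗ[ℂ] Uq q :=
  LinearMap.mul' ℂ (Uq q) ∘ₗ TensorProduct.map (antipode q) LinearMap.id

theorem antipodeMul_tmul (x y : Uq q) : antipodeMul q (x ⊗ₜ y) = antipode q x * y := by
  simp [antipodeMul]

/-- As S reverses products, multiplying by x ⊗ y on the right places the value at `s` between S(x)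
and y, and a scalar there can be pulled out. This is the multiplicative step in proving the antipode
axiom by induction on generators. -/
theorem antipodeMul_mul (s : Uq q ⊗[ℂ] Uq q) (c : ℂ)
    (hs : antipodeMul q s = algebraMap ℂ _ c) (t : Uq q ⊗[ℂ] Uq q) :
    antipodeMul q (s * t) = c • antipodeMul q t := by
  induction t using TensorProduct.induction_on with
  | zero => simp
  | add t t' h h' => rw [mul_add, map_add, h, h', map_add, smul_add]
  | tmul x y =>
    have h : antipodeMul q (s * x ⊗ₜ y) = antipode q x * antipodeMul q s * y := by
      clear hs
      induction s using TensorProduct.induction_on with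
      | zero => simp
      | add s s' h h' => rw [add_mul, map_add, h, h', map_add, mul_add, add_mul]
      | tmul u v =>
        simp only [Algebra.TensorProduct.tmul_mul_tmul, antipodeMul_tmul, antipode_mul, mul_assoc]
    rw [h, hs, ← Algebra.commutes, mul_assoc, ← Algebra.smul_def, antipodeMul_tmul]

/-- The axiom `∑ S(x₍₁₎) x₍₂₎ = ε(x)` of the antipode. -/
theorem antipodeMul_comul (x : Uq q) : antipodeMul q (Coalgebra.comul x) =
    algebraMap ℂ _ (Coalgebra.counit (R := ℂ) x) := by
  have h := Uq.tuple q
  have hq := qc_ne_zero q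
  induction x using Uq.induction with
  | hc c =>
    rw [Bialgebra.comul_algebraMap, Bialgebra.counit_algebraMap,
      Algebra.TensorProduct.algebraMap_apply, antipodeMul_tmul, antipode_algebraMap, mul_one]
  | hK => rw [Uq.comul_K, antipodeMul_tmul, antipode_K, Uq.Kinv_K, Uq.counit_K, map_one]
  | hKinv =>
    rw [Uq.comul_Kinv, antipodeMul_tmul, antipode_Kinv, Uq.K_Kinv, Uq.counit_Kinv, map_one]
  | hJp =>
    rw [Uq.comul_Jp, map_add, antipodeMul_tmul, antipodeMul_tmul, antipode_Kinv, antipode_Jp,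
      Uq.counit_Jp, map_zero, h.kp, neg_mul, smul_mul_assoc, add_neg_cancel]
  | hJm =>
    rw [Uq.comul_Jm, map_add, antipodeMul_tmul, antipodeMul_tmul, antipode_Kinv, antipode_Jm,
      Uq.counit_Jm, map_zero, h.km, neg_mul, smul_mul_assoc, add_neg_cancel]
  | hadd x y hx hy => simp only [map_add, hx, hy]
  | hmul x y hx hy =>
    rw [Bialgebra.comul_mul, antipodeMul_mul q _ _ hx, hy, Bialgebra.counit_mul, map_mul,
      Algebra.smul_def]

/-- The square of the antipode is the conjugation by `q ^ (2 J_z)`. -/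
theorem antipode_antipode (x : Uq q) :
    antipode q (antipode q x) * (Uq.K q * Uq.K q) = Uq.K q * Uq.K q * x := by
  have h := Uq.tuple q
  have hq := qc_ne_zero q
  induction x using Uq.induction with
  | hc c => rw [antipode_algebraMap, antipode_algebraMap, Algebra.commutes]
  | hK => rw [antipode_K, antipode_Kinv, mul_assoc]
  | hKinv =>
    rw [antipode_Kinv, antipode_K, ← mul_assoc, Uq.Kinv_K, mul_assoc, Uq.K_Kinv, one_mul, mul_one]
  | hJp =>
    rw [antipode_Jp, map_neg, map_smul, antipode_Jp, mul_assoc (Uq.K q), h.kp, mul_smul_comm, ← mul_assoc (Uq.K q),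
      h.kp]
    simp [smul_smul, mul_assoc]
  | hJm =>
    rw [antipode_Jm, map_neg, map_smul, antipode_Jm, mul_assoc (Uq.K q), h.km, mul_smul_comm, ← mul_assoc (Uq.K q),
      h.km]
    simp [smul_smul, mul_assoc]
  | hadd x y hx hy => rw [map_add, map_add, add_mul, mul_add, hx, hy]
  | hmul x y hx hy => rw [antipode_mul, antipode_mul, mul_assoc, hy, ← mul_assoc, hx, mul_assoc]

/-- S² is conjugation by an invertible element, hence injective, and so is S. -/
theorem antipode_injective : Function.Injective (antipode q) := by
  intro x y hxy
  have h : Uq.K q * Uq.K q * x = Uq.K q * Uq.K q * y := by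
    rw [← antipode_antipode, ← antipode_antipode, hxy]
  have h' := congrArg (fun z => Uq.Kinv q * (Uq.Kinv q * z)) h
  have e : ∀ z, Uq.Kinv q * (Uq.Kinv q * (Uq.K q * Uq.K q * z)) = z := fun z => by
    rw [mul_assoc (Uq.K q), ← mul_assoc (Uq.Kinv q) (Uq.K q), Uq.Kinv_K, one_mul, ← mul_assoc,
      Uq.Kinv_K, one_mul]
  simpa only [e] using h'

end antipode

/-! ## The matrices over `U_q(su(2))` -/

section gens

variable {q : DefParam} {ι : Type} [Fintype ι] [DecidableEq ι] (π : Uq q →ₐ[ℂ] Matrix ι ι ℂ)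

theorem legM_mul_leg_apply (x : Uq q) (F : Matrix ι ι ℂ) (n i : ι) :
    (legM q ι F * leg q ι x) n i = F n i • x := by
  simp [leg, legM, Matrix.scalar, Algebra.ofId_apply, Algebra.smul_def]

theorem actL_apply_one {x u v : Uq q} (h : Coalgebra.comul (R := ℂ) x = u ⊗ₜ[ℂ] v) (n i : ι) :
    actL π x n i = π v n i • u := by
  rw [actL_one π h, (leg_comm _ _).eq, legM_mul_leg_apply]

theorem actR_apply_one {x u v : Uq q} (h : Coalgebra.comul (R := ℂ) x = u ⊗ₜ[ℂ] v) (n i : ι) :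
    actR π x n i = π u n i • v := by
  rw [actR_one π h, legM_mul_leg_apply]

theorem actL_apply_two {x u v u' v' : Uq q}
    (h : Coalgebra.comul (R := ℂ) x = u ⊗ₜ[ℂ] v + u' ⊗ₜ[ℂ] v') (n i : ι) :
    actL π x n i = π v n i • u + π v' n i • u' := by
  rw [actL_two π h, (leg_comm _ _).eq, (leg_comm _ _).eq, Matrix.add_apply, legM_mul_leg_apply,
    legM_mul_leg_apply]

theorem actR_apply_two {x u v u' v' : Uq q}
    (h : Coalgebra.comul (R := ℂ) x = u ⊗ₜ[ℂ] v + u' ⊗ₜ[ℂ] v') (n i : ι) :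
    actR π x n i = π u n i • v + π u' n i • v' := by
  rw [actR_two π h, Matrix.add_apply, legM_mul_leg_apply, legM_mul_leg_apply]

/-- The index type is arbitrary so that this applies to the entries of `Xmat`, whose coproduct is a
sum over the basis of V_I. -/
theorem actL_apply_sum {κ : Type} [Fintype κ] {x : Uq q} {u v : κ → Uq q}
    (h : Coalgebra.comul (R := ℂ) x = ∑ s, u s ⊗ₜ[ℂ] v s) (n i : ι) :
    actL π x n i = ∑ s, π (v s) n i • u s := by
  have h' : actL π x = ∑ s, leg q ι (u s) * legM q ι (π (v s)) := by
    refine (congrArg (Algebra.TensorProduct.lift (leg q ι) ((legM q ι).comp π)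
      fun x y => leg_comm x (π y)) h).trans ?_
    rw [map_sum]
    exact Finset.sum_congr rfl fun i _ => Algebra.TensorProduct.lift_tmul _ _ _ _ _
  rw [h', Matrix.sum_apply]
  exact Finset.sum_congr rfl fun s _ => by rw [(leg_comm _ _).eq, legM_mul_leg_apply]

theorem actR_apply_sum {κ : Type} [Fintype κ] {x : Uq q} {u v : κ → Uq q}
    (h : Coalgebra.comul (R := ℂ) x = ∑ s, u s ⊗ₜ[ℂ] v s) (n i : ι) :
    actR π x n i = ∑ s, π (u s) n i • v s := by
  have h' : actR π x = ∑ s, legM q ι (π (u s)) * leg q ι (v s) := by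
    refine (congrArg (Algebra.TensorProduct.lift ((legM q ι).comp π) (leg q ι)
      fun x y => (leg_comm y (π x)).symm) h).trans ?_
    rw [map_sum]
    exact Finset.sum_congr rfl fun i _ => Algebra.TensorProduct.lift_tmul _ _ _ _ _
  rw [h', Matrix.sum_apply]
  exact Finset.sum_congr rfl fun s _ => legM_mul_leg_apply _ _ _ _

end gens

/-! ### The matrix of R': weights, inverse, and twisted inverse of the transpose. -/

section Xmat

variable (q : DefParam) (M N : ℕ)

/-- The eigenvalue of `q ^ J_z` on a basis vector of `V_{M/2} ⊗ V_{N/2}`. -/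
def kEig (p : FinIdx M N) : ℂ := qpow q (wt M p.1 + wt N p.2)

theorem kEig_ne_zero (p : FinIdx M N) : kEig q M N p ≠ 0 := qpow_ne_zero q _

theorem spinTensor_apply_one {x u v : Uq q} (h : Coalgebra.comul (R := ℂ) x = u ⊗ₜ[ℂ] v)
    (p r : FinIdx M N) :
    spinTensor q M N x p r = spinRep q M u p.1 r.1 * spinRep q N v p.2 r.2 := by
  rw [spinTensor_one q M N h]
  simp [kron₁, kron₂, Matrix.mul_apply, Fintype.sum_prod_type]

theorem spinTensor_apply_two {x u v u' v' : Uq q}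
    (h : Coalgebra.comul (R := ℂ) x = u ⊗ₜ[ℂ] v + u' ⊗ₜ[ℂ] v') (p r : FinIdx M N) :
    spinTensor q M N x p r = spinRep q M u p.1 r.1 * spinRep q N v p.2 r.2 +
      spinRep q M u' p.1 r.1 * spinRep q N v' p.2 r.2 := by
  rw [spinTensor_two q M N h]
  simp [kron₁, kron₂, Matrix.mul_apply, Fintype.sum_prod_type]

theorem spinTensor_K :
    spinTensor q M N (Uq.K q) = Matrix.diagonal (kEig q M N) := by
  ext p r
  rw [spinTensor_apply_one q M N (Uq.comul_K q), spinRep_K, spinRep_K, spinK, spinK]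
  simp only [Matrix.diagonal_apply, Prod.ext_iff, kEig, qpow_add, one_mul]
  split_ifs <;> simp_all

theorem spinTensor_Kinv :
    spinTensor q M N (Uq.Kinv q) = Matrix.diagonal fun p => (kEig q M N p)⁻¹ := by
  ext p r
  rw [spinTensor_apply_one q M N (Uq.comul_Kinv q), spinRep_Kinv, spinRep_Kinv, spinK, spinK]
  simp only [Matrix.diagonal_apply, Prod.ext_iff, kEig, qpow_add, mul_inv, neg_one_mul, qpow_neg]
  split_ifs <;> simp_all

/-- The exchange relation at q^{J_z}, where the scalar matrices involved are diagonal: each entry of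
`Xmat` is a weight vector for conjugation by q^{J_z}. -/
theorem K_mul_Xmat (p r : FinIdx M N) : kEig q M N p • (Uq.K q * Xmat q M N p r) =
    kEig q M N r • (Xmat q M N p r * Uq.K q) := by
  have h := congrFun (congrFun (Xmat_exchange q M N (Uq.K q)) p) r
  simp only [Matrix.mul_apply, actL_apply_one _ (Uq.comul_K q), actR_apply_one _ (Uq.comul_K q),
    spinTensor_K, Matrix.diagonal_apply, ite_smul, mul_ite, ite_mul, zero_smul, mul_zero, zero_mul,
    Finset.sum_ite_eq, Finset.sum_ite_eq', Finset.mem_univ, if_true, mul_smul_comm,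
    smul_mul_assoc] at h
  exact h.symm

/-- The coproduct and counit of `Xmat` are those of a matrix of matrix elements, so the antipode
axiom says that S applied entrywise gives a left inverse. -/
theorem antipode_mul_Xmat (p r : FinIdx M N) :
    ∑ s, antipode q (Xmat q M N p s) * Xmat q M N s r = if p = r then 1 else 0 := by
  have h := antipodeMul_comul q (Xmat q M N p r)
  rw [comul_Xmat, map_sum, counit_Xmat] at h
  simp only [antipodeMul_tmul] at h
  rw [h]
  split_ifs <;> simp

/-- S² is conjugation by q^{2J_z}, and the entries are weight vectors for that conjugation. This is
where the weights of the quantum trace enter. -/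
theorem antipode_antipode_Xmat (p r : FinIdx M N) :
    kEig q M N p ^ 2 • antipode q (antipode q (Xmat q M N p r)) =
      kEig q M N r ^ 2 • Xmat q M N p r := by
  have h1 : kEig q M N p ^ 2 • (Uq.K q * Uq.K q * Xmat q M N p r) =
      kEig q M N r ^ 2 • (Xmat q M N p r * (Uq.K q * Uq.K q)) := by
    have h := K_mul_Xmat q M N p r
    rw [pow_two, mul_smul, mul_assoc, ← mul_smul_comm, h, mul_smul_comm, ← mul_assoc, smul_comm,
      ← smul_mul_assoc, h, smul_mul_assoc, smul_smul, ← pow_two, mul_assoc]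
  rw [← antipode_antipode, ← smul_mul_assoc, ← smul_mul_assoc] at h1
  have h2 := congrArg (fun z => z * Uq.Kinv q * Uq.Kinv q) h1
  have e : ∀ z, z * (Uq.K q * Uq.K q) * Uq.Kinv q * Uq.Kinv q = z := fun z => by
    rw [← mul_assoc z, mul_assoc (z * _), Uq.K_Kinv, mul_one, mul_assoc, Uq.K_Kinv, mul_one]
  simpa only [e] using h2

/-- The transposed inverse of `Xmat`, twisted by `q ^ (2 J_z)`. -/
theorem antipode_Xmat_twisted (s t : FinIdx M N) :
    ∑ p, kEig q M N p ^ 2 • (antipode q (Xmat q M N p s) * Xmat q M N t p) =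
      if s = t then algebraMap ℂ _ (kEig q M N s ^ 2) else 0 := by
  -- Applying S reverses the factors and turns the first one into S²(X_ps). The weight k_p² absorbs
  -- the S² at the price of k_s², and the sum becomes the plain left inverse relation with indices t
  -- and s.
  apply antipode_injective
  have h : ∀ p, antipode q (kEig q M N p ^ 2 •
      (antipode q (Xmat q M N p s) * Xmat q M N t p)) =
      kEig q M N s ^ 2 • (antipode q (Xmat q M N t p) * Xmat q M N p s) := fun p => by
    rw [map_smul, antipode_mul, ← mul_smul_comm, antipode_antipode_Xmat, mul_smul_comm]
  rw [map_sum, Finset.sum_congr rfl fun p _ => h p, ← Finset.smul_sum, antipode_mul_Xmat]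
  simp only [eq_comm (a := t)]
  split_ifs
  · rw [antipode_algebraMap, Algebra.algebraMap_eq_smul_one]
  · rw [smul_zero, map_zero]

end Xmat

/-! ### The matrix of R R' and the centrality of its quantum trace. -/

section central

variable (q : DefParam) (M N : ℕ)

/-- The matrix `(Π_I ⊗ id)(R R')` over the quantum double, `I = (M / 2, N / 2)`. -/
def Ymat : Matrix (FinIdx M N) (FinIdx M N) (Dq q) :=
  (Tmat q M N).map (Dq.ofO q) * (Xmat q M N).map (Dq.ofU q)

theorem cI_eq (I : FinLabel) :
    cI q I = ∑ p, kEig q I.twoL I.twoR p ^ 2 • Ymat q I.twoL I.twoR p p := by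
  have h : finRep q I.twoL I.twoR (Dq.ofU q (Uq.K q * Uq.K q)) =
      Matrix.diagonal fun p => kEig q I.twoL I.twoR p ^ 2 := by
    rw [finRep, Dq.lift_ofU, map_mul, spinTensor_K, Matrix.diagonal_mul_diagonal]
    simp only [pow_two]
  rw [cI, muI, h, Matrix.diagonal_map (map_zero _), Matrix.trace]
  refine Finset.sum_congr rfl fun p _ => ?_
  rw [Matrix.diag_apply, Matrix.diagonal_mul, ← Algebra.smul_def]
  rfl

/-! ### Commutation with `U_q(su(2))` -/

/-- The cross relation for the tensor product of two spin representations follows from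
coassociativity. -/
theorem cross_Tmat_of_coassoc {x : Uq q}
    (hL : ∀ p r, actL (spinTensor q M N) x p r =
      actL (spinRep q M) (actL (spinRep q N) x p.2 r.2) p.1 r.1)
    (hR : ∀ p r, actR (spinTensor q M N) x p r =
      actR (spinRep q N) (actR (spinRep q M) x p.1 r.1) p.2 r.2)
    (hLR : ∀ i j k l, actR (spinRep q M) (actL (spinRep q N) x k l) i j =
      actL (spinRep q N) (actR (spinRep q M) x i j) k l) :
    (actL (spinTensor q M N) x).map (Dq.ofU q) * (Tmat q M N).map (Dq.ofO q) =
      (Tmat q M N).map (Dq.ofO q) * (actR (spinTensor q M N) x).map (Dq.ofU q) := by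
  ext p r
  simp only [Matrix.mul_apply, Matrix.map_apply, Tmat, Matrix.of_apply, map_mul, hL, hR,
    Fintype.sum_prod_type]
  rw [Finset.sum_comm]
  -- The U_q(su(2)) factor is carried past g^{M/2} by one cross relation. `hLR` then reorders the
  -- two operations, which act on different legs of the iterated coproduct, and a second cross
  -- relation carries it past g^{N/2}.
  calc _ = ∑ k, ∑ i, Dq.ofO q (g q M p.1 i) * Dq.ofU q (actR (spinRep q M)
        (actL (spinRep q N) x p.2 k) i r.1) * Dq.ofO q (g q N k r.2) := by
        refine Finset.sum_congr rfl fun k _ => ?_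
        simp only [← mul_assoc]
        rw [← Finset.sum_mul, Dq.cross, Finset.sum_mul]
    _ = ∑ i, Dq.ofO q (g q M p.1 i) * ∑ k, Dq.ofU q (actL (spinRep q N)
        (actR (spinRep q M) x i r.1) p.2 k) * Dq.ofO q (g q N k r.2) := by
        rw [Finset.sum_comm]
        simp only [hLR, Finset.mul_sum, mul_assoc]
    _ = _ := by
        simp only [Dq.cross, Finset.mul_sum, mul_assoc]

/-- Coassociativity is needed only on generators, because commutation with an element extends to
products. Here all the matrices are scalar multiples of x, and the conditions reduce to
commutativity of scalars. -/
theorem cross_Tmat_of_groupLike {x : Uq q} (h : Coalgebra.comul (R := ℂ) x = x ⊗ₜ[ℂ] x) :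
    (actL (spinTensor q M N) x).map (Dq.ofU q) * (Tmat q M N).map (Dq.ofO q) =
      (Tmat q M N).map (Dq.ofO q) * (actR (spinTensor q M N) x).map (Dq.ofU q) := by
  refine cross_Tmat_of_coassoc q M N (fun p r => ?_) (fun p r => ?_) fun i j k l => ?_
  · rw [actL_apply_one _ h, actL_apply_one _ h, map_smul, Matrix.smul_apply, actL_apply_one _ h,
      spinTensor_apply_one q M N h, smul_smul, mul_comm]
  · rw [actR_apply_one _ h, actR_apply_one _ h, map_smul, Matrix.smul_apply, actR_apply_one _ h,
      spinTensor_apply_one q M N h, smul_smul]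
  · rw [actL_apply_one _ h, actR_apply_one _ h, map_smul, map_smul, Matrix.smul_apply,
      Matrix.smul_apply, actL_apply_one _ h, actR_apply_one _ h, smul_comm]

theorem cross_Tmat_of_skewPrimitive {J : Uq q}
    (h : Coalgebra.comul (R := ℂ) J = Uq.Kinv q ⊗ₜ[ℂ] J + J ⊗ₜ[ℂ] Uq.K q) :
    (actL (spinTensor q M N) J).map (Dq.ofU q) * (Tmat q M N).map (Dq.ofO q) =
      (Tmat q M N).map (Dq.ofO q) * (actR (spinTensor q M N) J).map (Dq.ofU q) := by
  have hK := Uq.comul_K q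
  have hK' := Uq.comul_Kinv q
  refine cross_Tmat_of_coassoc q M N (fun p r => ?_) (fun p r => ?_) fun i j k l => ?_
  · simp only [actL_apply_two _ h, map_add, map_smul, Matrix.add_apply, Matrix.smul_apply,
      actL_apply_one _ hK', spinTensor_apply_two q M N h, spinTensor_apply_one q M N hK]
    module
  · simp only [actR_apply_two _ h, map_add, map_smul, Matrix.add_apply, Matrix.smul_apply,
      actR_apply_one _ hK, spinTensor_apply_two q M N h, spinTensor_apply_one q M N hK']
    module
  · simp only [actL_apply_two _ h, actR_apply_two _ h, map_add, map_smul, Matrix.add_apply,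
      Matrix.smul_apply, actL_apply_one _ hK, actR_apply_one _ hK']
    module

/-- With L and L' the two matrices of x, T X L = T L' X = L T X: the factor `Xmat` turns one
coproduct into the opposite one, and `Tmat` turns it back. -/
theorem Ymat_commute_of_cross {x : Uq q}
    (h : (actL (spinTensor q M N) x).map (Dq.ofU q) * (Tmat q M N).map (Dq.ofO q) =
      (Tmat q M N).map (Dq.ofO q) * (actR (spinTensor q M N) x).map (Dq.ofU q)) :
    Ymat q M N * (actL (spinTensor q M N) x).map (Dq.ofU q) =
      (actL (spinTensor q M N) x).map (Dq.ofU q) * Ymat q M N := by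
  rw [Ymat, ← mul_assoc, h, mul_assoc, mul_assoc, ← Matrix.map_mul, ← Matrix.map_mul,
    Xmat_exchange]

/-- The quantum trace of `Ymat`. -/
def qtrace : Dq q := ∑ p, kEig q M N p ^ 2 • Ymat q M N p p

theorem K_mul_Ymat (p r : FinIdx M N) : kEig q M N p • (Dq.ofU q (Uq.K q) * Ymat q M N p r) =
    kEig q M N r • (Ymat q M N p r * Dq.ofU q (Uq.K q)) := by
  have h := congrFun (congrFun (Ymat_commute_of_cross q M N
    (cross_Tmat_of_groupLike q M N (Uq.comul_K q))) p) r
  simp only [Matrix.mul_apply, Matrix.map_apply, actL_apply_one _ (Uq.comul_K q),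
    spinTensor_K, Matrix.diagonal_apply, ite_smul, mul_ite, ite_mul, zero_smul, mul_zero, zero_mul,
    Finset.sum_ite_eq, Finset.sum_ite_eq', Finset.mem_univ, if_true, mul_smul_comm,
    smul_mul_assoc, map_smul, apply_ite (Dq.ofU q), map_zero] at h
  exact h.symm

theorem Kinv_mul_Ymat (p r : FinIdx M N) :
    (kEig q M N p)⁻¹ • (Dq.ofU q (Uq.Kinv q) * Ymat q M N p r) =
    (kEig q M N r)⁻¹ • (Ymat q M N p r * Dq.ofU q (Uq.Kinv q)) := by
  have h := congrFun (congrFun (Ymat_commute_of_cross q M N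
    (cross_Tmat_of_groupLike q M N (Uq.comul_Kinv q))) p) r
  simp only [Matrix.mul_apply, Matrix.map_apply, actL_apply_one _ (Uq.comul_Kinv q),
    spinTensor_Kinv, Matrix.diagonal_apply, ite_smul, mul_ite, ite_mul, zero_smul, mul_zero,
    zero_mul, Finset.sum_ite_eq, Finset.sum_ite_eq', Finset.mem_univ, if_true, mul_smul_comm,
    smul_mul_assoc, map_smul, apply_ite (Dq.ofU q), map_zero] at h
  exact h.symm

/-- Conjugation by q^{J_z} scales Y_pr by k_r / k_p, so the diagonal entries are fixed. -/
theorem qtrace_commute_K : Commute (qtrace q M N) (Dq.ofU q (Uq.K q)) := by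
  rw [Commute, SemiconjBy, qtrace, Finset.sum_mul, Finset.mul_sum]
  refine Finset.sum_congr rfl fun p _ => ?_
  rw [smul_mul_assoc, mul_smul_comm, pow_two, mul_smul, mul_smul, K_mul_Ymat]

theorem qtrace_commute_Kinv : Commute (qtrace q M N) (Dq.ofU q (Uq.Kinv q)) := by
  have h1 : Dq.ofU q (Uq.K q) * Dq.ofU q (Uq.Kinv q) = 1 := by rw [← map_mul, Uq.K_Kinv, map_one]
  have h2 : Dq.ofU q (Uq.Kinv q) * Dq.ofU q (Uq.K q) = 1 := by rw [← map_mul, Uq.Kinv_K, map_one]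
  exact Commute.units_inv_right (u := ⟨_, _, h1, h2⟩) (qtrace_commute_K q M N)

/-- Take the (p, p) entry of the commutation of Y with the matrix of J. It expresses k_p (Y_pp J - J
Y_pp) through terms containing q^{-J_z} and the entries of Π_I(J). Once q^{-J_z} is moved to the
right, the weights make these terms antisymmetric under the exchange of the two indices, so their
total vanishes. -/
theorem qtrace_commute_skewPrimitive {J : Uq q}
    (h : Coalgebra.comul (R := ℂ) J = Uq.Kinv q ⊗ₜ[ℂ] J + J ⊗ₜ[ℂ] Uq.K q) :
    Commute (qtrace q M N) (Dq.ofU q J) := by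
  obtain ⟨j, hj⟩ : ∃ j, j = spinTensor q M N J := ⟨_, rfl⟩
  have key : ∀ p, kEig q M N p ^ 2 • (Ymat q M N p p * Dq.ofU q J) -
      kEig q M N p ^ 2 • (Dq.ofU q J * Ymat q M N p p) =
      (∑ s, (kEig q M N s * j p s) • (Ymat q M N s p * Dq.ofU q (Uq.Kinv q))) -
      ∑ s, (kEig q M N p * j s p) • (Ymat q M N p s * Dq.ofU q (Uq.Kinv q)) := by
    intro p
    have h1 := congrFun (congrFun (Ymat_commute_of_cross q M N
      (cross_Tmat_of_skewPrimitive q M N h)) p) p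
    simp only [Matrix.mul_apply, Matrix.map_apply, actL_apply_two _ h, ← hj,
      spinTensor_K, Matrix.diagonal_apply, ite_smul, zero_smul, map_add, mul_add, add_mul,
      Finset.sum_add_distrib, mul_ite, ite_mul, mul_zero, zero_mul,
      Finset.sum_ite_eq, Finset.sum_ite_eq', Finset.mem_univ, if_true, mul_smul_comm,
      smul_mul_assoc, map_smul, apply_ite (Dq.ofU q), map_zero] at h1
    -- Moving q^{-J_z} across Y_sp costs k_s / k_p, which replaces the coefficient k_p by k_s.
    have h2 : ∀ s, (kEig q M N p * j p s) • (Dq.ofU q (Uq.Kinv q) * Ymat q M N s p) =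
        (kEig q M N s * j p s) • (Ymat q M N s p * Dq.ofU q (Uq.Kinv q)) := fun s => by
      have hp := kEig_ne_zero q M N p
      have hs := kEig_ne_zero q M N s
      have h3 := congrArg (fun z => (kEig q M N p * kEig q M N s * j p s) • z)
        (Kinv_mul_Ymat q M N s p)
      simp only [smul_smul] at h3
      convert h3 using 2 <;> field_simp
    -- The coproduct of J already supplies one factor k_p, so one more gives the weight k_p² of the
    -- quantum trace.
    have h4 := congrArg (fun z => kEig q M N p • z) h1
    simp only [smul_add, Finset.smul_sum, smul_smul, h2, ← pow_two] at h4
    rw [sub_eq_sub_iff_add_eq_add, add_comm, h4]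
  rw [Commute, SemiconjBy, ← sub_eq_zero, qtrace, Finset.sum_mul, Finset.mul_sum,
    ← Finset.sum_sub_distrib]
  simp only [smul_mul_assoc, mul_smul_comm, key]
  -- The two double sums differ only by the names of p and s.
  rw [Finset.sum_sub_distrib, sub_eq_zero, Finset.sum_comm]

theorem qtrace_commute_ofU (x : Uq q) : Commute (qtrace q M N) (Dq.ofU q x) := by
  induction x using Uq.induction with
  | hc c => rw [AlgHom.commutes]; exact (Algebra.commutes _ _).symm
  | hK => exact qtrace_commute_K q M N
  | hKinv => exact qtrace_commute_Kinv q M N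
  | hJp => exact qtrace_commute_skewPrimitive q M N (Uq.comul_Jp q)
  | hJm => exact qtrace_commute_skewPrimitive q M N (Uq.comul_Jm q)
  | hadd x y hx hy => rw [map_add]; exact hx.add_right hy
  | hmul x y hx hy => rw [map_mul]; exact hx.mul_right hy

/-! ### Commutation with the restricted dual -/

theorem evalO_injective {f f' : Oq q} (h : ∀ x, evalO f x = evalO f' x) : f = f' :=
  Subtype.ext (WithConv.ofConv_injective (LinearMap.ext h))

variable (B : ℕ)

/-- The product of a matrix element of `Π_I` with one of a spin representation. -/
theorem evalO_Tmat_mul_g (p s : FinIdx M N) (n j : Fin (B + 1)) (x : Uq q) :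
    evalO (Tmat q M N p s * g q B n j) x =
      spinRep q B (actR (spinTensor q M N) x p s) n j := by
  rw [evalO_mul]
  suffices h : ∀ t : Uq q ⊗[ℂ] Uq q,
      LinearMap.mul' ℂ ℂ (TensorProduct.map (evalO (Tmat q M N p s)) (evalO (g q B n j)) t) =
      spinRep q B (Algebra.TensorProduct.lift ((legM q _).comp (spinTensor q M N)) (leg q _)
        (fun x y => (leg_comm y (spinTensor q M N x)).symm) t p s) n j from h _
  intro t
  induction t using TensorProduct.induction_on with
  | zero => simp
  | add t t' h h' => simp only [map_add, h, h', Matrix.add_apply]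
  | tmul x y =>
    have h : Algebra.TensorProduct.lift ((legM q _).comp (spinTensor q M N)) (leg q _)
        (fun x y => (leg_comm y (spinTensor q M N x)).symm) (x ⊗ₜ[ℂ] y) =
        legM q _ (spinTensor q M N x) * leg q _ y :=
      Algebra.TensorProduct.lift_tmul _ _ _ _ _
    rw [h, legM_mul_leg_apply, TensorProduct.map_tmul, LinearMap.mul'_apply, evalO_g,
      evalO_Tmat, finRep, Dq.lift_ofU, map_smul, Matrix.smul_apply, smul_eq_mul]

theorem evalO_g_mul_Tmat (p s : FinIdx M N) (n j : Fin (B + 1)) (x : Uq q) :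
    evalO (g q B n j * Tmat q M N p s) x =
      spinRep q B (actL (spinTensor q M N) x p s) n j := by
  rw [evalO_mul]
  suffices h : ∀ t : Uq q ⊗[ℂ] Uq q,
      LinearMap.mul' ℂ ℂ (TensorProduct.map (evalO (g q B n j)) (evalO (Tmat q M N p s)) t) =
      spinRep q B (Algebra.TensorProduct.lift (leg q _) ((legM q _).comp (spinTensor q M N))
        (fun x y => leg_comm x (spinTensor q M N y)) t p s) n j from h _
  intro t
  induction t using TensorProduct.induction_on with
  | zero => simp
  | add t t' h h' => simp only [map_add, h, h', Matrix.add_apply]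
  | tmul x y =>
    have h : Algebra.TensorProduct.lift (leg q _) ((legM q _).comp (spinTensor q M N))
        (fun x y => leg_comm x (spinTensor q M N y)) (x ⊗ₜ[ℂ] y) =
        leg q _ x * legM q _ (spinTensor q M N y) :=
      Algebra.TensorProduct.lift_tmul _ _ _ _ _
    rw [h, (leg_comm _ _).eq, legM_mul_leg_apply, TensorProduct.map_tmul, LinearMap.mul'_apply,
      evalO_g, evalO_Tmat, finRep, Dq.lift_ofU, map_smul, Matrix.smul_apply, smul_eq_mul, mul_comm]

/-- The exchange relation between `Tmat` and the matrix of the `g^B_{nj}`. -/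
theorem Tmat_exchange (p r : FinIdx M N) (n j : Fin (B + 1)) :
    ∑ s, ∑ i, spinRep q B (Xmat q M N s r) i j • (Tmat q M N p s * g q B n i) =
      ∑ s, ∑ i, spinRep q B (Xmat q M N p s) n i • (g q B i j * Tmat q M N s r) := by
  -- Evaluated at x, both sides become the image under π^B of the (p, r) entry of the exchange
  -- relation for `Xmat`: products in the restricted dual are paired through the coproduct of x.
  apply evalO_injective
  intro x
  have h := congrFun (congrFun (congrArg (spinRep q B)
    (congrFun (congrFun (Xmat_exchange q M N x) p) r)) n) j
  simp only [Matrix.mul_apply, map_sum, map_mul, Matrix.sum_apply] at h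
  have hs : ∀ (κ : Type) (t : Finset κ) (f : κ → Oq q),
      evalO (∑ k ∈ t, f k) x = ∑ k ∈ t, evalO (f k) x := fun κ t f => by
    let L : Oq q →+ ℂ := ⟨⟨fun f => evalO f x, rfl⟩, fun _ _ => rfl⟩
    exact map_sum L f t
  have hm : ∀ (c : ℂ) (f : Oq q), evalO (c • f) x = c * evalO f x := fun _ _ => rfl
  simp only [hs, hm, evalO_Tmat_mul_g, evalO_g_mul_Tmat]
  rw [h]
  simp only [mul_comm]

/-- The exchange relation between `Xmat` and the matrix of the `g^B_{nj}`. -/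
theorem Xmat_g_exchange (p r : FinIdx M N) (n j : Fin (B + 1)) :
    ∑ s, ∑ i, spinRep q B (Xmat q M N s r) n i •
        (Dq.ofU q (Xmat q M N p s) * Dq.ofO q (g q B i j)) =
      ∑ s, ∑ i, spinRep q B (Xmat q M N p s) i j •
        (Dq.ofO q (g q B n i) * Dq.ofU q (Xmat q M N s r)) := by
  -- The cross relation is used at x = X_pr. The coproduct of this entry is ∑ X_ps ⊗ X_sr, so both
  -- sides are written in entries of `Xmat` and their images under π^B.
  have h := Dq.cross q B n j (Xmat q M N p r)
  simp only [actL_apply_sum _ (comul_Xmat q M N p r), actR_apply_sum _ (comul_Xmat q M N p r),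
    map_sum, map_smul, Finset.sum_mul, Finset.mul_sum, smul_mul_assoc, mul_smul_comm] at h
  rw [Finset.sum_comm, h, Finset.sum_comm]

/-! ### Exchange relations with the matrix of the g^B, and commutation with the restricted dual. -/

/-- A matrix of scalars, over the quantum double. -/
abbrev scalarD : Matrix (Fin (B + 1)) (Fin (B + 1)) ℂ →ₐ[ℂ]
    Matrix (Fin (B + 1)) (Fin (B + 1)) (Dq q) := (Algebra.ofId ℂ (Dq q)).mapMatrix

/-- The matrix of the `g^B_{nj}` over the quantum double. -/
def gmat : Matrix (Fin (B + 1)) (Fin (B + 1)) (Dq q) := Matrix.of fun n j => Dq.ofO q (g q B n j)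

/-- An element of the quantum double as a scalar matrix. -/
abbrev scal : Dq q →ₐ[ℂ] Matrix (Fin (B + 1)) (Fin (B + 1)) (Dq q) :=
  Matrix.scalarAlgHom (Fin (B + 1)) ℂ

theorem scal_commute_scalarD (d : Dq q) (F : Matrix (Fin (B + 1)) (Fin (B + 1)) ℂ) :
    Commute (scal q B d) (scalarD q B F) := by
  ext i j
  simp [scal, scalarD, Algebra.ofId_apply, Algebra.commutes, Matrix.scalar]

variable {q B} in
theorem scal_mul_apply (d : Dq q) (A : Matrix (Fin (B + 1)) (Fin (B + 1)) (Dq q))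
    (n j : Fin (B + 1)) : (scal q B d * A) n j = d * A n j :=
  Matrix.diagonal_mul _ _ _ _

variable {q B} in
theorem mul_scal_apply (d : Dq q) (A : Matrix (Fin (B + 1)) (Fin (B + 1)) (Dq q))
    (n j : Fin (B + 1)) : (A * scal q B d) n j = A n j * d :=
  Matrix.mul_diagonal _ _ _ _

variable {q B} in
theorem scalarD_mul_gmat_apply (F : Matrix (Fin (B + 1)) (Fin (B + 1)) ℂ) (n j : Fin (B + 1)) :
    (scalarD q B F * gmat q B) n j = ∑ i, F n i • Dq.ofO q (g q B i j) := by
  simp only [Matrix.mul_apply, AlgHom.mapMatrix_apply, Matrix.map_apply, Algebra.ofId_apply, gmat,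
    Matrix.of_apply, Algebra.smul_def]

variable {q B} in
theorem gmat_mul_scalarD_apply (F : Matrix (Fin (B + 1)) (Fin (B + 1)) ℂ) (n j : Fin (B + 1)) :
    (gmat q B * scalarD q B F) n j = ∑ i, F i j • Dq.ofO q (g q B n i) := by
  simp only [Matrix.mul_apply, AlgHom.mapMatrix_apply, Matrix.map_apply, Algebra.ofId_apply, gmat,
    Matrix.of_apply, Algebra.smul_def, Algebra.commutes]

theorem scal_Ymat (p r : FinIdx M N) : scal q B (Ymat q M N p r) =
    ∑ t, scal q B (Dq.ofO q (Tmat q M N p t)) * scal q B (Dq.ofU q (Xmat q M N t r)) := by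
  simp only [Ymat, Matrix.mul_apply, map_sum, map_mul, Matrix.map_apply]

/-- In leg notation T₁ G₂ P₁₂ = P₁₂ G₂ T₁ with P = π^B(X). The V_I indices stay explicit, while the
V_B indices are absorbed into matrices over the double. -/
theorem Tmat_exchange_matrix (p r : FinIdx M N) :
    ∑ s, scal q B (Dq.ofO q (Tmat q M N p s)) * gmat q B *
        scalarD q B (spinRep q B (Xmat q M N s r)) =
      ∑ s, scalarD q B (spinRep q B (Xmat q M N p s)) * gmat q B *
        scal q B (Dq.ofO q (Tmat q M N s r)) := by
  ext n j
  have h := congrArg (Dq.ofO q) (Tmat_exchange q M N B p r n j)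
  simp only [map_sum, map_smul, map_mul] at h
  simpa only [Matrix.sum_apply, mul_assoc (scal q B _), scal_mul_apply, mul_scal_apply,
    scalarD_mul_gmat_apply, gmat_mul_scalarD_apply, Finset.mul_sum, Finset.sum_mul,
    mul_smul_comm, smul_mul_assoc] using h

/-- In leg notation X₁ P₁₂ G₂ = G₂ P₁₂ X₁. -/
theorem Xmat_exchange_matrix (p r : FinIdx M N) :
    ∑ s, scal q B (Dq.ofU q (Xmat q M N p s)) *
        scalarD q B (spinRep q B (Xmat q M N s r)) * gmat q B =
      ∑ s, gmat q B * scalarD q B (spinRep q B (Xmat q M N p s)) *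
        scal q B (Dq.ofU q (Xmat q M N s r)) := by
  ext n j
  simpa only [Matrix.sum_apply, mul_assoc (scal q B _), scal_mul_apply, mul_scal_apply,
    scalarD_mul_gmat_apply, gmat_mul_scalarD_apply, Finset.mul_sum, Finset.sum_mul,
    mul_smul_comm, smul_mul_assoc] using Xmat_g_exchange q M N B p r n j

/-- In leg notation T₁ X₁ P₁₂ G₂ = T₁ G₂ P₁₂ X₁ = P₁₂ G₂ T₁ X₁. The same P stands to the left of G
on both ends, and this is what lets it be cancelled under a trace. -/
theorem Ymat_exchange_matrix (p r : FinIdx M N) :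
    ∑ s, scal q B (Ymat q M N p s) * (scalarD q B (spinRep q B (Xmat q M N s r)) * gmat q B) =
      ∑ s, scalarD q B (spinRep q B (Xmat q M N p s)) * gmat q B * scal q B (Ymat q M N s r) := by
  calc _ = ∑ t, scal q B (Dq.ofO q (Tmat q M N p t)) *
        ∑ s, scal q B (Dq.ofU q (Xmat q M N t s)) *
          scalarD q B (spinRep q B (Xmat q M N s r)) * gmat q B := by
        simp only [scal_Ymat, Finset.sum_mul, Finset.mul_sum, mul_assoc]
        rw [Finset.sum_comm]
    _ = ∑ s, (∑ t, scal q B (Dq.ofO q (Tmat q M N p t)) * gmat q B *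
          scalarD q B (spinRep q B (Xmat q M N t s))) *
          scal q B (Dq.ofU q (Xmat q M N s r)) := by
        rw [Finset.sum_congr rfl fun t _ => by rw [Xmat_exchange_matrix]]
        simp only [Finset.sum_mul, Finset.mul_sum, mul_assoc]
        rw [Finset.sum_comm]
    _ = _ := by
        rw [Finset.sum_congr rfl fun t _ => by rw [Tmat_exchange_matrix]]
        simp only [scal_Ymat, Finset.sum_mul, Finset.mul_sum, mul_assoc]
        rw [Finset.sum_comm]

/-- If `Y M G = M G Y` for a matrix `M` with a left inverse `M'` whose twisted transpose inverts
that of `M`, then `G` commutes with the twisted trace of `Y`. -/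
theorem commute_twistedTrace {A ι : Type*} [Ring A] [Algebra ℂ A] [Fintype ι] [DecidableEq ι]
    {μ : ι → ℂ} {Y P P' : ι → ι → A} {G : A}
    (hY : ∀ p r, ∑ s, Y p s * (P s r * G) = ∑ s, P p s * G * Y s r)
    (hP : ∀ p r, ∑ s, P' p s * P s r = if p = r then 1 else 0)
    (hμ : ∀ s t, ∑ p, μ p • (P' p s * P t p) = if s = t then algebraMap ℂ _ (μ s) else 0)
    (hc : ∀ p s r t, Commute (Y r t) (P' p s)) : Commute (∑ p, μ p • Y p p) G := by
  -- Inserting P' P = 1 to the left of G makes `hY` applicable. The entries of Y then move left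
  -- across P', bringing the P' and P factors together.
  have h : ∀ p r, G * Y p r = ∑ s, ∑ t, Y s t * (P' p s * P t r) * G := by
    intro p r
    calc _ = ∑ t, (∑ s, P' p s * P s t) * G * Y t r := by
          simp only [hP, ite_mul, one_mul, zero_mul, Finset.sum_ite_eq, Finset.mem_univ, if_true]
      _ = ∑ s, P' p s * ∑ t, P s t * G * Y t r := by
          simp only [Finset.sum_mul, Finset.mul_sum, mul_assoc]
          rw [Finset.sum_comm]
      _ = _ := by
          refine Finset.sum_congr rfl fun s _ => ?_
          rw [← hY, Finset.mul_sum]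
          refine Finset.sum_congr rfl fun t _ => ?_
          rw [← mul_assoc, ← (hc p s s t).eq]
          simp only [mul_assoc]
  symm
  -- On the diagonal r = p, the weighted sum over p is exactly the twisted transpose relation `hμ`,
  -- which leaves only the terms s = t.
  calc G * ∑ p, μ p • Y p p = ∑ s, ∑ t, Y s t * (∑ p, μ p • (P' p s * P t p)) * G := by
        simp only [Finset.mul_sum, mul_smul_comm, h, Finset.smul_sum, Finset.sum_mul,
          smul_mul_assoc]
        rw [Finset.sum_comm]
        exact Finset.sum_congr rfl fun s _ => Finset.sum_comm
    _ = _ := by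
        simp only [hμ, mul_ite, ite_mul, mul_zero, zero_mul, Finset.sum_ite_eq, Finset.mem_univ,
          if_true, Finset.sum_mul]
        exact Finset.sum_congr rfl fun s _ => by rw [Algebra.smul_def, Algebra.commutes]

/-- The twisted trace argument is run in matrices over the double, with G the matrix of the g^B, P =
π^B(X) and P' = π^B(S(X)). The last two have scalar entries, so they commute with the entries of Y
placed on the diagonal. The (n, j) entry of the result is the claim. -/
theorem qtrace_commute_g (n j : Fin (B + 1)) :
    Commute (qtrace q M N) (Dq.ofO q (g q B n j)) := by
  have h := commute_twistedTrace (μ := fun p => kEig q M N p ^ 2)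
    (Y := fun p s => scal q B (Ymat q M N p s))
    (P := fun p s => scalarD q B (spinRep q B (Xmat q M N p s)))
    (P' := fun p s => scalarD q B (spinRep q B (antipode q (Xmat q M N p s))))
    (Ymat_exchange_matrix q M N B)
    (fun p r => by
      simp only [← map_mul, ← map_sum, antipode_mul_Xmat]
      split_ifs <;> simp only [map_one, map_zero])
    (fun s t => by
      simp only [← map_mul, ← map_smul, ← map_sum, antipode_Xmat_twisted]
      split_ifs <;> simp only [AlgHom.commutes, map_zero])
    (fun p s r t => scal_commute_scalarD q B _ _)
  have e : ∑ p, kEig q M N p ^ 2 • scal q B (Ymat q M N p p) = scal q B (qtrace q M N) := by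
    rw [qtrace, map_sum]; simp only [map_smul]
  rw [e] at h
  have h' := congrFun (congrFun h.eq n) j
  rwa [scal_mul_apply, mul_scal_apply] at h'

theorem qtrace_commute_ofO (f : Oq q) : Commute (qtrace q M N) (Dq.ofO q f) := by
  obtain ⟨f, hf⟩ := f
  induction hf using Algebra.adjoin_induction with
  | mem f hf =>
    obtain ⟨B, i, j, rfl⟩ := hf
    exact qtrace_commute_g q M N B i j
  | algebraMap c =>
    have : (⟨algebraMap ℂ _ c, Subalgebra.algebraMap_mem _ c⟩ : Oq q) = algebraMap ℂ _ c := rfl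
    rw [this, AlgHom.commutes]
    exact (Algebra.commutes _ _).symm
  | add f f' hf hf' h h' =>
    have : (⟨f + f', add_mem hf hf'⟩ : Oq q) = ⟨f, hf⟩ + ⟨f', hf'⟩ := rfl
    rw [this, map_add]
    exact h.add_right h'
  | mul f f' hf hf' h h' =>
    have : (⟨f * f', mul_mem hf hf'⟩ : Oq q) = ⟨f, hf⟩ * ⟨f', hf'⟩ := rfl
    rw [this, map_mul]
    exact h.mul_right h'

theorem cI_commute (I : FinLabel) (d : Dq q) : Commute (cI q I) d := by
  rw [cI_eq]
  induction d using Dq.induction with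
  | hc c => exact (Algebra.commutes _ _).symm
  | hU x => exact qtrace_commute_ofU q _ _ x
  | hO f => exact qtrace_commute_ofO q _ _ f
  | hadd x y hx hy => exact hx.add_right hy
  | hmul x y hx hy => exact hx.mul_right hy

end central

/-! ## The scalar -/

section scalar

variable (q : DefParam)

/-- F^n shifts the index by n s, so with s ≠ 0 only the term n = 0 reaches the diagonal. -/
theorem rmatrix_diag {q : DefParam} {N : ℕ} (W : Fin (N + 1) → Uq q) (e : Uq q) (Q : ℂ)
    {F : Matrix (Fin (N + 1)) (Fin (N + 1)) ℂ} {s : ℤ} (hs : s ≠ 0)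
    (hF : ∀ a b : Fin (N + 1), ((a : ℕ) : ℤ) ≠ (b : ℕ) + s → F a b = 0) (a : Fin (N + 1)) :
    (Matrix.diagonal W * ∑ n ∈ Finset.range (N + 1), rcoeff Q n •
      (leg q (Fin (N + 1)) e ^ n * legM q (Fin (N + 1)) F ^ n) :
        Matrix (Fin (N + 1)) (Fin (N + 1)) (Uq q)) a a = W a := by
  rw [rmatrix_entry, Finset.sum_eq_single 0]
  · simp [rcoeff_zero]
  · intro n _ hn
    rw [pow_shift hF n a a, mul_zero, zero_smul]
    have : (n : ℤ) * s ≠ 0 := mul_ne_zero (by exact_mod_cast hn) hs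
    omega
  · simp

/-- The diagonal parts of R^{(+)} and R^{(-)} are q^{±2 J_z ⊗ J_z}. Their opposite signs are what
separates the left and right parameters in the eigenvalue. -/
theorem Xmat_diag (M N : ℕ) (p : FinIdx M N) : Xmat q M N p p =
    Kpow q (((M : ℤ) - 2 * (p.1 : ℕ)) - ((N : ℤ) - 2 * (p.2 : ℕ))) := by
  rw [Xmat, Matrix.of_apply, Rminus, Rplus, rmatrix_diag _ _ _ (by norm_num) (shift_e q N),
    rmatrix_diag _ _ _ one_ne_zero (shift_f q M), ← Kpow_add, neg_add_eq_sub]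

theorem covariantVectors_Kpow {a b : ℂ} {φ : Dq q →ₗ[ℂ] ℂ} (hφ : φ ∈ covariantVectors q a b)
    (z : ℤ) (d : Dq q) : φ (Dq.ofU q (Kpow q z) * d) = qpow q ((a - b) * z) * φ d := by
  induction z using Int.induction_on generalizing d with
  | zero => simp [Kpow_zero, qpow_zero]
  | succ n ih =>
    rw [Kpow_add, Kpow_one, map_mul (Dq.ofU q), mul_assoc, ih, hφ.2, ← mul_assoc, ← qpow_add]
    congr 2; push_cast; ring
  | pred n ih =>
    -- Covariance is given for q^{J_z} only. It is applied to the translate by the lower power, and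
    -- the nonzero factor q^{a - b} is cancelled.
    have h := hφ.2 (Dq.ofU q (Kpow q (-(n : ℤ) - 1)) * d)
    rw [← mul_assoc, ← map_mul, ← Kpow_one, ← Kpow_add, add_sub_cancel, ih] at h
    apply mul_left_cancel₀ (qpow_ne_zero q (a - b))
    rw [← h, ← mul_assoc, ← qpow_add]
    congr 2; push_cast; ring

/-- The character of the spin `N / 2` representation. -/
def spinChar (N : ℕ) (x : ℂ) : ℂ := ∑ k : Fin (N + 1), qpow q (2 * wt N k * x)

/-- With c_I on the left, φ sees only the character: it selects T_pp X_pp from Y_pp, and X_pp is a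
power of q^{J_z}. For weights m, m' the total exponent, including the 2(m + m') of the quantum
trace, is 2m(2a + 1) + 2m'(2b + 1), so the sum over pairs factors. -/
theorem covariantVectors_cI (I : FinLabel) {a b : ℂ} {φ : Dq q →ₗ[ℂ] ℂ}
    (hφ : φ ∈ covariantVectors q a b) (d : Dq q) : φ (cI q I * d) =
      spinChar q I.twoL (2 * a + 1) * spinChar q I.twoR (2 * b + 1) * φ d := by
  have h : ∀ p, φ (Ymat q I.twoL I.twoR p p * d) =
      qpow q (2 * (a + b) * (wt I.twoL p.1 + wt I.twoR p.2)) *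
        (qpow q ((a - b) * (2 * wt I.twoL p.1 - 2 * wt I.twoR p.2)) * φ d) := by
    intro p
    rw [Ymat, Matrix.mul_apply, Finset.sum_mul, map_sum, Finset.sum_eq_single p]
    · rw [Matrix.map_apply, Matrix.map_apply, Tmat, Matrix.of_apply, map_mul (Dq.ofO q), mul_assoc,
        mul_assoc, hφ.1, if_pos rfl, hφ.1, if_pos rfl, Xmat_diag, covariantVectors_Kpow q hφ,
        ← mul_assoc, ← qpow_add, ← mul_add]
      congr 3
      simp only [wt]; push_cast; ring
    -- For r ≠ p at least one of the two factors of T_pr is an off-diagonal g, which φ kills.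
    · intro r _ hr
      rw [Matrix.map_apply, Matrix.map_apply, Tmat, Matrix.of_apply, map_mul (Dq.ofO q), mul_assoc,
        mul_assoc, hφ.1, hφ.1]
      by_cases h1 : p.1 = r.1
      · rw [if_pos h1, if_neg fun h2 => hr (Prod.ext h1.symm h2.symm), mul_zero]
      · rw [if_neg h1]
    · simp
  rw [cI_eq, Finset.sum_mul, map_sum, spinChar, spinChar, Finset.sum_mul_sum,
    ← Fintype.sum_prod_type', Finset.sum_mul]
  refine Finset.sum_congr rfl fun p _ => ?_
  rw [smul_mul_assoc, map_smul, h, smul_eq_mul, ← mul_assoc, ← mul_assoc, kEig, pow_two,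
    ← qpow_add, ← qpow_add, ← qpow_add, ← qpow_add]
  congr 2
  ring

/-- The representation multiplies the argument on the right, whereas covariance concerns the left.
Centrality of c_I connects the two. -/
theorem principalRep_cI (I : FinLabel) (a b : ℂ) (v : principalSpace q a b) :
    principalRep q a b (cI q I) v =
      (spinChar q I.twoL (2 * a + 1) * spinChar q I.twoR (2 * b + 1)) • v := by
  apply Subtype.ext
  ext y
  change v.1 (y * cI q I) = _ * v.1 y
  rw [← (cI_commute q I y).eq, covariantVectors_cI q I v.2.1]

/-- A geometric sum: multiplied by q^x - q^{-x}, the character telescopes. The product form is valid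
even when [x] = 0. -/
theorem spinChar_mul_qnum (N : ℕ) (x : ℂ) :
    spinChar q N x * qnum q x = qnum q ((2 * ((N : ℂ) / 2) + 1) * x) := by
  have hN : 2 * ((N : ℂ) / 2) + 1 = N + 1 := by ring
  rw [hN, qnum, qnum, mul_div_assoc', spinChar, Finset.sum_mul]
  congr 1
  -- Since 2m = N - 2k, the exponents 2m ± 1 are N + 1 - 2k and N + 1 - 2(k + 1), consecutive values
  -- of one sequence. Its end values, at k = 0 and k = N + 1, are q^{±(N+1)x}.
  have h : ∀ k : Fin (N + 1), qpow q (2 * wt N k * x) * (qpow q x - qpow q (-x)) =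
      (fun k : ℕ => qpow q ((N + 1 - 2 * k) * x)) k -
        (fun k : ℕ => qpow q ((N + 1 - 2 * k) * x)) (k + 1) := by
    intro k
    simp only [mul_sub, ← qpow_add, wt]
    congr 2 <;> push_cast <;> ring
  rw [Finset.sum_congr rfl fun k _ => h k, Fin.sum_univ_eq_sum_range
    (fun k : ℕ => (fun k : ℕ => qpow q ((N + 1 - 2 * k) * x)) k -
      (fun k : ℕ => qpow q ((N + 1 - 2 * k) * x)) (k + 1)), Finset.sum_range_sub']
  congr 2 <;> push_cast <;> ring

theorem spinChar_eq_div (N : ℕ) {x : ℂ} (hx : qnum q x ≠ 0) :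
    spinChar q N x = qnum q ((2 * ((N : ℂ) / 2) + 1) * x) / qnum q x :=
  eq_div_of_mul_eq hx (spinChar_mul_qnum q N x)

/-! ### Continuity of the characters and isolation of the zeros of quantum numbers. -/

theorem continuous_qpow : Continuous (qpow q) :=
  continuous_const.cpow continuous_id fun _ => Or.inl (by
    rw [qc, Complex.ofReal_re]; exact q.2.1)

theorem continuous_spinChar (N : ℕ) : Continuous (spinChar q N) :=
  continuous_finsetSum _ fun _ _ => (continuous_qpow q).comp (continuous_const.mul continuous_id)

/-- A zero of [x + z] forces q^{2(x+z)} = 1. The derivative of this power in z at 0 is nonzero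
because log q ≠ 0, so near 0 and away from it the value 1 is not taken. -/
theorem qnum_ne_zero_near (x : ℂ) : ∀ᶠ z in nhdsWithin (0 : ℂ) {0}ᶜ, qnum q (x + z) ≠ 0 := by
  have hq : Complex.log (qc q) ≠ 0 := by
    rw [qc, ← Complex.ofReal_log q.2.1.le, Complex.ofReal_ne_zero]
    exact (Real.log_neg q.2.1 q.2.2).ne
  have hd : HasDerivAt (fun z : ℂ => qpow q (2 * (x + z)))
      (qpow q (2 * (x + 0)) * Complex.log (qc q) * (2 * 1)) 0 :=
    (((hasDerivAt_id (0 : ℂ)).const_add x).const_mul 2).const_cpow (Or.inl (qc_ne_zero q))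
  have h := hd.eventually_ne (c := 1)
    (mul_ne_zero (mul_ne_zero (qpow_ne_zero q _) hq) (by norm_num))
  filter_upwards [h] with z hz h0
  apply hz
  rw [qnum, div_eq_zero_iff, or_iff_left (lam_ne_zero q), sub_eq_zero] at h0
  rw [two_mul, qpow_add]
  nth_rw 1 [h0]
  rw [← qpow_add, neg_add_cancel, qpow_zero]

end scalar

end QuantumLorentz

end

theorem mainTheorem8 (q : QuantumLorentz.DefParam) (I : QuantumLorentz.FinLabel)
    (α : QuantumLorentz.PrincipalLabel) :
    (∀ d : QuantumLorentz.Dq q,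
      QuantumLorentz.cI q I * d = d * QuantumLorentz.cI q I) ∧
    ∃ ϑ : ℂ,
      (∀ v : QuantumLorentz.principalSpace q α.l α.r,
        QuantumLorentz.principalRep q α.l α.r (QuantumLorentz.cI q I) v = ϑ • v) ∧
      (QuantumLorentz.qnum q (2 * α.l + 1) ≠ 0 → QuantumLorentz.qnum q (2 * α.r + 1) ≠ 0 →
        ϑ = QuantumLorentz.qnum q ((2 * I.l + 1) * (2 * α.l + 1)) /
              QuantumLorentz.qnum q (2 * α.l + 1) *
            (QuantumLorentz.qnum q ((2 * I.r + 1) * (2 * α.r + 1)) /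
              QuantumLorentz.qnum q (2 * α.r + 1))) ∧
      Filter.Tendsto
        (fun z : ℂ =>
          QuantumLorentz.qnum q ((2 * I.l + 1) * (2 * α.l + 1 + z)) /
              QuantumLorentz.qnum q (2 * α.l + 1 + z) *
            (QuantumLorentz.qnum q ((2 * I.r + 1) * (2 * α.r + 1 + z)) /
              QuantumLorentz.qnum q (2 * α.r + 1 + z)))
        (nhdsWithin 0 {0}ᶜ) (nhds ϑ) := by
  -- The scalar, fixed by unification, is the product of the two spin characters at 2α^l + 1 and
  -- 2α^r + 1, which is defined without any condition on denominators.
  refine ⟨fun d => (QuantumLorentz.cI_commute q I d).eq, _,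
    QuantumLorentz.principalRep_cI q I α.l α.r, fun hl hr => ?_, ?_⟩
  · rw [QuantumLorentz.spinChar_eq_div q _ hl, QuantumLorentz.spinChar_eq_div q _ hr]
    rfl
  · have hc : Continuous fun z : ℂ => QuantumLorentz.spinChar q I.twoL (2 * α.l + 1 + z) *
        QuantumLorentz.spinChar q I.twoR (2 * α.r + 1 + z) :=
      ((QuantumLorentz.continuous_spinChar q _).comp (continuous_const.add continuous_id)).mul
        ((QuantumLorentz.continuous_spinChar q _).comp (continuous_const.add continuous_id))
    have ht := (hc.tendsto 0).mono_left (nhdsWithin_le_nhds (s := {0}ᶜ))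
    simp only [add_zero] at ht
    -- The product of characters is continuous in z, so its limit at 0 is its value there. It
    -- suffices that it agrees with the product of quotients on a punctured neighbourhood of 0,
    -- where both denominators are nonzero.
    refine ht.congr' ?_
    filter_upwards [QuantumLorentz.qnum_ne_zero_near q (2 * α.l + 1),
      QuantumLorentz.qnum_ne_zero_near q (2 * α.r + 1)] with z hl hr
    rw [QuantumLorentz.spinChar_eq_div q _ hl, QuantumLorentz.spinChar_eq_div q _ hr]
    rfl
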